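/- For a set $X\subseteq\mathbb{R}^d$ and $x\in X$ let $A_X(x)=\{\|x-y\| : y\in X,\ y\neq x\}$, where $\|\cdot\|$ is the Euclidean norm; $X$ is called a locally $k$-distance set if $|A_X(x)|\le k$ for every $x\in X$. Two subsets of $\mathbb{R}^2$ are called similar if some similarity transformation of $\mathbb{R}^2$ (a bijection that multiplies all distances by one positive constant; reflections are allowed) maps one onto the other. Let $F\subset\mathbb{R}^2$ be the eight-point set consisting of the four vertices of a square and the apexes of the four equilateral triangles erected outwards on its sides, for example $$F=\{(\pm1,\pm1)\}\cup\{(\pm(1+\sqrt3),0)\}\cup\{(0,\pm(1+\sqrt3))\}.$$ Then every eight-point locally three-distance set in $\mathbb{R}^2$ is similar to $F$. In particular, the largest cardinality of a locally three-distance set in $\mathbb{R}^2$ is $8$: there is one with exactly $8$ points, and every locally three-distance set in $\mathbb{R}^2$ is finite with at most $8$ points. -/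

import Mathlib

/-- The Euclidean space `ℝ^d`. -/
abbrev E (d : ℕ) : Type := EuclideanSpace ℝ (Fin d)

/-- `A_X(x)`: the set of distances from `x` to the points of `X` other than `x`. -/
def distancesFrom {d : ℕ} (X : Set (E d)) (x : E d) : Set ℝ :=
  {r : ℝ | ∃ y ∈ X, x ≠ y ∧ dist x y = r}

/-- `X` is a locally `k`-distance set: `|A_X(x)| ≤ k` for all `x ∈ X`. -/
def IsLocallyDistanceSet {d : ℕ} (k : ℕ) (X : Set (E d)) : Prop :=
  ∀ x ∈ X, (distancesFrom X x).encard ≤ k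

/-- The possible cardinalities of locally `k`-distance sets in `ℝ^d` (`⊤` standing for infinite
sets). -/
def locallyDistanceSetCards (d k : ℕ) : Set ℕ∞ :=
  {n : ℕ∞ | ∃ X : Set (E d), IsLocallyDistanceSet k X ∧ X.encard = n}

/-- Two subsets of `ℝ^d` are similar if a similarity transformation of `ℝ^d` (a bijection that
multiplies all distances by the same positive number) maps one onto the other. -/
def SimilarSets {d : ℕ} (X Y : Set (E d)) : Prop :=
  ∃ f : E d ≃ᵈ E d, f '' X = Y

/-- The four vertices `(±1, ±1)` of a square of side length `2`, together with the apexes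
`(±(1 + √3), 0)`, `(0, ±(1 + √3))` of the four equilateral triangles erected outwards on its
sides. -/
noncomputable def squareWithTriangles : Set (E 2) :=
  {!₂[1, 1], !₂[-1, 1], !₂[-1, -1], !₂[1, -1],
    !₂[1 + √3, 0], !₂[0, 1 + √3], !₂[-(1 + √3), 0], !₂[0, -(1 + √3)]}

/-! Only the equalities between distances matter. Give each distance occurring in a set a colour; a
finite set then becomes a coloured complete graph, and the hypothesis says that every vertex sees at
most three colours. Geometry enters through five-point patterns. For five points of the plane, the
Gram matrix of the four vectors from one of them has rank at most two, and its entries are linear in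
the squared distances, so its `3 × 3`-minors are polynomial relations between the values of the
colours. For each pattern in `badPatterns` a combination of these minors equals a product of factors
that cannot vanish (a value, a difference of values of distinct colours, or a sum of values), so the
pattern does not occur (`not_occurs_of_mem_badPatterns`).

The rest is mostly a finite search, evaluated by the kernel. A point is added by choosing the
colours of its edges one at a time; a branch is closed when a vertex would see four colours, when a
bad five-point pattern appears, or when a four-point pattern appears that is already excluded. The
new points may be taken in the order of a key depending on their distances to the initial points,
which removes much of the symmetry. Soundness (`exists_of_search`) says that the points of an actual
set trace a branch that is never closed, hence reach a leaf accepted by the final test.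

The search yields the following. Five points of a locally three-distance set contain one of 24
four-point patterns. With eight points, 22 of these are excluded one after another, each with the
help of the previous ones. The trapezoid leaves a single eight-point pattern, and two relations
between its squared distances contradict positivity (`not_areRows_trapezoidRows`). So a set with at
least eight points contains a square (`foundIn_square`). A square cannot be extended by five points,
which bounds the cardinality, also of infinite sets; its extensions by four points all have the
pattern `squareRows`. In that pattern there are two squares, and the one with the shorter side is
the inner one: the other four points are the apexes on its sides, and coordinates give the
similarity (`similarSets_of_areRows`). -/

namespace ThreeDistance

/-!
### Patterns of five points

The functions of this section and of the section on the search are evaluated by the kernel. They are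
built from recursors and from the operations on natural numbers that the kernel knows.
-/

/-- Case distinction on a Boolean. -/
notation:max "decide!" b:max x:max y:max => @Bool.rec (fun _ => _) y x b

/-- Case distinction on a list. -/
notation "cases!" l:max d:max f => @List.rec _ (fun _ => _) d f l

/-- The colours of the ten edges of a complete graph on the vertices `0, 1, 2, 3, 4`. -/
structure Pattern where
  (e01 e02 e03 e04 e12 e13 e14 e23 e24 e34 : ℕ)

namespace Pattern

/-- Exchange the vertices `0` and `1`. -/
noncomputable def swap01 : Pattern → Pattern :=
  @Pattern.rec (fun _ => Pattern) fun a b c d e f g h i j => ⟨a, e, f, g, b, c, d, h, i, j⟩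

/-- Exchange the vertices `1` and `2`. -/
noncomputable def swap12 : Pattern → Pattern :=
  @Pattern.rec (fun _ => Pattern) fun a b c d e f g h i j => ⟨b, a, c, d, e, h, i, f, g, j⟩

/-- Exchange the vertices `2` and `3`. -/
noncomputable def swap23 : Pattern → Pattern :=
  @Pattern.rec (fun _ => Pattern) fun a b c d e f g h i j => ⟨a, c, b, d, f, e, g, h, j, i⟩

/-- Exchange the vertices `3` and `4`. -/
noncomputable def swap34 : Pattern → Pattern :=
  @Pattern.rec (fun _ => Pattern) fun a b c d e f g h i j => ⟨a, b, d, c, e, g, f, i, h, j⟩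

end Pattern

/-- The index of the first entry of `l` equal to `x` (the length of `l` if there is none). -/
noncomputable def firstIndex (x : ℕ) (l : List ℕ) : ℕ :=
  @List.rec ℕ (fun _ => ℕ) 0 (fun y _ r => decide! (Nat.beq x y) 0 (Nat.succ r)) l

/-- A code for the equalities between six colours. -/
noncomputable def edgeCode (a b c d e f : ℕ) : ℕ :=
  Nat.add (firstIndex b [a]) (Nat.mul 2 (Nat.add (firstIndex c [a, b]) (Nat.mul 3
    (Nat.add (firstIndex d [a, b, c]) (Nat.mul 4 (Nat.add (firstIndex e [a, b, c, d])
      (Nat.mul 5 (firstIndex f [a, b, c, d, e]))))))))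

/-- A code for the equalities of the colours `w, x, y, z` with one another and with six further
colours. -/
noncomputable def columnCode (a b c d e f w x y z : ℕ) : ℕ :=
  Nat.add (firstIndex w [a, b, c, d, e, f]) (Nat.mul 7
    (Nat.add (firstIndex x [a, b, c, d, e, f, w]) (Nat.mul 8
      (Nat.add (firstIndex y [a, b, c, d, e, f, w, x]) (Nat.mul 9
        (firstIndex z [a, b, c, d, e, f, w, x, y]))))))

/-- Union of bit sets. -/
noncomputable def unionBits {α : Type} (f : α → ℕ) (l : List α) : ℕ :=
  @List.rec α (fun _ => ℕ) 0 (fun x _ r => Nat.lor (f x) r) l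

/-- Membership in a bit set. -/
def hasBit (m i : ℕ) : Bool := Nat.beq (Nat.land (Nat.shiftRight m i) 1) 1

/-- `f n`, arranged so that the kernel evaluates `n` first. -/
noncomputable def force {α : Type} (n : ℕ) (f : ℕ → α) : α :=
  @Nat.rec (fun _ => α) (f 0) (fun k _ => f (Nat.succ k)) n

/-- `1` or `0`. -/
noncomputable def same (x y : ℕ) : ℕ := decide! (Nat.beq x y) 1 0

/-- An invariant of the coloured complete graph on four vertices. -/
noncomputable def invariant (a b c d e f : ℕ) : ℕ :=
  Nat.add (Nat.mul 16 (Nat.add (same a f) (Nat.add (same b e) (same c d))))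
    (Nat.add (same a b) (Nat.add (same a c) (Nat.add (same b c) (Nat.add (same a d)
      (Nat.add (same a e) (Nat.add (same d e) (Nat.add (same b d) (Nat.add (same b f)
        (Nat.add (same d f) (Nat.add (same c e) (Nat.add (same c f) (same e f))))))))))))

/-- The invariant of the four-vertex pattern with a given edge code. -/
noncomputable def invariantOfCode (n : ℕ) : ℕ :=
  invariant 0 (decide! (Nat.beq (Nat.mod n 2) 0) 0 1)
    (Nat.mod (Nat.div n 2) 3) (Nat.mod (Nat.div n 6) 4) (Nat.mod (Nat.div n 24) 5)
    (Nat.div n 120)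

namespace Pattern

/-- The code of the edges among `1, 2, 3, 4`. -/
noncomputable def code : Pattern → ℕ :=
  @Pattern.rec (fun _ => ℕ) fun _ _ _ _ a b c d e f => edgeCode a b c d e f

/-- The code of the edges at `0`. -/
noncomputable def column : Pattern → ℕ :=
  @Pattern.rec (fun _ => ℕ) fun w x y z a b c d e f => columnCode a b c d e f w x y z

/-- An invariant of the restriction to `1, 2, 3, 4`. -/
noncomputable def inv : Pattern → ℕ :=
  @Pattern.rec (fun _ => ℕ) fun _ _ _ _ a b c d e f => invariant a b c d e f

/-- All the patterns that arise by a permutation of `1, 2, 3, 4`. -/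
noncomputable def shuffles (P : Pattern) : List Pattern :=
  ([P, P.swap34].flatMap fun Q => [Q, Q.swap23, Q.swap23.swap34]).flatMap
    fun Q => [Q, Q.swap12, Q.swap12.swap23, Q.swap12.swap23.swap34]

/-- Five patterns, one for each choice of the vertex that is moved to the place `0`. -/
noncomputable def pivots (P : Pattern) : List Pattern :=
  [P, P.swap01, P.swap12.swap01, P.swap23.swap12.swap01, P.swap34.swap23.swap12.swap01]

/-- The set of the invariants of the restrictions to four of the five vertices. -/
noncomputable def invs (P : Pattern) : ℕ := unionBits (fun Q : Pattern => Nat.pow 2 Q.inv) P.pivots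

end Pattern

/-- Patterns of five points that do not occur in the plane. -/
def badPatterns : List Pattern := [
  ⟨0, 0, 0, 0, 0, 0, 0, 0, 0, 0⟩, ⟨0, 0, 0, 0, 0, 0, 0, 0, 0, 1⟩, ⟨0, 0, 0, 0, 0, 0, 1, 0, 1, 1⟩,
  ⟨0, 0, 0, 1, 0, 0, 1, 0, 2, 2⟩, ⟨0, 0, 0, 1, 0, 0, 2, 0, 0, 0⟩, ⟨0, 0, 0, 1, 0, 0, 2, 0, 2, 2⟩,
  ⟨0, 0, 0, 0, 0, 0, 0, 1, 1, 1⟩, ⟨0, 0, 0, 0, 0, 0, 0, 1, 2, 3⟩, ⟨0, 0, 0, 0, 0, 0, 1, 2, 0, 0⟩,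
  ⟨0, 0, 0, 1, 0, 0, 1, 1, 1, 1⟩, ⟨0, 0, 0, 1, 0, 0, 1, 1, 2, 2⟩, ⟨0, 0, 0, 1, 0, 0, 2, 3, 0, 0⟩,
  ⟨0, 0, 0, 1, 0, 0, 2, 3, 1, 2⟩, ⟨0, 0, 0, 1, 0, 1, 0, 1, 1, 1⟩, ⟨0, 0, 0, 1, 0, 1, 1, 1, 1, 0⟩,
  ⟨0, 0, 0, 1, 0, 2, 2, 2, 3, 1⟩, ⟨0, 0, 0, 1, 0, 2, 1, 2, 2, 2⟩, ⟨0, 0, 1, 1, 0, 0, 0, 0, 0, 0⟩,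
  ⟨0, 0, 1, 1, 0, 0, 0, 0, 2, 0⟩, ⟨0, 0, 1, 1, 0, 0, 2, 0, 1, 2⟩, ⟨0, 0, 1, 1, 0, 0, 1, 1, 0, 0⟩,
  ⟨0, 0, 1, 1, 0, 0, 0, 2, 2, 2⟩, ⟨0, 0, 1, 1, 0, 0, 2, 3, 0, 0⟩, ⟨0, 0, 1, 0, 0, 1, 0, 0, 2, 1⟩,
  ⟨0, 0, 1, 0, 0, 1, 0, 0, 2, 2⟩, ⟨0, 0, 1, 1, 0, 1, 1, 0, 2, 0⟩, ⟨0, 0, 1, 1, 0, 1, 0, 1, 0, 2⟩,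
  ⟨0, 0, 1, 1, 0, 1, 1, 1, 0, 2⟩, ⟨0, 0, 1, 2, 0, 1, 2, 1, 2, 3⟩, ⟨0, 0, 1, 0, 0, 1, 0, 2, 0, 0⟩,
  ⟨0, 0, 1, 1, 0, 1, 1, 2, 2, 0⟩, ⟨0, 0, 1, 1, 0, 1, 1, 2, 2, 1⟩, ⟨0, 0, 1, 1, 0, 1, 1, 2, 3, 2⟩,
  ⟨0, 0, 1, 1, 0, 1, 2, 2, 2, 3⟩, ⟨0, 0, 1, 2, 0, 1, 2, 2, 1, 3⟩, ⟨0, 0, 1, 2, 0, 1, 1, 3, 3, 2⟩,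
  ⟨0, 0, 1, 1, 0, 2, 3, 0, 0, 1⟩, ⟨0, 0, 1, 2, 0, 2, 3, 0, 0, 2⟩, ⟨0, 0, 1, 2, 0, 2, 1, 1, 0, 1⟩,
  ⟨0, 0, 1, 1, 0, 2, 0, 2, 0, 2⟩, ⟨0, 0, 1, 1, 0, 2, 1, 2, 1, 2⟩, ⟨0, 0, 1, 1, 0, 2, 2, 2, 2, 3⟩,
  ⟨0, 0, 1, 1, 0, 2, 3, 2, 3, 1⟩, ⟨0, 0, 1, 1, 0, 2, 3, 4, 5, 1⟩, ⟨0, 0, 0, 1, 2, 0, 3, 0, 0, 3⟩,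
  ⟨0, 0, 0, 0, 1, 1, 1, 0, 2, 2⟩, ⟨0, 0, 0, 1, 1, 1, 1, 0, 0, 0⟩, ⟨0, 0, 0, 0, 1, 1, 1, 1, 1, 1⟩,
  ⟨0, 0, 0, 0, 1, 1, 1, 1, 2, 2⟩, ⟨0, 0, 0, 0, 1, 1, 2, 1, 2, 2⟩, ⟨0, 0, 0, 1, 1, 1, 2, 1, 2, 0⟩,
  ⟨0, 0, 0, 0, 1, 1, 2, 3, 1, 1⟩, ⟨0, 0, 0, 1, 1, 1, 1, 2, 2, 1⟩, ⟨0, 0, 0, 0, 1, 2, 2, 0, 0, 1⟩,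
  ⟨0, 0, 0, 0, 1, 2, 2, 2, 2, 0⟩, ⟨0, 0, 0, 1, 1, 2, 1, 2, 2, 2⟩, ⟨0, 0, 0, 1, 2, 3, 2, 3, 2, 2⟩,
  ⟨0, 0, 0, 1, 2, 3, 2, 4, 2, 0⟩, ⟨0, 0, 1, 0, 1, 0, 0, 0, 0, 0⟩, ⟨0, 0, 1, 0, 1, 0, 0, 0, 2, 3⟩,
  ⟨0, 0, 1, 1, 1, 0, 0, 0, 0, 2⟩, ⟨0, 0, 1, 1, 1, 0, 1, 0, 1, 1⟩, ⟨0, 0, 1, 2, 1, 0, 1, 0, 2, 0⟩,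
  ⟨0, 0, 1, 2, 1, 0, 1, 0, 2, 3⟩, ⟨0, 0, 1, 2, 1, 0, 2, 0, 2, 1⟩, ⟨0, 0, 1, 2, 1, 0, 3, 0, 3, 2⟩,
  ⟨0, 0, 1, 1, 1, 0, 1, 1, 1, 1⟩, ⟨0, 0, 1, 2, 1, 0, 2, 1, 0, 1⟩, ⟨0, 0, 1, 2, 1, 0, 3, 1, 1, 1⟩,
  ⟨0, 0, 1, 2, 1, 0, 3, 1, 2, 3⟩, ⟨0, 0, 1, 0, 1, 0, 0, 2, 2, 0⟩, ⟨0, 0, 1, 0, 1, 0, 0, 2, 2, 1⟩,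
  ⟨0, 0, 1, 1, 1, 0, 0, 2, 2, 2⟩, ⟨0, 0, 1, 1, 1, 0, 2, 3, 0, 0⟩, ⟨0, 0, 1, 0, 1, 1, 0, 1, 0, 0⟩,
  ⟨0, 0, 1, 0, 1, 2, 0, 0, 2, 2⟩, ⟨0, 0, 1, 0, 1, 2, 0, 1, 0, 0⟩, ⟨0, 0, 1, 1, 1, 2, 2, 1, 1, 2⟩,
  ⟨0, 0, 1, 2, 1, 3, 0, 1, 1, 1⟩, ⟨0, 0, 1, 0, 1, 2, 0, 2, 2, 2⟩, ⟨0, 0, 1, 0, 1, 2, 2, 2, 2, 0⟩,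
  ⟨0, 0, 1, 1, 1, 2, 1, 2, 1, 1⟩, ⟨0, 0, 1, 2, 1, 2, 0, 2, 2, 0⟩, ⟨0, 0, 1, 2, 1, 2, 1, 2, 1, 1⟩,
  ⟨0, 0, 1, 2, 1, 2, 1, 2, 1, 3⟩, ⟨0, 0, 1, 2, 2, 0, 2, 0, 1, 1⟩, ⟨0, 0, 1, 2, 2, 0, 1, 0, 1, 2⟩,
  ⟨0, 0, 1, 1, 2, 0, 2, 0, 2, 1⟩, ⟨0, 0, 1, 2, 3, 0, 2, 0, 4, 4⟩, ⟨0, 0, 1, 2, 3, 0, 3, 3, 0, 0⟩,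
  ⟨0, 0, 1, 0, 2, 0, 0, 1, 2, 2⟩, ⟨0, 0, 1, 2, 2, 0, 1, 1, 2, 0⟩, ⟨0, 0, 1, 0, 2, 0, 0, 3, 0, 0⟩,
  ⟨0, 0, 1, 1, 2, 0, 2, 3, 3, 3⟩, ⟨0, 0, 1, 0, 2, 2, 1, 2, 1, 2⟩, ⟨0, 0, 1, 2, 2, 2, 0, 2, 0, 0⟩,
  ⟨0, 0, 1, 2, 2, 2, 2, 2, 2, 0⟩, ⟨0, 0, 1, 2, 2, 2, 1, 1, 2, 0⟩, ⟨0, 0, 1, 0, 2, 2, 3, 3, 2, 3⟩,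
  ⟨0, 0, 1, 2, 3, 3, 4, 4, 3, 3⟩, ⟨0, 0, 1, 1, 2, 1, 2, 0, 0, 1⟩, ⟨0, 0, 1, 2, 2, 1, 0, 2, 1, 1⟩,
  ⟨0, 0, 1, 1, 2, 1, 2, 1, 2, 3⟩, ⟨0, 0, 1, 1, 2, 1, 1, 1, 1, 2⟩, ⟨0, 0, 1, 1, 2, 1, 1, 1, 1, 1⟩,
  ⟨0, 0, 1, 2, 3, 2, 2, 0, 0, 0⟩, ⟨0, 0, 1, 1, 2, 3, 2, 1, 0, 0⟩, ⟨0, 0, 1, 0, 2, 3, 0, 3, 3, 3⟩,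
  ⟨0, 0, 1, 0, 2, 3, 3, 3, 3, 0⟩, ⟨0, 0, 1, 2, 2, 3, 0, 3, 0, 3⟩, ⟨0, 0, 1, 0, 2, 3, 3, 4, 0, 3⟩,
  ⟨0, 1, 0, 0, 0, 0, 1, 2, 1, 0⟩, ⟨0, 1, 0, 2, 0, 0, 2, 3, 3, 3⟩, ⟨0, 1, 0, 2, 0, 1, 0, 2, 0, 1⟩,
  ⟨0, 1, 0, 0, 0, 2, 0, 0, 1, 1⟩, ⟨0, 1, 0, 0, 0, 2, 2, 1, 1, 1⟩, ⟨0, 1, 1, 0, 0, 0, 1, 1, 2, 1⟩,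
  ⟨0, 1, 1, 1, 0, 0, 2, 1, 2, 2⟩, ⟨0, 1, 1, 2, 0, 0, 2, 1, 3, 0⟩, ⟨0, 1, 1, 2, 0, 0, 3, 1, 0, 0⟩,
  ⟨0, 1, 1, 1, 0, 0, 2, 3, 3, 3⟩, ⟨0, 1, 1, 1, 0, 1, 2, 0, 1, 2⟩, ⟨0, 1, 1, 2, 0, 1, 1, 1, 1, 0⟩,
  ⟨0, 1, 1, 0, 0, 1, 0, 2, 1, 3⟩, ⟨0, 1, 1, 0, 0, 2, 3, 2, 0, 0⟩, ⟨0, 1, 1, 1, 0, 2, 2, 2, 2, 1⟩,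
  ⟨0, 1, 1, 2, 0, 3, 3, 2, 0, 3⟩, ⟨0, 1, 2, 2, 0, 0, 0, 0, 0, 3⟩, ⟨0, 1, 2, 2, 0, 0, 1, 0, 2, 0⟩,
  ⟨0, 1, 2, 2, 0, 0, 1, 1, 2, 1⟩, ⟨0, 1, 2, 1, 0, 2, 2, 1, 3, 1⟩, ⟨0, 1, 2, 2, 0, 2, 0, 1, 3, 0⟩,
  ⟨0, 1, 2, 1, 0, 2, 1, 2, 2, 1⟩, ⟨0, 1, 2, 1, 0, 2, 1, 2, 2, 2⟩, ⟨0, 1, 2, 2, 0, 2, 3, 3, 0, 2⟩,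
  ⟨0, 1, 2, 1, 0, 3, 1, 1, 2, 1⟩, ⟨0, 1, 2, 1, 0, 3, 2, 3, 1, 3⟩, ⟨0, 1, 0, 2, 1, 1, 2, 0, 0, 1⟩,
  ⟨0, 1, 0, 0, 1, 1, 1, 2, 2, 1⟩, ⟨0, 1, 0, 0, 1, 1, 1, 2, 3, 0⟩, ⟨0, 1, 0, 0, 1, 1, 2, 3, 2, 0⟩,
  ⟨0, 1, 0, 0, 1, 2, 0, 2, 0, 0⟩, ⟨0, 1, 0, 1, 1, 2, 0, 2, 2, 2⟩, ⟨0, 1, 0, 2, 1, 2, 2, 2, 2, 0⟩,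
  ⟨0, 1, 0, 2, 1, 3, 0, 3, 2, 0⟩, ⟨0, 1, 0, 2, 1, 3, 3, 3, 1, 3⟩, ⟨0, 1, 0, 2, 1, 3, 0, 2, 3, 0⟩,
  ⟨0, 1, 0, 2, 1, 3, 0, 4, 4, 4⟩, ⟨0, 1, 1, 0, 1, 0, 2, 2, 2, 1⟩, ⟨0, 1, 1, 1, 1, 1, 1, 0, 0, 0⟩,
  ⟨0, 1, 1, 1, 1, 1, 1, 0, 0, 1⟩, ⟨0, 1, 1, 1, 1, 1, 2, 0, 2, 2⟩, ⟨0, 1, 1, 0, 1, 1, 0, 1, 2, 0⟩,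
  ⟨0, 1, 1, 2, 1, 1, 2, 1, 1, 2⟩, ⟨0, 1, 1, 2, 1, 1, 2, 1, 2, 2⟩, ⟨0, 1, 1, 1, 1, 1, 0, 2, 0, 0⟩,
  ⟨0, 1, 1, 1, 1, 1, 1, 2, 1, 0⟩, ⟨0, 1, 1, 1, 1, 1, 1, 2, 2, 1⟩, ⟨0, 1, 1, 1, 1, 1, 1, 2, 2, 2⟩,
  ⟨0, 1, 1, 1, 1, 1, 1, 2, 2, 3⟩, ⟨0, 1, 1, 1, 1, 1, 1, 2, 3, 0⟩, ⟨0, 1, 1, 2, 1, 1, 1, 2, 1, 3⟩,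
  ⟨0, 1, 1, 1, 1, 2, 0, 0, 0, 1⟩, ⟨0, 1, 1, 2, 1, 2, 2, 0, 0, 0⟩, ⟨0, 1, 1, 0, 1, 2, 2, 1, 0, 3⟩,
  ⟨0, 1, 1, 2, 1, 3, 1, 1, 2, 0⟩, ⟨0, 1, 2, 1, 1, 0, 2, 3, 0, 0⟩, ⟨0, 1, 2, 1, 1, 2, 1, 0, 0, 1⟩,
  ⟨0, 1, 2, 2, 1, 2, 1, 1, 1, 2⟩, ⟨0, 1, 2, 0, 1, 2, 2, 2, 0, 1⟩, ⟨0, 1, 2, 2, 1, 2, 2, 3, 1, 2⟩,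
  ⟨0, 1, 2, 2, 1, 3, 3, 1, 1, 2⟩, ⟨0, 1, 2, 2, 1, 3, 1, 4, 3, 2⟩, ⟨0, 1, 0, 2, 3, 0, 3, 0, 3, 3⟩,
  ⟨0, 1, 0, 2, 2, 0, 1, 1, 2, 3⟩, ⟨0, 1, 0, 2, 2, 0, 2, 1, 1, 3⟩, ⟨0, 1, 0, 2, 3, 0, 1, 1, 3, 1⟩,
  ⟨0, 1, 0, 0, 2, 0, 0, 3, 3, 0⟩, ⟨0, 1, 0, 0, 2, 0, 0, 3, 3, 3⟩, ⟨0, 1, 0, 1, 2, 0, 0, 3, 1, 3⟩,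
  ⟨0, 1, 0, 2, 2, 0, 1, 3, 2, 2⟩, ⟨0, 1, 0, 2, 3, 0, 4, 4, 1, 4⟩, ⟨0, 1, 0, 2, 3, 0, 2, 4, 4, 4⟩,
  ⟨0, 1, 0, 2, 2, 1, 0, 0, 0, 0⟩, ⟨0, 1, 0, 2, 2, 1, 0, 0, 0, 3⟩, ⟨0, 1, 0, 0, 2, 1, 0, 2, 1, 2⟩,
  ⟨0, 1, 0, 0, 2, 2, 2, 0, 1, 1⟩, ⟨0, 1, 0, 1, 2, 2, 0, 0, 0, 0⟩, ⟨0, 1, 0, 1, 2, 2, 0, 0, 0, 3⟩,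
  ⟨0, 1, 0, 2, 2, 2, 2, 0, 1, 1⟩, ⟨0, 1, 0, 2, 2, 2, 2, 0, 2, 0⟩, ⟨0, 1, 0, 0, 2, 2, 1, 2, 1, 0⟩,
  ⟨0, 1, 0, 2, 2, 3, 2, 0, 2, 0⟩, ⟨0, 1, 0, 2, 3, 2, 0, 4, 4, 2⟩, ⟨0, 1, 1, 0, 2, 0, 1, 0, 1, 1⟩,
  ⟨0, 1, 1, 2, 3, 0, 0, 1, 2, 4⟩, ⟨0, 1, 1, 1, 2, 1, 1, 0, 0, 3⟩, ⟨0, 1, 1, 2, 2, 1, 2, 0, 1, 1⟩,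
  ⟨0, 1, 1, 2, 2, 1, 2, 0, 1, 2⟩, ⟨0, 1, 1, 1, 2, 2, 2, 0, 0, 0⟩, ⟨0, 1, 1, 1, 2, 2, 2, 0, 1, 1⟩,
  ⟨0, 1, 1, 2, 2, 2, 1, 0, 0, 0⟩, ⟨0, 1, 1, 2, 2, 3, 3, 0, 0, 0⟩, ⟨0, 1, 2, 1, 2, 0, 2, 1, 1, 2⟩,
  ⟨0, 1, 2, 1, 2, 1, 1, 1, 2, 2⟩, ⟨0, 1, 2, 2, 2, 1, 0, 1, 2, 2⟩, ⟨0, 1, 2, 1, 2, 1, 2, 3, 1, 2⟩,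
  ⟨0, 1, 2, 2, 2, 2, 2, 0, 0, 1⟩, ⟨0, 1, 2, 0, 2, 3, 0, 4, 2, 2⟩, ⟨0, 1, 2, 2, 2, 3, 2, 4, 2, 2⟩,
  ⟨0, 1, 2, 0, 3, 0, 0, 1, 0, 2⟩, ⟨0, 1, 2, 0, 3, 3, 0, 0, 0, 0⟩, ⟨0, 1, 2, 0, 3, 3, 2, 3, 0, 2⟩,
  ⟨0, 1, 2, 1, 3, 3, 1, 3, 3, 0⟩, ⟨0, 1, 2, 2, 3, 3, 2, 2, 3, 3⟩, ⟨0, 1, 2, 2, 3, 2, 0, 3, 3, 2⟩,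
  ⟨0, 1, 2, 2, 3, 2, 2, 2, 2, 4⟩]


/-! ### The search -/

/-- The bit set of the columns that together with a four-vertex pattern of edge code `n` give a bad
pattern. -/
noncomputable def badColumns (n : ℕ) : ℕ :=
  force (invariantOfCode n) fun v =>
    unionBits (fun P : Pattern => decide! (hasBit P.invs v) (unionBits (fun Q : Pattern =>
      decide! (Nat.beq Q.inv v) (unionBits (fun R : Pattern =>
        decide! (Nat.beq R.code n) (Nat.pow 2 R.column) 0) Q.shuffles) 0) P.pivots) 0) badPatterns

/-- The bit set of the edge codes of the four-vertex patterns in a list. -/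
noncomputable def codeSet (l : List Pattern) : ℕ :=
  unionBits (fun P : Pattern => unionBits (fun Q : Pattern => Nat.pow 2 Q.code) P.shuffles) l

/-- Is the pattern with the given edges and the given column bad? -/
noncomputable def badFive (a b c d e f w x y z : ℕ) : Bool :=
  force (edgeCode a b c d e f) fun n => hasBit (badColumns n) (columnCode a b c d e f w x y z)

/-- Is there a point `a` such that the points `z, i, d, b, a` form a bad pattern? -/
noncomputable def badWithThree (zi zd zb id ib db : ℕ) (rowb : List ℕ) :
    List ℕ → List ℕ → List ℕ → Bool :=
  @List.rec ℕ (fun _ => List ℕ → List ℕ → List ℕ → Bool) (fun _ _ _ => false)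
    (fun ba _ ih rowz rowi rowd =>
      cases! rowz false fun za rowz _ => cases! rowi false fun ia rowi _ =>
        cases! rowd false fun da rowd _ =>
          decide! (badFive id ib ia db da ba zi zd zb za) true (ih rowz rowi rowd)) rowb

/-- Are there points `b, a` such that `z, i, d, b` form a forbidden pattern or `z, i, d, b, a` form
a bad pattern? -/
noncomputable def badWithTwo (forb zi zd id : ℕ) (rows : List (List ℕ)) :
    List ℕ → List ℕ → List ℕ → Bool :=
  @List.rec (List ℕ) (fun _ => List ℕ → List ℕ → List ℕ → Bool) (fun _ _ _ => false)
    (fun rowb _ ih rowz rowi rowd =>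
      cases! rowz false fun zb rowz _ => cases! rowi false fun ib rowi _ =>
        cases! rowd false fun db rowd _ =>
          decide! (hasBit forb (edgeCode zi zd zb id ib db)) true
            (decide! (badWithThree zi zd zb id ib db rowb rowz rowi rowd) true
              (ih rowz rowi rowd))) rows

/-- Are there points `d, b, a` such that `z, i, d, b` form a forbidden pattern or `z, i, d, b, a`
form a bad pattern? -/
noncomputable def badWithOne (forb zi : ℕ) (rows : List (List ℕ)) : List ℕ → List ℕ → Bool :=
  @List.rec (List ℕ) (fun _ => List ℕ → List ℕ → Bool) (fun _ _ => false)
    (fun rowd rows ih rowz rowi =>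
      cases! rowz false fun zd rowz _ => cases! rowi false fun id rowi _ =>
        decide! (badWithTwo forb zi zd id rows rowz rowi rowd) true (ih rowz rowi)) rows

/-! ### Palettes, keys and the main loop of the search. -/

/-- Length of a list. -/
noncomputable def len {α : Type} (l : List α) : ℕ :=
  @List.rec α (fun _ => ℕ) 0 (fun _ _ r => Nat.succ r) l

/-- Boolean membership in a list. -/
noncomputable def isMem (x : ℕ) (l : List ℕ) : Bool :=
  @List.rec ℕ (fun _ => Bool) false (fun y _ r => decide! (Nat.beq x y) true r) l

/-- Does `f` hold on a list? -/
noncomputable def allList {α : Type} (f : α → Bool) (l : List α) : Bool :=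
  @List.rec α (fun _ => Bool) true (fun x _ r => decide! (f x) r false) l

/-- Add `k` to the palette `l`, if the result has at most three colours, and continue with `f`. -/
noncomputable def addColour (l : List ℕ) (k : ℕ) (f : List ℕ → Bool) : Bool :=
  decide! (isMem k l) (f l) (decide! (Nat.ble 3 (len l)) true (f (k :: l)))

/-- The last `n` entries of a list. -/
noncomputable def lastEntries (n : ℕ) (l : List ℕ) : List ℕ :=
  @List.rec ℕ (fun _ => List ℕ) [] (fun x t r => decide! (Nat.ble n (len t)) r (x :: t)) l

/-- A number that encodes a list of colours, where colours from `6` on are identified. -/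
noncomputable def key (l : List ℕ) : ℕ :=
  @List.rec ℕ (fun _ => ℕ) 0 (fun x _ r => Nat.add (decide! (Nat.ble 6 x) 6 x) (Nat.mul 8 r)) l

/-- Run through all the columns of a further point `z`. The column of `z` to the oldest `n` points
has to have a key at least `prev`. -/
noncomputable def extend (forb n prev : ℕ) (rows : List (List ℕ)) :
    List (List ℕ) → List ℕ → List ℕ →
      (List ℕ → List ℕ → List (List ℕ) → List ℕ → List ℕ → Bool) → Bool :=
  @List.rec (List ℕ) (fun _ => List (List ℕ) → List ℕ → List ℕ →
      (List ℕ → List ℕ → List (List ℕ) → List ℕ → List ℕ → Bool) → Bool)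
    (fun _ known fresh cont => cont [] [] [] known fresh)
    (fun row rows ih pals known fresh cont =>
      cases! pals false fun pal pals _ =>
        ih pals known fresh fun col zpal pals known fresh =>
          decide! (decide! (Nat.beq (len row) n) (Nat.ble prev (key col)) true)
            (decide! (allList (fun k => addColour pal k fun pal => addColour zpal k fun zpal =>
                  decide! (badWithOne forb k rows col row) true
                    (cont (k :: col) zpal (pal :: pals) known fresh))
                (decide! (Nat.ble 3 (len pal)) pal known))
              (decide! (Nat.ble 3 (len pal)) true
                (cases! fresh false fun k fresh _ =>
                  addColour pal k fun pal => addColour zpal k fun zpal =>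
                    decide! (badWithOne forb k rows col row) true
                      (cont (k :: col) zpal (pal :: pals) (k :: known) fresh)))
              false)
            true) rows

/-- Add `s` further points in all possible ways to `n` given points, and test the results with
`final`. -/
noncomputable def search (forb n : ℕ) (final : List (List ℕ) → Bool) (s : ℕ) :
    ℕ → List (List ℕ) → List (List ℕ) → List ℕ → List ℕ → Bool :=
  @Nat.rec (fun _ => ℕ → List (List ℕ) → List (List ℕ) → List ℕ → List ℕ → Bool)
    (fun _ rows _ _ _ => final rows)
    (fun _ ih prev rows pals known fresh =>
      extend forb n prev rows pals known fresh fun col zpal pals known fresh =>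
        ih (key (lastEntries n col)) (col :: rows) (zpal :: pals) known fresh) s

/-- Add `k` to the list `l` if it is not there. -/
noncomputable def insertColour (k : ℕ) (l : List ℕ) : List ℕ := decide! (isMem k l) l (k :: l)

/-- The colours that are available for new distances. -/
def freshColours : List ℕ := [6, 7, 8, 9, 10, 11, 12, 13, 14, 15, 16, 17]

/-- The search that starts from a single point. -/
noncomputable def searchFromPoint (forb s : ℕ) : Bool :=
  search forb 1 (fun _ => false) s 0 [[]] [[]] [] freshColours

/-- The search that starts from the vertices `1, 2, 3, 4` of a pattern. -/
noncomputable def searchFrom (forb : ℕ) (final : List (List ℕ) → Bool) (s : ℕ) : Pattern → Bool :=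
  @Pattern.rec (fun _ => Bool) fun _ _ _ _ a b c d e f =>
    search forb 4 final s 0 [[a, b, c], [d, e], [f], []]
      [insertColour a (insertColour b [c]), insertColour a (insertColour d [e]),
        insertColour b (insertColour d [f]), insertColour c (insertColour e [f])]
      (insertColour a (insertColour b (insertColour c (insertColour d (insertColour e [f])))))
      freshColours

/-- The searches from the patterns of a list, where the patterns earlier in the list or in
`earlier` are forbidden. -/
noncomputable def searchFromAll (l : List Pattern) : List Pattern → Bool :=
  @List.rec Pattern (fun _ => List Pattern → Bool) (fun _ => true)
    (fun P _ ih earlier =>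
      decide! (force (codeSet earlier) fun forb => searchFrom forb (fun _ => false) 4 P)
        (ih (P :: earlier)) false) l

/-! ### Initial four-point patterns and surviving eight-point patterns. -/

/-- The pattern of a square. -/
def square : Pattern := ⟨0, 0, 0, 0, 0, 0, 1, 1, 0, 0⟩

/-- The pattern of an isosceles trapezoid formed by four vertices of a regular pentagon. -/
def trapezoid : Pattern := ⟨0, 0, 0, 0, 1, 0, 1, 1, 0, 0⟩

/-- The patterns of four points, in the last four places, that the search starts from after `square`
and `trapezoid`. -/
def fourPatterns : List Pattern := [
  ⟨0, 0, 0, 0, 2, 1, 0, 1, 0, 0⟩, ⟨0, 0, 0, 0, 3, 3, 3, 2, 1, 0⟩, ⟨0, 0, 0, 0, 0, 1, 2, 2, 1, 0⟩,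
  ⟨0, 0, 0, 0, 2, 2, 1, 1, 0, 0⟩, ⟨0, 0, 0, 0, 5, 4, 3, 2, 1, 0⟩, ⟨0, 0, 0, 0, 1, 1, 2, 2, 1, 0⟩,
  ⟨0, 0, 0, 0, 3, 1, 2, 2, 1, 0⟩, ⟨0, 0, 0, 0, 2, 1, 1, 1, 0, 0⟩, ⟨0, 0, 0, 0, 1, 1, 1, 1, 0, 0⟩,
  ⟨0, 0, 0, 0, 0, 0, 2, 1, 0, 0⟩, ⟨0, 0, 0, 0, 4, 3, 2, 2, 1, 0⟩, ⟨0, 0, 0, 0, 3, 3, 2, 2, 1, 0⟩,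
  ⟨0, 0, 0, 0, 2, 1, 2, 1, 0, 0⟩, ⟨0, 0, 0, 0, 2, 1, 0, 0, 0, 0⟩, ⟨0, 0, 0, 0, 3, 0, 2, 1, 1, 0⟩,
  ⟨0, 0, 0, 0, 1, 1, 1, 0, 0, 0⟩, ⟨0, 0, 0, 0, 2, 3, 2, 2, 1, 0⟩, ⟨0, 0, 0, 0, 1, 0, 0, 0, 0, 0⟩,
  ⟨0, 0, 0, 0, 3, 3, 2, 1, 0, 0⟩, ⟨0, 0, 0, 0, 4, 2, 3, 2, 1, 0⟩, ⟨0, 0, 0, 0, 2, 2, 1, 2, 1, 0⟩,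
  ⟨0, 0, 0, 0, 3, 2, 1, 0, 0, 0⟩]

/-- The pattern of `squareWithTriangles`, as the rows of the colours of the edges from each point to
the later ones. -/
def squareRows : List (List ℕ) :=
  [[6, 6, 7, 0, 0, 6, 6], [7, 6, 0, 6, 0, 6], [6, 6, 0, 6, 0], [6, 6, 0, 0],
    [0, 0, 1], [1, 0], [0], []]

/-- The pattern that extends the one of a trapezoid. -/
def trapezoidRows : List (List ℕ) :=
  [[6, 6, 7, 7, 1, 1, 6], [7, 7, 0, 7, 0, 6], [6, 1, 7, 6, 1], [7, 0, 6, 0],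
    [1, 0, 1], [1, 0], [0], []]


/-! ### Patterns that do not occur in the plane -/

/-- The pattern `P` occurs in the plane: the squared distances of five points have the values given
by some injective assignment of positive numbers to the colours. -/
def Pattern.Occurs (P : Pattern) : Prop :=
  ∃ t : ℕ → ℝ, Function.Injective t ∧ (∀ n, 0 < t n) ∧ ∃ p q r s u : E 2,
    t P.e01 = dist p q ^ 2 ∧ t P.e02 = dist p r ^ 2 ∧ t P.e03 = dist p s ^ 2 ∧
    t P.e04 = dist p u ^ 2 ∧ t P.e12 = dist q r ^ 2 ∧ t P.e13 = dist q s ^ 2 ∧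
    t P.e14 = dist q u ^ 2 ∧ t P.e23 = dist r s ^ 2 ∧ t P.e24 = dist r u ^ 2 ∧
    t P.e34 = dist s u ^ 2

theorem dist_sq_eq (p q : E 2) : dist p q ^ 2 = (p 0 - q 0) ^ 2 + (p 1 - q 1) ^ 2 := by
  rw [EuclideanSpace.dist_eq, Real.sq_sqrt (by positivity)]
  simp [Fin.sum_univ_two, Real.dist_eq, sq_abs]

/-- Twice the inner product of `a - o` and `b - o`, in terms of squared distances. -/
theorem dist_sq_add_dist_sq_sub (o a b : E 2) :
    dist o a ^ 2 + dist o b ^ 2 - dist a b ^ 2 =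
      2 * ((a 0 - o 0) * (b 0 - o 0) + (a 1 - o 1) * (b 1 - o 1)) := by
  simp only [dist_sq_eq]; ring

/-- The determinant of a `3 × 3`-matrix. -/
notation "det3" a:max b:max c:max d:max e:max f:max g:max h:max i:max =>
  a * (e * i - f * h) - b * (d * i - f * g) + c * (d * h - e * g)

/-- The `3 × 3`-minors of a Gram matrix of vectors in the plane vanish. -/
theorem det3_gram (o a b c x y z : E 2) :
    det3 (dist o a ^ 2 + dist o x ^ 2 - dist a x ^ 2) (dist o a ^ 2 + dist o y ^ 2 - dist a y ^ 2)
      (dist o a ^ 2 + dist o z ^ 2 - dist a z ^ 2) (dist o b ^ 2 + dist o x ^ 2 - dist b x ^ 2)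
      (dist o b ^ 2 + dist o y ^ 2 - dist b y ^ 2) (dist o b ^ 2 + dist o z ^ 2 - dist b z ^ 2)
      (dist o c ^ 2 + dist o x ^ 2 - dist c x ^ 2) (dist o c ^ 2 + dist o y ^ 2 - dist c y ^ 2)
      (dist o c ^ 2 + dist o z ^ 2 - dist c z ^ 2) = 0 := by
  simp only [dist_sq_add_dist_sq_sub]; ring

/-- The `3 × 3`-minors of the Gram matrix of the four vectors from one of five points to the others
vanish, where the squared distances are given by `t` and a pattern. -/
structure GramRelations (t : ℕ → ℝ) (a b c d e f g h i j : ℕ) : Prop where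
  m0 : det3 (2 * t a) (t a + t b - t e) (t a + t c - t f)
    (t b + t a - t e) (2 * t b) (t b + t c - t h)
    (t c + t a - t f) (t c + t b - t h) (2 * t c) = 0
  m1 : det3 (2 * t a) (t a + t b - t e) (t a + t d - t g)
    (t b + t a - t e) (2 * t b) (t b + t d - t i)
    (t c + t a - t f) (t c + t b - t h) (t c + t d - t j) = 0
  m2 : det3 (2 * t a) (t a + t c - t f) (t a + t d - t g)
    (t b + t a - t e) (t b + t c - t h) (t b + t d - t i)
    (t c + t a - t f) (2 * t c) (t c + t d - t j) = 0
  m3 : det3 (t a + t b - t e) (t a + t c - t f) (t a + t d - t g)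
    (2 * t b) (t b + t c - t h) (t b + t d - t i)
    (t c + t b - t h) (2 * t c) (t c + t d - t j) = 0
  m4 : det3 (2 * t a) (t a + t b - t e) (t a + t d - t g)
    (t b + t a - t e) (2 * t b) (t b + t d - t i)
    (t d + t a - t g) (t d + t b - t i) (2 * t d) = 0
  m5 : det3 (2 * t a) (t a + t c - t f) (t a + t d - t g)
    (t b + t a - t e) (t b + t c - t h) (t b + t d - t i)
    (t d + t a - t g) (t d + t c - t j) (2 * t d) = 0
  m6 : det3 (t a + t b - t e) (t a + t c - t f) (t a + t d - t g)
    (2 * t b) (t b + t c - t h) (t b + t d - t i)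
    (t d + t b - t i) (t d + t c - t j) (2 * t d) = 0
  m7 : det3 (2 * t a) (t a + t c - t f) (t a + t d - t g)
    (t c + t a - t f) (2 * t c) (t c + t d - t j)
    (t d + t a - t g) (t d + t c - t j) (2 * t d) = 0
  m8 : det3 (t a + t b - t e) (t a + t c - t f) (t a + t d - t g)
    (t c + t b - t h) (2 * t c) (t c + t d - t j)
    (t d + t b - t i) (t d + t c - t j) (2 * t d) = 0
  m9 : det3 (2 * t b) (t b + t c - t h) (t b + t d - t i)
    (t c + t b - t h) (2 * t c) (t c + t d - t j)
    (t d + t b - t i) (t d + t c - t j) (2 * t d) = 0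

/-- The Gram relations hold for the squared distances of any five points. -/
theorem gramRelations {t : ℕ → ℝ} {a b c d e f g h i j : ℕ} {p q r s u : E 2}
    (h1 : t a = dist p q ^ 2) (h2 : t b = dist p r ^ 2) (h3 : t c = dist p s ^ 2)
    (h4 : t d = dist p u ^ 2) (h5 : t e = dist q r ^ 2) (h6 : t f = dist q s ^ 2)
    (h7 : t g = dist q u ^ 2) (h8 : t h = dist r s ^ 2) (h9 : t i = dist r u ^ 2)
    (h10 : t j = dist s u ^ 2) : GramRelations t a b c d e f g h i j := by
  have hself : ∀ y : E 2, 2 * dist p y ^ 2 = dist p y ^ 2 + dist p y ^ 2 - dist y y ^ 2 := by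
    intro y; rw [dist_self]; ring
  constructor <;> simp only [h1, h2, h3, h4, h5, h6, h7, h8, h9, h10, hself]
  · simpa only [dist_comm] using det3_gram p q r s q r s
  · simpa only [dist_comm] using det3_gram p q r s q r u
  · simpa only [dist_comm] using det3_gram p q r s q s u
  · simpa only [dist_comm] using det3_gram p q r s r s u
  · simpa only [dist_comm] using det3_gram p q r u q r u
  · simpa only [dist_comm] using det3_gram p q r u q s u
  · simpa only [dist_comm] using det3_gram p q r u r s u
  · simpa only [dist_comm] using det3_gram p q s u q s u
  · simpa only [dist_comm] using det3_gram p q s u r s u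
  · simpa only [dist_comm] using det3_gram p r s u r s u

/-- A pattern does not occur if the vanishing of the `3 × 3`-minors of the Gram matrix implies the
vanishing of some product of nonzero terms. -/
theorem not_occurs {a b c d e f g h i j : ℕ} (x : (ℕ → ℝ) → ℝ)
    (H : ∀ t, GramRelations t a b c d e f g h i j → x t = 0)
    (hx : ∀ t : ℕ → ℝ, Function.Injective t → (∀ n, t n ≠ 0) → (∀ m n, t m + t n ≠ 0) →
      (∀ l m n, t l + t m + t n ≠ 0) → x t ≠ 0 := by
        intro t ht h1 h2 h3; simp [sub_eq_zero, ht.eq_iff, h1, h2, h3]) :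
    ¬ Pattern.Occurs ⟨a, b, c, d, e, f, g, h, i, j⟩ := by
  rintro ⟨t, ht, hp, p, q, r, s, u, h1, h2, h3, h4, h5, h6, h7, h8, h9, h10⟩
  exact hx t ht (fun n => (hp n).ne') (fun m n => (add_pos (hp m) (hp n)).ne')
    (fun l m n => (add_pos (add_pos (hp l) (hp m)) (hp n)).ne')
    (H t (gramRelations h1 h2 h3 h4 h5 h6 h7 h8 h9 h10))

theorem forall_mem_cons {α : Type} {p : α → Prop} {a : α} {l : List α} (h : p a)
    (H : ∀ x ∈ l, p x) : ∀ x ∈ a :: l, p x :=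
  List.forall_mem_cons.2 ⟨h, H⟩

-- Every case is a polynomial identity: the first argument of `not_occurs` is the product of nonzero
-- factors, and the coefficients given to `linear_combination` express it through the Gram minors.
-- That the factors do not vanish is left to the default proof of `hx`, which uses that distinct
-- colours have distinct positive values.
set_option maxHeartbeats 4000000 in
theorem not_occurs_of_mem_badPatterns : ∀ P ∈ badPatterns, ¬ P.Occurs := by
  unfold badPatterns
  refine forall_mem_cons (not_occurs (fun t => t 0 * t 0 * t 0) fun _ m => by
    linear_combination 1/4 * m.m9) ?_
  refine forall_mem_cons (not_occurs (fun t => t 0 * t 0 * t 1) fun _ m => by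
    linear_combination -m.m6) ?_
  refine forall_mem_cons (not_occurs (fun t => t 0 * t 0 * t 0) fun _ m => by
    linear_combination 1/4 * m.m0) ?_
  refine forall_mem_cons (not_occurs (fun t => t 0 * t 0 * t 0) fun _ m => by
    linear_combination 1/4 * m.m0) ?_
  refine forall_mem_cons (not_occurs (fun t => t 0 * t 0 * t 0) fun _ m => by
    linear_combination 1/4 * m.m0) ?_
  refine forall_mem_cons (not_occurs (fun t => t 0 * t 0 * t 0) fun _ m => by
    linear_combination 1/4 * m.m0) ?_
  refine forall_mem_cons (not_occurs (fun t => t 0 * t 1 * t 1) fun _ m => by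
    linear_combination m.m8) ?_
  refine forall_mem_cons (not_occurs (fun t => t 1 * t 2 * t 3) fun _ m => by
    linear_combination m.m3 - m.m6 + m.m8 - 1/2 * m.m9) ?_
  refine forall_mem_cons (not_occurs (fun t => t 0 * t 1 * t 2) fun _ m => by
    linear_combination m.m8) ?_
  refine forall_mem_cons (not_occurs (fun t => t 0 * t 0 * t 1) fun _ m => by
    linear_combination -m.m2) ?_
  refine forall_mem_cons (not_occurs (fun t => t 0 * t 1 * t 2) fun _ m => by
    linear_combination 1/22 * m.m0 + 2/11 * m.m3 + 7/11 * m.m8) ?_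
  refine forall_mem_cons (not_occurs (fun t => t 0 * t 1 * t 3 * (t 0 - t 1)) fun t m => by
    linear_combination -1/2 * t 1 * m.m0 + 1/2 * t 0 * m.m9) ?_
  refine forall_mem_cons (not_occurs (fun t => t 0 * t 0 * t 3) fun _ m => by
    linear_combination 1/2 * m.m1 - 1/2 * m.m2) ?_
  refine forall_mem_cons (not_occurs (fun t => t 0 * t 0 * (t 0 + t 1)) fun _ m => by
    linear_combination -3 * m.m3 + m.m6 + 3/2 * m.m9) ?_
  refine forall_mem_cons (not_occurs (fun t => t 0 * t 0 * t 1) fun _ m => by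
    linear_combination -1/7 * m.m1 + 2/7 * m.m4) ?_
  refine forall_mem_cons (not_occurs (fun t => t 0 * (t 0 - t 1) * (t 1 - t 2)) fun _ m => by
    linear_combination -1/2 * m.m1 + 1/2 * m.m4 + 1/2 * m.m8 - 1/2 * m.m9) ?_
  refine forall_mem_cons (not_occurs (fun t => t 0 * t 0 * t 2) fun _ m => by
    linear_combination -m.m1 - 1/2 * m.m2 + 1/2 * m.m3 + m.m4 - 1/2 * m.m7 + m.m8 - 1/2 * m.m9) ?_
  refine forall_mem_cons (not_occurs (fun t => t 0 * t 0 * t 1) fun _ m => by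
    linear_combination -m.m6) ?_
  refine forall_mem_cons (not_occurs (fun t => t 0 * t 0 * (t 0 + t 1)) fun _ m => by
    linear_combination m.m0 + 1/2 * m.m2 - 1/2 * m.m3 - m.m8) ?_
  refine forall_mem_cons (not_occurs (fun t => t 0 * t 0 * t 1) fun _ m => by
    linear_combination 1/2 * m.m0 + 1/2 * m.m2 - 1/2 * m.m3) ?_
  refine forall_mem_cons (not_occurs (fun t => t 0 * t 1 * t 1) fun _ m => by
    linear_combination 1/3 * m.m4 - 1/3 * m.m5) ?_
  refine forall_mem_cons (not_occurs (fun t => t 0 * t 0 * t 2) fun _ m => by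
    linear_combination -1/3 * m.m1 + 1/3 * m.m4) ?_
  refine forall_mem_cons (not_occurs (fun t => t 0 * (t 0 - t 1) * (t 2 - t 3)) fun _ m => by
    linear_combination -1/2 * m.m2 + 1/2 * m.m6) ?_
  refine forall_mem_cons (not_occurs (fun t => t 0 * t 0 * (t 0 + t 1)) fun _ m => by
    linear_combination m.m4 - m.m5 + 2 * m.m6 + 1/2 * m.m7 - m.m8) ?_
  refine forall_mem_cons (not_occurs (fun t => t 0 * t 0 * t 0) fun _ m => by
    linear_combination 4/11 * m.m1 + 1/11 * m.m3 - 5/11 * m.m6 + 1/11 * m.m8) ?_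
  refine forall_mem_cons (not_occurs (fun t => t 0 * t 0 * t 2) fun _ m => by
    linear_combination 2/3 * m.m3 - 1/6 * m.m5 + 1/2 * m.m8) ?_
  refine forall_mem_cons (not_occurs (fun t => t 0 * t 0 * t 2) fun _ m => by
    linear_combination -1/4 * m.m1 + 1/4 * m.m3 + 1/4 * m.m4) ?_
  refine forall_mem_cons (not_occurs (fun t => t 0 * t 0 * (t 0 + t 1)) fun _ m => by
    linear_combination -3 * m.m0 + 2 * m.m1 + 3/2 * m.m4 - 3 * m.m6 + 3/2 * m.m7 - 3 * m.m8) ?_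
  refine forall_mem_cons (not_occurs (fun t => t 0 * t 0 * (t 1 - t 2)) fun _ m => by
    linear_combination 1/6 * m.m0 - 1/6 * m.m4) ?_
  refine forall_mem_cons (not_occurs (fun t => t 0 * t 0 * t 0) fun _ m => by
    linear_combination 1/4 * m.m4) ?_
  refine forall_mem_cons (not_occurs (fun t => t 0 * t 0 * (t 1 + t 2)) fun _ m => by
    linear_combination -m.m6 + 1/4 * m.m7) ?_
  refine forall_mem_cons (not_occurs (fun t => t 0 * t 0 * t 1) fun _ m => by
    linear_combination -2/3 * m.m6 + 1/6 * m.m7 - 1/3 * m.m8) ?_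
  refine forall_mem_cons (not_occurs (fun t => t 0 * t 3 * (t 1 - t 2)) fun _ m => by
    linear_combination 1/3 * m.m2 - 1/3 * m.m3 + 1/3 * m.m7 - 2/3 * m.m8) ?_
  refine forall_mem_cons (not_occurs (fun t => t 0 * t 0 * (t 1 - t 2)) fun _ m => by
    linear_combination 1/2 * m.m0 - 1/2 * m.m4) ?_
  refine forall_mem_cons (not_occurs (fun t => t 0 * t 0 * (t 1 - t 2)) fun _ m => by
    linear_combination 1/2 * m.m0 - 1/2 * m.m4) ?_
  refine forall_mem_cons (not_occurs (fun t => t 0 * t 0 * (t 1 - t 2)) fun _ m => by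
    linear_combination 1/2 * m.m0 - 1/2 * m.m1 - 1/2 * m.m3 - 1/2 * m.m5 + 1/2 * m.m6) ?_
  refine forall_mem_cons (not_occurs (fun t => t 1 * (t 0 - t 2) * (t 0 - t 3)) fun _ m => by
    linear_combination -m.m2 + 1/2 * m.m3 + m.m5 - 1/2 * m.m6 - 1/2 * m.m7 + m.m8 - 1/2 * m.m9) ?_
  refine forall_mem_cons (not_occurs (fun t => t 1 * t 3 * (t 1 - t 3)) fun _ m => by
    linear_combination m.m2 + 1/2 * m.m7 - m.m8) ?_
  refine forall_mem_cons (not_occurs (fun t => t 0 * t 1 * (t 0 - t 1)) fun _ m => by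
    linear_combination -1/3 * m.m0 - 1/6 * m.m1 + 1/6 * m.m3 + 1/3 * m.m4) ?_
  refine forall_mem_cons (not_occurs (fun t => t 0 * t 0 * t 2) fun _ m => by
    linear_combination -2/5 * m.m1 - 1/5 * m.m3 + 2/5 * m.m4 + 3/5 * m.m6 - 1/5 * m.m8 + 1/5 *
      m.m9) ?_
  refine forall_mem_cons (not_occurs (fun t => t 0 * t 0 * t 0) fun _ m => by
    linear_combination -1/2 * m.m0 - 1/2 * m.m1 + m.m3 + 1/2 * m.m4 - 1/2 * m.m6) ?_
  refine forall_mem_cons (not_occurs (fun t => t 0 * t 0 * t 3) fun _ m => by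
    linear_combination -1/3 * m.m1 + 1/3 * m.m4) ?_
  refine forall_mem_cons (not_occurs (fun t => t 0 * t 1 * (t 2 - t 3)) fun _ m => by
    linear_combination 1/3 * m.m3 + 1/3 * m.m6) ?_
  -- The minors are cubic in the squared distances. This product has degree four, so the
  -- coefficients of the minors are themselves linear in `t`.
  refine forall_mem_cons (not_occurs (fun t => t 0 * t 1 * (t 2 - t 5) * (t 3 - t 4)) fun t m => by
    linear_combination -1/2 * t 1 * m.m0 - 1/2 * t 1 * m.m4 + 1/2 * t 0 * m.m7 + 1/2 * t 0 * m.m9)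
      ?_
  refine forall_mem_cons (not_occurs (fun t => t 0 * t 1 * t 2) fun _ m => by
    linear_combination -1/2 * m.m2 + 1/2 * m.m3) ?_
  refine forall_mem_cons (not_occurs (fun t => t 0 * t 0 * t 0) fun _ m => by
    linear_combination -1/2 * m.m0 - m.m5 + m.m7) ?_
  refine forall_mem_cons (not_occurs (fun t => t 0 * t 1 * t 1) fun _ m => by
    linear_combination -m.m8 + 1/2 * m.m9) ?_
  refine forall_mem_cons (not_occurs (fun t => t 1 * t 1 * t 1) fun _ m => by
    linear_combination -3 * m.m8 + m.m9) ?_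
  refine forall_mem_cons (not_occurs (fun t => t 0 * t 1 * t 1) fun _ m => by
    linear_combination 1/2 * m.m0 + m.m3 - 2 * m.m8) ?_
  refine forall_mem_cons (not_occurs (fun t => t 0 * t 1 * t 1) fun _ m => by
    linear_combination -m.m8 + 1/2 * m.m9) ?_
  refine forall_mem_cons (not_occurs (fun t => t 1 * t 1 * t 1) fun _ m => by
    linear_combination 4 * m.m0 - 3 * m.m1 - 6 * m.m3 + 6 * m.m6) ?_
  refine forall_mem_cons (not_occurs (fun t => t 2 * t 3 * (t 2 - t 3)) fun _ m => by
    linear_combination -m.m3 + m.m5 - m.m7 + m.m9) ?_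
  refine forall_mem_cons (not_occurs (fun t => t 0 * t 1 * t 1) fun _ m => by
    linear_combination 1/6 * m.m0 - 1/6 * m.m4 - 1/6 * m.m5 + 1/3 * m.m7 - 1/6 * m.m8) ?_
  refine forall_mem_cons (not_occurs (fun t => t 0 * t 1 * t 1) fun _ m => by
    linear_combination -m.m1 + m.m4 - m.m6 + m.m8 - m.m9) ?_
  refine forall_mem_cons (not_occurs (fun t => t 0 * t 1 * (t 0 + t 2)) fun _ m => by
    linear_combination m.m6 - m.m8 + m.m9) ?_
  refine forall_mem_cons (not_occurs (fun t => t 0 * t 0 * t 2) fun _ m => by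
    linear_combination m.m0 + m.m2 - m.m3 - 1/2 * m.m4 - m.m8 + 1/2 * m.m9) ?_
  refine forall_mem_cons (not_occurs (fun t => t 1 * t 2 * t 2) fun _ m => by
    linear_combination -1/2 * m.m4 - m.m8 + m.m9) ?_
  refine forall_mem_cons (not_occurs (fun t => (t 0 - t 2) * (t 0 - t 3) * (t 0 - t 4) * (t 3 -
      t 4)) fun t m => by
    linear_combination (-1/2 * t 0 + 1/2 * t 2) * m.m0 - 1/2 * t 4 * m.m1 + (-1/2 * t 2 + t 3) *
      m.m3 + 1/2 * t 4 * m.m7 - 1/2 * t 3 * m.m9) ?_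
  refine forall_mem_cons (not_occurs (fun t => t 0 * t 1 * t 1) fun _ m => by
    linear_combination -m.m6) ?_
  refine forall_mem_cons (not_occurs (fun t => t 0 * t 1 * (t 2 - t 3)) fun _ m => by
    linear_combination 1/4 * m.m1 + 1/4 * m.m2) ?_
  refine forall_mem_cons (not_occurs (fun t => t 1 * t 1 * t 2) fun _ m => by
    linear_combination -m.m6) ?_
  refine forall_mem_cons (not_occurs (fun t => t 1 * t 1 * (t 0 + t 1)) fun _ m => by
    linear_combination m.m3 - m.m6) ?_
  refine forall_mem_cons (not_occurs (fun t => t 0 * t 0 * t 1) fun _ m => by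
    linear_combination 1/2 * m.m0 - 1/4 * m.m1 + 1/2 * m.m2 - 1/4 * m.m3) ?_
  refine forall_mem_cons (not_occurs (fun t => t 0 * t 1 * (t 1 - t 3)) fun _ m => by
    linear_combination 1/4 * m.m1 - 1/4 * m.m3) ?_
  refine forall_mem_cons (not_occurs (fun t => t 0 * t 1 * t 2) fun _ m => by
    linear_combination 1/3 * m.m1 + 1/3 * m.m3 - 1/3 * m.m6) ?_
  refine forall_mem_cons (not_occurs (fun t => t 1 * t 1 * (t 2 - t 3)) fun _ m => by
    linear_combination -1/8 * m.m0 + 1/2 * m.m3) ?_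
  refine forall_mem_cons (not_occurs (fun t => t 0 * t 1 * t 1) fun _ m => by
    linear_combination 3/2 * m.m7 - m.m8 - m.m9) ?_
  refine forall_mem_cons (not_occurs (fun t => t 0 * t 0 * (t 0 + t 1)) fun _ m => by
    linear_combination 1/2 * m.m4 - 2 * m.m5 + 3 * m.m6 - 1/2 * m.m7 - m.m8 + 2 * m.m9) ?_
  refine forall_mem_cons (not_occurs (fun t => t 0 * (t 0 + t 1) * (t 2 - t 3)) fun _ m => by
    linear_combination -1/2 * m.m0 + m.m1 + m.m3) ?_
  refine forall_mem_cons (not_occurs (fun t => t 1 * (t 0 + t 1) * (t 2 - t 3)) fun _ m => by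
    linear_combination -m.m0 + 1/2 * m.m1 - 3/2 * m.m2 + 2 * m.m3) ?_
  refine forall_mem_cons (not_occurs (fun t => t 0 * t 0 * t 1) fun _ m => by
    linear_combination 1/6 * m.m2 + 1/3 * m.m7 - 1/6 * m.m8) ?_
  refine forall_mem_cons (not_occurs (fun t => t 0 * t 0 * (t 0 + t 2)) fun _ m => by
    linear_combination 3/2 * m.m2 - 1/2 * m.m3 + 2 * m.m4 + 5/2 * m.m5 - 7/2 * m.m6 - m.m7 + 2 *
      m.m8 - 2 * m.m9) ?_
  refine forall_mem_cons (not_occurs (fun t => t 0 * t 2 * t 2) fun _ m => by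
    linear_combination -m.m1 + m.m4 - 1/2 * m.m7) ?_
  refine forall_mem_cons (not_occurs (fun t => (t 0 + t 1) * (t 0 - t 1) * (t 2 - t 3)) fun _ m =>
      by
    linear_combination -1/2 * m.m2 + 1/2 * m.m6) ?_
  refine forall_mem_cons (not_occurs (fun t => t 0 * t 1 * t 1) fun _ m => by
    linear_combination m.m3) ?_
  refine forall_mem_cons (not_occurs (fun t => t 0 * t 0 * (t 0 - t 2)) fun _ m => by
    linear_combination 1/6 * m.m2 + 1/3 * m.m4 - 1/3 * m.m5 - 1/6 * m.m7 - 1/6 * m.m8) ?_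
  refine forall_mem_cons (not_occurs (fun t => t 0 * t 0 * t 2) fun _ m => by
    linear_combination 1/2 * m.m3 + 1/2 * m.m5) ?_
  refine forall_mem_cons (not_occurs (fun t => t 0 * t 1 * t 2) fun _ m => by
    linear_combination -1/3 * m.m1 + 1/3 * m.m4 - 1/9 * m.m5 + 2/9 * m.m6 - 1/9 * m.m8 + 1/9 *
      m.m9) ?_
  refine forall_mem_cons (not_occurs (fun t => t 3 * (t 0 - t 1) * (t 0 - t 2)) fun _ m => by
    linear_combination -1/2 * m.m1 - 1/2 * m.m3 - 1/2 * m.m5 + 1/2 * m.m6 + 1/2 * m.m9) ?_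
  refine forall_mem_cons (not_occurs (fun t => t 0 * t 1 * t 1) fun _ m => by
    linear_combination 1/2 * m.m1 + 1/2 * m.m2 + 1/2 * m.m5 - 1/2 * m.m6) ?_
  refine forall_mem_cons (not_occurs (fun t => t 0 * t 1 * (t 1 + t 2)) fun _ m => by
    linear_combination -1/6 * m.m1 - 2/3 * m.m3 + 1/6 * m.m4 + 1/3 * m.m6 - 5/6 * m.m8 + 5/6 *
      m.m9) ?_
  refine forall_mem_cons (not_occurs (fun t => t 0 * t 1 * t 1) fun _ m => by
    linear_combination 2/3 * m.m3 - 1/3 * m.m6) ?_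
  refine forall_mem_cons (not_occurs (fun t => t 0 * t 1 * t 2) fun _ m => by
    linear_combination -1/6 * m.m1 + 1/6 * m.m5 + 1/6 * m.m6 - 1/6 * m.m8 + 1/3 * m.m9) ?_
  refine forall_mem_cons (not_occurs (fun t => t 0 * t 1 * t 2) fun _ m => by
    linear_combination 9 * m.m1 + 18 * m.m3 - 9 * m.m4 - 19 * m.m6 + 3 * m.m8 - 3 * m.m9) ?_
  refine forall_mem_cons (not_occurs (fun t => t 1 * t 1 * (t 1 - t 2)) fun _ m => by
    linear_combination -1/2 * m.m0 + 1/2 * m.m4) ?_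
  refine forall_mem_cons (not_occurs (fun t => t 0 * t 0 * t 1) fun _ m => by
    linear_combination 5/6 * m.m0 - 1/2 * m.m1 + 2/3 * m.m2 - 1/3 * m.m3 - 1/3 * m.m5 + 1/6 * m.m7
      - 1/2 * m.m8 - 1/6 * m.m9) ?_
  refine forall_mem_cons (not_occurs (fun t => t 1 * t 2 * (t 0 + t 1)) fun _ m => by
    linear_combination 3/5 * m.m1 + 2/5 * m.m3 - m.m6) ?_
  refine forall_mem_cons (not_occurs (fun t => t 1 * t 1 * t 2) fun _ m => by
    linear_combination 1/3 * m.m3 - 2/3 * m.m6) ?_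
  refine forall_mem_cons (not_occurs (fun t => t 1 * t 3 * (t 1 - t 3)) fun _ m => by
    linear_combination 1/2 * m.m0 + m.m2 - m.m3) ?_
  refine forall_mem_cons (not_occurs (fun t => t 0 * (t 0 + t 3) * (t 1 - t 2)) fun _ m => by
    linear_combination 1/2 * m.m0 + m.m2 - 1/2 * m.m4 - m.m6 + 1/2 * m.m7 - 1/2 * m.m9) ?_
  refine forall_mem_cons (not_occurs (fun t => t 0 * t 0 * t 2) fun _ m => by
    linear_combination -1/3 * m.m2 - 1/6 * m.m4 + 2/3 * m.m5 - 1/3 * m.m6 + 1/3 * m.m8) ?_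
  refine forall_mem_cons (not_occurs (fun t => t 0 * t 0 * (t 0 + t 1)) fun _ m => by
    linear_combination 1/2 * m.m0 - 9/4 * m.m1 + 3/4 * m.m2 - 9/4 * m.m3 + 5/4 * m.m4 - 5/4 * m.m5
      + 5/2 * m.m6 - m.m8 + 5/4 * m.m9) ?_
  refine forall_mem_cons (not_occurs (fun t => t 0 * (t 0 - t 3) * (t 1 - t 2)) fun _ m => by
    linear_combination 1/2 * m.m2 - 1/2 * m.m5 + 1/2 * m.m6 + 1/2 * m.m7 - 1/2 * m.m8) ?_
  refine forall_mem_cons (not_occurs (fun t => t 3 * t 3 * (t 1 - t 2)) fun _ m => by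
    linear_combination -1/2 * m.m0 + 1/2 * m.m1 - m.m2 + m.m3 + 1/2 * m.m5 - 1/2 * m.m6 - 1/2 *
      m.m7 + 1/2 * m.m8) ?_
  refine forall_mem_cons (not_occurs (fun t => t 0 * t 2 * (t 1 + t 2)) fun _ m => by
    linear_combination -5/2 * m.m0 + 3 * m.m3 - 1/2 * m.m4 - 5 * m.m6 - 2 * m.m8 + 2 * m.m9) ?_
  refine forall_mem_cons (not_occurs (fun t => t 2 * t 2 * t 2) fun _ m => by
    linear_combination -m.m0 + m.m1 + 2 * m.m3 + 1/4 * m.m4 - m.m6) ?_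
  refine forall_mem_cons (not_occurs (fun t => t 0 * t 2 * (t 0 + t 2)) fun _ m => by
    linear_combination -3/2 * m.m0 + m.m1 + 3 * m.m3 + 1/2 * m.m4 - 2 * m.m6) ?_
  refine forall_mem_cons (not_occurs (fun t => t 0 * t 0 * (t 1 + t 2)) fun _ m => by
    linear_combination 17/14 * m.m0 - 12/7 * m.m1 + 1/8 * m.m2 - 15/7 * m.m3 + 1/2 * m.m4 + 3/56 *
      m.m5 + 31/14 * m.m6 - 3/7 * m.m8 + 3/7 * m.m9) ?_
  refine forall_mem_cons (not_occurs (fun t => t 3 * (t 2 + t 3) * (t 0 - t 1)) fun _ m => by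
    linear_combination -1/2 * m.m0 + m.m3 + 1/2 * m.m4 - m.m5 + 1/2 * m.m7 - 1/2 * m.m9) ?_
  refine forall_mem_cons (not_occurs (fun t => t 3 * t 4 * (t 1 - t 2)) fun _ m => by
    linear_combination 1/4 * m.m0 + 1/4 * m.m2 - 1/4 * m.m3 - 1/4 * m.m4 + 1/4 * m.m5 - 1/4 * m.m6)
      ?_
  refine forall_mem_cons (not_occurs (fun t => t 0 * t 0 * t 1) fun _ m => by
    linear_combination -1/2 * m.m3 - 2 * m.m5 + m.m6 - 3/2 * m.m8 + 3/2 * m.m9) ?_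
  refine forall_mem_cons (not_occurs (fun t => t 0 * t 0 * t 2) fun _ m => by
    linear_combination 3/2 * m.m1 - m.m2 - m.m4 + m.m5 - m.m6 + 1/2 * m.m8) ?_
  refine forall_mem_cons (not_occurs (fun t => t 2 * t 3 * (t 0 - t 1) * (t 0 - t 1)) fun t m => by
    linear_combination -1/2 * t 3 * m.m0 + t 1 * m.m3 - t 1 * m.m6) ?_
  refine forall_mem_cons (not_occurs (fun t => t 0 * t 2 * t 2) fun _ m => by
    linear_combination -m.m6) ?_
  refine forall_mem_cons (not_occurs (fun t => t 0 * t 1 * t 2) fun _ m => by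
    linear_combination -m.m6) ?_
  refine forall_mem_cons (not_occurs (fun t => t 1 * t 3 * (t 0 - t 3)) fun _ m => by
    linear_combination 1/2 * m.m0 + 1/2 * m.m2 + 1/2 * m.m8 - 1/2 * m.m9) ?_
  refine forall_mem_cons (not_occurs (fun t => t 1 * (t 0 + t 1) * (t 0 - t 3)) fun _ m => by
    linear_combination -m.m6 + m.m8 - 1/2 * m.m9) ?_
  refine forall_mem_cons (not_occurs (fun t => t 0 * t 1 * t 2 * (t 0 - t 2)) fun t m => by
    linear_combination 1/2 * t 0 * m.m0 - 1/2 * t 2 * m.m7) ?_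
  refine forall_mem_cons (not_occurs (fun t => t 1 * t 2 * (t 0 + t 3)) fun _ m => by
    linear_combination -m.m3 - m.m8 + m.m9) ?_
  refine forall_mem_cons (not_occurs (fun t => t 2 * t 2 * (t 1 - t 3)) fun _ m => by
    linear_combination -1/4 * m.m4 - m.m6) ?_
  refine forall_mem_cons (not_occurs (fun t => t 0 * t 3 * (t 0 - t 4) * (t 1 - t 2)) fun t m => by
    linear_combination -1/2 * t 0 * m.m0 + (-1/6 * t 0 + 1/3 * t 1 - 1/6 * t 3 + 1/3 * t 4) * m.m4
      + (1/3 * t 1 + 1/3 * t 2 - 1/3 * t 3 + 1/3 * t 4) * m.m6 + (1/6 * t 0 + 1/3 * t 2 - 1/6 *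
      t 3) * m.m9) ?_
  refine forall_mem_cons (not_occurs (fun t => t 0 * t 0 * t 2) fun _ m => by
    linear_combination 1/2 * m.m0 - 1/2 * m.m2 + 1/2 * m.m8 - 1/2 * m.m9) ?_
  refine forall_mem_cons (not_occurs (fun t => t 3 * (t 0 - t 1) * (t 0 - t 2)) fun _ m => by
    linear_combination 1/2 * m.m1 - 1/2 * m.m4 + 1/2 * m.m5 - 1/2 * m.m6 + 1/2 * m.m8) ?_
  refine forall_mem_cons (not_occurs (fun t => t 0 * t 2 * t 2) fun _ m => by
    linear_combination 1/2 * m.m1 - 1/2 * m.m2 + 1/2 * m.m4 + 1/4 * m.m6 - 1/2 * m.m7 + 1/4 * m.m8)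
      ?_
  refine forall_mem_cons (not_occurs (fun t => t 0 * t 0 * (t 0 + t 1)) fun _ m => by
    linear_combination -1/4 * m.m1 + m.m4 - 3/4 * m.m5 + 1/4 * m.m6 + 1/4 * m.m8 - 1/4 * m.m9) ?_
  refine forall_mem_cons (not_occurs (fun t => t 0 * t 0 * t 1) fun _ m => by
    linear_combination -m.m1 + m.m4 - 1/2 * m.m9) ?_
  refine forall_mem_cons (not_occurs (fun t => t 0 * t 0 * t 2) fun _ m => by
    linear_combination 1/2 * m.m0 + 1/2 * m.m1 + 1/2 * m.m5 - 1/2 * m.m7) ?_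
  refine forall_mem_cons (not_occurs (fun t => t 0 * t 1 * (t 1 + t 2)) fun _ m => by
    linear_combination m.m0 - m.m3 + m.m8 - 1/2 * m.m9) ?_
  refine forall_mem_cons (not_occurs (fun t => t 1 * (t 0 - t 2) * (t 0 - t 2)) fun _ m => by
    linear_combination 1/2 * m.m1 + 1/2 * m.m3 - m.m6 - 1/2 * m.m9) ?_
  refine forall_mem_cons (not_occurs (fun t => t 1 * (t 0 - t 2) * (t 0 - t 3)) fun _ m => by
    linear_combination -1/2 * m.m2 + 1/2 * m.m3 + m.m8 - 1/2 * m.m9) ?_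
  refine forall_mem_cons (not_occurs (fun t => t 3 * t 3 * (t 0 - t 1)) fun _ m => by
    linear_combination 1/2 * m.m0 + m.m2 - 1/2 * m.m3 - 1/2 * m.m8) ?_
  refine forall_mem_cons (not_occurs (fun t => t 0 * t 0 * t 2) fun _ m => by
    linear_combination -m.m0 - 2 * m.m2 + 5/2 * m.m4 + m.m6 - 3/2 * m.m7) ?_
  refine forall_mem_cons (not_occurs (fun t => t 0 * t 0 * t 2) fun _ m => by
    linear_combination 1/3 * m.m1 - m.m2 + 1/3 * m.m3 - 1/3 * m.m4 + 2/3 * m.m5) ?_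
  refine forall_mem_cons (not_occurs (fun t => t 0 * (t 0 - t 3) * (t 1 - t 2)) fun _ m => by
    linear_combination 1/2 * m.m2 - 1/2 * m.m6) ?_
  refine forall_mem_cons (not_occurs (fun t => t 0 * t 1 * t 3) fun _ m => by
    linear_combination 1/2 * m.m1 - 1/2 * m.m6) ?_
  refine forall_mem_cons (not_occurs (fun t => t 0 * t 1 * t 1) fun _ m => by
    linear_combination -1/3 * m.m5 - 1/3 * m.m6 - 1/3 * m.m8 + 1/3 * m.m9) ?_
  refine forall_mem_cons (not_occurs (fun t => t 3 * (t 0 - t 1) * (t 0 - t 1)) fun _ m => by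
    linear_combination 1/2 * m.m0 - 1/2 * m.m1 + 1/2 * m.m2 - 1/2 * m.m3 - 1/2 * m.m5) ?_
  refine forall_mem_cons (not_occurs (fun t => t 1 * t 3 * (t 2 - t 3)) fun _ m => by
    linear_combination -m.m5 + 2 * m.m6 - m.m8 + m.m9) ?_
  refine forall_mem_cons (not_occurs (fun t => t 0 * t 1 * t 2) fun _ m => by
    linear_combination -5/12 * m.m4 + 1/2 * m.m5 - 7/6 * m.m6 + 5/12 * m.m7 + 1/3 * m.m8 - 1/4 *
      m.m9) ?_
  refine forall_mem_cons (not_occurs (fun t => t 0 * t 1 * t 2) fun _ m => by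
    linear_combination 1/2 * m.m0 + 1/18 * m.m1 + 4/9 * m.m2 - 2/3 * m.m3 - 1/9 * m.m6 - 1/2 * m.m8
      + 1/9 * m.m9) ?_
  refine forall_mem_cons (not_occurs (fun t => t 2 * t 3 * (t 2 - t 3)) fun _ m => by
    linear_combination -m.m3 - m.m8 + 1/2 * m.m9) ?_
  refine forall_mem_cons (not_occurs (fun t => t 0 * (t 0 + t 2) * (t 0 - t 3)) fun _ m => by
    linear_combination -m.m2 + m.m5 - 1/2 * m.m7) ?_
  refine forall_mem_cons (not_occurs (fun t => t 0 * t 1 * t 2) fun _ m => by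
    linear_combination 1/4 * m.m0 - 1/2 * m.m1 + 1/4 * m.m2 - 1/4 * m.m5 + 1/4 * m.m7) ?_
  refine forall_mem_cons (not_occurs (fun t => t 0 * t 1 * t 2) fun _ m => by
    linear_combination 1/2 * m.m1 - 1/2 * m.m4 - 2 * m.m6 + 1/2 * m.m8) ?_
  refine forall_mem_cons (not_occurs (fun t => t 2 * t 3 * (t 0 - t 3) * (t 1 - t 2)) fun t m => by
    linear_combination (-1/3 * t 0 + 1/6 * t 1 + 1/6 * t 2 + 1/6 * t 3) * m.m7 + (-1/3 * t 1 + 1/3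
      * t 2) * m.m8 + (1/3 * t 0 - 1/3 * t 2 - 1/6 * t 3) * m.m9) ?_
  refine forall_mem_cons (not_occurs (fun t => t 1 * t 2 * (t 1 - t 3)) fun _ m => by
    linear_combination -1/4 * m.m3 - 1/4 * m.m6) ?_
  refine forall_mem_cons (not_occurs (fun t => t 1 * (t 0 - t 3) * (t 0 - t 3)) fun _ m => by
    linear_combination -m.m1 - m.m3 + 1/2 * m.m4 + m.m6 - m.m8 + 1/2 * m.m9) ?_
  refine forall_mem_cons (not_occurs (fun t => t 0 * t 0 * t 0) fun _ m => by
    linear_combination -1/6 * m.m0 - m.m1 + 2/3 * m.m2 + 1/3 * m.m3 + 1/2 * m.m4 - m.m5 + 1/2 *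
      m.m7) ?_
  refine forall_mem_cons (not_occurs (fun t => t 0 * t 1 * (t 0 + t 2)) fun _ m => by
    linear_combination -m.m5 + m.m6 + m.m7) ?_
  refine forall_mem_cons (not_occurs (fun t => t 0 * (t 1 - t 2) * (t 1 - t 3)) fun _ m => by
    linear_combination 1/2 * m.m0 - m.m1 + 1/2 * m.m2 + 1/2 * m.m4 - 1/2 * m.m5 - 1/2 * m.m9) ?_
  refine forall_mem_cons (not_occurs (fun t => t 0 * (t 0 - t 3) * (t 1 - t 2)) fun _ m => by
    linear_combination -1/2 * m.m2 + 1/2 * m.m5 - 1/2 * m.m6 - 1/2 * m.m7 + 1/2 * m.m8) ?_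
  refine forall_mem_cons (not_occurs (fun t => t 0 * t 0 * t 2) fun _ m => by
    linear_combination -1/2 * m.m5 + 1/2 * m.m7 - 1/2 * m.m8) ?_
  refine forall_mem_cons (not_occurs (fun t => t 0 * t 0 * t 1) fun _ m => by
    linear_combination 3/4 * m.m0 + 3/2 * m.m2 - 5/4 * m.m3 - 1/2 * m.m4 + 1/2 * m.m5 + 1/4 * m.m7
      - 7/4 * m.m8 + 3/4 * m.m9) ?_
  refine forall_mem_cons (not_occurs (fun t => t 0 * t 0 * t 2) fun _ m => by
    linear_combination 1/2 * m.m0 - m.m1 + m.m2 + 1/2 * m.m4 - m.m5) ?_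
  refine forall_mem_cons (not_occurs (fun t => t 0 * (t 0 - t 1) * (t 2 - t 3)) fun _ m => by
    linear_combination 1/2 * m.m0 + m.m2 - 1/2 * m.m4 + 1/2 * m.m7 - m.m8) ?_
  refine forall_mem_cons (not_occurs (fun t => t 2 * t 3 * (t 0 - t 1)) fun _ m => by
    linear_combination -1/2 * m.m4 + 1/2 * m.m5 + 1/2 * m.m7 - 1/2 * m.m8) ?_
  refine forall_mem_cons (not_occurs (fun t => t 2 * t 3 * (t 2 - t 3)) fun _ m => by
    linear_combination -1/3 * m.m5 + 1/6 * m.m7 - 1/3 * m.m8) ?_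
  refine forall_mem_cons (not_occurs (fun t => t 4 * (t 0 - t 1) * (t 2 - t 3)) fun _ m => by
    linear_combination -1/2 * m.m1 - 1/2 * m.m3 + 1/2 * m.m4 - 1/2 * m.m5 + 1/2 * m.m6) ?_
  refine forall_mem_cons (not_occurs (fun t => t 0 * t 0 * t 2) fun _ m => by
    linear_combination -1/6 * m.m0 + 1/3 * m.m1 - 2/3 * m.m2 + 2/3 * m.m4 - 2/3 * m.m5 + 2/3 * m.m6
      - 1/6 * m.m7 - 2/3 * m.m8 + 1/6 * m.m9) ?_
  refine forall_mem_cons (not_occurs (fun t => t 0 * t 0 * t 0) fun _ m => by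
    linear_combination m.m8) ?_
  refine forall_mem_cons (not_occurs (fun t => t 0 * t 0 * t 1) fun _ m => by
    linear_combination -m.m6) ?_
  refine forall_mem_cons (not_occurs (fun t => t 0 * t 0 * t 2) fun _ m => by
    linear_combination 3/4 * m.m2 - 1/4 * m.m3 - m.m5 + m.m7 - m.m8) ?_
  refine forall_mem_cons (not_occurs (fun t => t 0 * t 0 * t 1) fun _ m => by
    linear_combination 1/4 * m.m0 - 3/4 * m.m3 + 3/4 * m.m8) ?_
  refine forall_mem_cons (not_occurs (fun t => t 0 * t 1 * t 2) fun _ m => by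
    linear_combination m.m8) ?_
  refine forall_mem_cons (not_occurs (fun t => t 0 * t 1 * t 1) fun _ m => by
    linear_combination m.m3) ?_
  refine forall_mem_cons (not_occurs (fun t => t 0 * t 2 * (t 0 + t 1)) fun _ m => by
    linear_combination -m.m2 + m.m3 + 2 * m.m8 - 1/2 * m.m9) ?_
  refine forall_mem_cons (not_occurs (fun t => t 0 * t 0 * (t 1 + t 2)) fun _ m => by
    linear_combination -1/4 * m.m0 + 1/2 * m.m3 + 1/4 * m.m4 - 3/2 * m.m6) ?_
  refine forall_mem_cons (not_occurs (fun t => t 0 * t 1 * t 2) fun _ m => by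
    linear_combination -m.m6) ?_
  refine forall_mem_cons (not_occurs (fun t => t 0 * t 2 * t 2) fun _ m => by
    linear_combination m.m8) ?_
  refine forall_mem_cons (not_occurs (fun t => t 0 * t 2 * t 3) fun _ m => by
    linear_combination -m.m6) ?_
  refine forall_mem_cons (not_occurs (fun t => t 0 * t 0 * t 2 * t 3) fun t m => by
    linear_combination -1/2 * t 0 * m.m6 + 1/2 * t 3 * m.m8) ?_
  refine forall_mem_cons (not_occurs (fun t => t 1 * t 2 * (t 0 - t 1) * (t 1 - t 2)) fun t m => by
    linear_combination 1/12 * t 2 * m.m0 + 1/12 * t 2 * m.m1 + (-1/12 * t 0 + 1/3 * t 1) * m.m3 -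
      1/6 * t 2 * m.m4) ?_
  refine forall_mem_cons (not_occurs (fun t => t 0 * t 0 * t 2) fun _ m => by
    linear_combination 2/3 * m.m0 + 2 * m.m3 - 7/6 * m.m4 + 4/3 * m.m5 - 5/3 * m.m6 - 2/3 * m.m7 +
      8/3 * m.m8 - 1/2 * m.m9) ?_
  refine forall_mem_cons (not_occurs (fun t => t 0 * t 0 * t 1) fun _ m => by
    linear_combination -m.m1 + m.m4 - 1/2 * m.m9) ?_
  refine forall_mem_cons (not_occurs (fun t => t 3 * (t 0 - t 1) * (t 0 - t 2)) fun _ m => by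
    linear_combination 1/2 * m.m0 - 1/2 * m.m1 + 1/2 * m.m2 - 1/2 * m.m5 + 1/2 * m.m6) ?_
  refine forall_mem_cons (not_occurs (fun t => t 0 * (t 0 - t 1) * (t 1 - t 2)) fun _ m => by
    linear_combination 1/2 * m.m4 - 1/2 * m.m9) ?_
  refine forall_mem_cons (not_occurs (fun t => t 0 * t 2 * (t 2 - t 3) * (t 0 + t 1 + t 3)) fun t m
      => by
    linear_combination (-5/2 * t 0 - 2 * t 1 + 2 * t 2) * m.m0 + (-2 * t 0 - t 1 + 3 * t 2 + t 3) *
      m.m1 + (-1/2 * t 0 + t 2) * m.m4 + (t 2 + 2 * t 3) * m.m6 + (5/2 * t 0 + 2 * t 1 - 2 * t 2) *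
      m.m9) ?_
  refine forall_mem_cons (not_occurs (fun t => t 0 * t 0 * (t 0 + t 2)) fun _ m => by
    linear_combination m.m3 - 1/4 * m.m4 + 1/4 * m.m5 - 3/4 * m.m6 + m.m8) ?_
  refine forall_mem_cons (not_occurs (fun t => t 0 * t 1 * t 2) fun _ m => by
    linear_combination m.m2 - 1/2 * m.m6 + 1/2 * m.m7 - 1/2 * m.m8) ?_
  refine forall_mem_cons (not_occurs (fun t => t 0 * t 0 * (t 0 + t 1)) fun _ m => by
    linear_combination 4 * m.m0 - 9/2 * m.m1 + 4 * m.m2 + 2 * m.m3 - 15/2 * m.m5 - 1/2 * m.m6 - 1/2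
      * m.m8) ?_
  refine forall_mem_cons (not_occurs (fun t => t 0 * t 2 * t 3) fun _ m => by
    linear_combination -1/2 * m.m6 + 1/2 * m.m8) ?_
  refine forall_mem_cons (not_occurs (fun t => t 0 * t 2 * t 2 * (t 1 - t 3)) fun t m => by
    linear_combination -1/3 * t 2 * m.m5 - 1/3 * t 0 * m.m8 + 1/6 * t 0 * m.m9) ?_
  refine forall_mem_cons (not_occurs (fun t => t 2 * (t 0 - t 1) * (t 0 - t 4) * (t 1 - t 3)) fun t
      m => by
    linear_combination (-1/6 * t 1 - 1/6 * t 2 + 1/3 * t 3 - 1/6 * t 4) * m.m7 + (-1/3 * t 0 + 1/3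
      * t 4) * m.m8 + (1/6 * t 0 + 1/6 * t 1 + 1/6 * t 2 - 1/3 * t 3) * m.m9) ?_
  refine forall_mem_cons (not_occurs (fun t => t 3 * (t 0 - t 2) * (t 1 - t 3)) fun _ m => by
    linear_combination -1/2 * m.m2 + 1/2 * m.m3 - 1/2 * m.m4 + 1/2 * m.m5 - 1/2 * m.m6) ?_
  refine forall_mem_cons (not_occurs (fun t => t 0 * (t 1 - t 2) * (t 1 - t 2) * (t 1 - t 3)) fun t
      m => by
    linear_combination t 2 * m.m0 + 1/2 * t 2 * m.m2 + (t 1 - 5/2 * t 2) * m.m3 - t 0 * m.m4 + (t 2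
      - t 3) * m.m6 + (1/2 * t 0 - 3/2 * t 1 + 3/2 * t 2) * m.m9) ?_
  refine forall_mem_cons (not_occurs (fun t => t 0 * t 0 * t 3 * (t 1 - t 2)) fun t m => by
    linear_combination -1/2 * t 1 * m.m7 + 1/2 * t 0 * m.m9) ?_
  refine forall_mem_cons (not_occurs (fun t => t 0 * (t 1 - t 3) * (t 2 - t 3)) fun _ m => by
    linear_combination 1/2 * m.m2 - 1/2 * m.m3 - 1/2 * m.m5 + 1/2 * m.m7 - 1/2 * m.m8) ?_
  refine forall_mem_cons (not_occurs (fun t => t 0 * t 0 * t 0) fun _ m => by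
    linear_combination 1/4 * m.m7) ?_
  refine forall_mem_cons (not_occurs (fun t => t 0 * t 3 * (t 0 - t 1) * (t 0 - t 2)) fun t m => by
    linear_combination (t 1 - 1/3 * t 3) * m.m5 + (1/3 * t 0 - 2/3 * t 1 - 1/6 * t 2 - 1/6 * t 3) *
      m.m7 + 1/2 * t 0 * m.m9) ?_
  refine forall_mem_cons (not_occurs (fun t => t 0 * t 1 * t 1 * (t 0 - t 3)) fun t m => by
    linear_combination 1/2 * t 1 * m.m7 - 1/2 * t 0 * m.m9) ?_
  refine forall_mem_cons (not_occurs (fun t => t 0 * (t 0 - t 2) * (t 1 - t 2) * (t 2 - t 3)) fun t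
      m => by
    linear_combination -1/2 * t 2 * m.m0 + 1/2 * t 0 * m.m9) ?_
  refine forall_mem_cons (not_occurs (fun t => t 0 * t 2 * (t 1 - t 2) * (t 1 - t 4)) fun t m => by
    linear_combination 1/2 * t 1 * m.m7 - 1/2 * t 0 * m.m9) ?_
  refine forall_mem_cons (not_occurs (fun t => t 0 * t 4 * (t 1 - t 2) * (t 2 - t 3)) fun t m => by
    linear_combination -1/4 * t 4 * m.m0 + (1/4 * t 3 - 1/12 * t 4) * m.m2 + (-1/6 * t 0 + 1/6 *
      t 2 - 1/4 * t 3 + 1/12 * t 4) * m.m5 + (1/12 * t 1 - 1/6 * t 2 + 1/3 * t 3 - 1/6 * t 4) *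
      m.m7 + 1/4 * t 0 * m.m9) ?_
  refine forall_mem_cons (not_occurs (fun t => t 0 * t 2 * (t 0 - t 2)) fun _ m => by
    linear_combination 1/24 * m.m0 + 1/24 * m.m4 - 1/6 * m.m6 + 1/24 * m.m7 + 1/3 * m.m8 - 1/4 *
      m.m9) ?_
  refine forall_mem_cons (not_occurs (fun t => (t 0 + t 2) * (t 0 - t 3) * (t 1 - t 3) * (t 2 -
      t 3)) fun t m => by
    linear_combination (1/4 * t 0 - 1/4 * t 1 + 1/4 * t 2 - 1/2 * t 3) * m.m0 + (-t 2 + 1/2 * t 3)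
      * m.m2 + (-1/2 * t 0 + t 1 - t 2 - t 3) * m.m3 + (-3/4 * t 0 + t 1) * m.m4 - t 3 * m.m5 +
      (t 0 - 1/4 * t 1 - t 2 + t 3) * m.m7 - t 3 * m.m8 + (-t 0 + 1/4 * t 1 + 1/4 * t 2 + 1/2 *
      t 3) * m.m9) ?_
  refine forall_mem_cons (not_occurs (fun t => t 0 * t 0 * t 2) fun _ m => by
    linear_combination -1/2 * m.m1 - 1/2 * m.m2 - 1/2 * m.m4 + 1/2 * m.m5 + 1/2 * m.m7 + 1/2 *
      m.m8) ?_
  refine forall_mem_cons (not_occurs (fun t => t 0 * t 0 * t 0) fun _ m => by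
    linear_combination -1/2 * m.m0 + m.m4 - m.m5) ?_
  refine forall_mem_cons (not_occurs (fun t => t 0 * t 0 * (t 0 + t 2)) fun _ m => by
    linear_combination -3/8 * m.m0 + 3/4 * m.m2 + 1/8 * m.m4 - m.m5 + 1/2 * m.m6 + 5/4 * m.m7 - 3/4
      * m.m8 + 1/4 * m.m9) ?_
  refine forall_mem_cons (not_occurs (fun t => (t 0 + t 2) * (t 1 - t 3) * (t 2 - t 3)) fun _ m =>
      by
    linear_combination m.m0 - m.m1 + 1/2 * m.m3 + 1/2 * m.m4 - 1/2 * m.m5 - m.m7 + m.m8 - 1/2 *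
      m.m9) ?_
  refine forall_mem_cons (not_occurs (fun t => t 0 * t 0 * t 2) fun _ m => by
    linear_combination -1/4 * m.m0 - 1/2 * m.m1 + 3/8 * m.m2 - 3/8 * m.m3 + 5/8 * m.m4 - 9/8 * m.m5
      + 1/2 * m.m7 - 1/8 * m.m8) ?_
  refine forall_mem_cons (not_occurs (fun t => t 0 * t 0 * (t 0 + t 2)) fun _ m => by
    linear_combination 5 * m.m0 + 6 * m.m2 - 3/2 * m.m3 - 5 * m.m4 + m.m5 + 9/2 * m.m6 + 1/2 * m.m7
      - m.m8 + 3 * m.m9) ?_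
  refine forall_mem_cons (not_occurs (fun t => t 0 * t 2 * (t 0 - t 1)) fun _ m => by
    linear_combination 1/2 * m.m7 - 1/2 * m.m9) ?_
  refine forall_mem_cons (not_occurs (fun t => t 1 * t 3 * (t 0 - t 1)) fun _ m => by
    linear_combination m.m1 + 1/2 * m.m3 - 1/2 * m.m4 - 1/2 * m.m6) ?_
  refine forall_mem_cons (not_occurs (fun t => t 0 * (t 0 + t 2) * (t 1 - t 3)) fun _ m => by
    linear_combination -m.m2 - 1/2 * m.m7 + m.m8) ?_
  refine forall_mem_cons (not_occurs (fun t => t 0 * t 0 * (t 0 + t 2)) fun _ m => by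
    linear_combination -1/4 * m.m3 - m.m5 + m.m7 - 3/4 * m.m8) ?_
  refine forall_mem_cons (not_occurs (fun t => t 1 * t 1 * t 4 * (t 0 - t 2)) fun t m => by
    linear_combination 1/2 * t 1 * m.m7 - 1/2 * t 0 * m.m9) ?_
  refine forall_mem_cons (not_occurs (fun t => t 3 * t 3 * (t 0 - t 1)) fun _ m => by
    linear_combination -1/2 * m.m7 + 1/2 * m.m9) ?_
  refine forall_mem_cons (not_occurs (fun t => t 0 * t 0 * t 0) fun _ m => by
    linear_combination -m.m1 + m.m2 + 1/2 * m.m4 - m.m5 + m.m7 - 1/2 * m.m9) ?_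
  refine forall_mem_cons (not_occurs (fun t => t 0 * t 0 * t 0) fun _ m => by
    linear_combination -7/6 * m.m0 + 1/3 * m.m2 + m.m3 - 3 * m.m5 + 2 * m.m6 - 1/6 * m.m7 - 2 *
      m.m8 + 19/6 * m.m9) ?_
  refine forall_mem_cons (not_occurs (fun t => t 0 * t 0 * t 0) fun _ m => by
    linear_combination -m.m5 + 1/2 * m.m7) ?_
  refine forall_mem_cons (not_occurs (fun t => t 0 * t 0 * t 0) fun _ m => by
    linear_combination -1/2 * m.m0 - m.m5 + m.m7) ?_
  refine forall_mem_cons (not_occurs (fun t => t 0 * t 0 * t 2) fun _ m => by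
    linear_combination -7 * m.m2 + 4 * m.m3 + 8 * m.m8 - 9/2 * m.m9) ?_
  refine forall_mem_cons (not_occurs (fun t => t 2 * (t 1 - t 3) * (t 1 - t 3)) fun _ m => by
    linear_combination -m.m1 + 2 * m.m2 - 2 * m.m3 + 1/2 * m.m4 - m.m5 + 2 * m.m6 - 2 * m.m8 + 2 *
      m.m9) ?_
  refine forall_mem_cons (not_occurs (fun t => t 0 * t 1 * t 1) fun _ m => by
    linear_combination 1/18 * m.m2 - 1/18 * m.m3 + 1/9 * m.m4 + 2/9 * m.m5 + 5/9 * m.m6 - 1/18 *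
      m.m7 - 1/9 * m.m8 + 1/3 * m.m9) ?_
  refine forall_mem_cons (not_occurs (fun t => t 1 * (t 1 + t 2) * (t 0 - t 2)) fun _ m => by
    linear_combination -m.m6 + m.m8 - 1/2 * m.m9) ?_
  refine forall_mem_cons (not_occurs (fun t => t 0 * t 1 * t 2) fun _ m => by
    linear_combination 3/10 * m.m0 + 3/5 * m.m1 - m.m3 + 13/10 * m.m5 - 6/5 * m.m6 - 8/5 * m.m7 +
      9/10 * m.m8 + 4/5 * m.m9) ?_
  refine forall_mem_cons (not_occurs (fun t => t 1 * (t 0 - t 3) * (t 1 - t 2)) fun _ m => by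
    linear_combination 1/2 * m.m1 - 1/2 * m.m4 + 1/2 * m.m5 - 1/2 * m.m6 + 1/2 * m.m8) ?_
  refine forall_mem_cons (not_occurs (fun t => t 0 * t 1 * t 1) fun _ m => by
    linear_combination -5/6 * m.m1 + 5/6 * m.m4 - 2/3 * m.m5 + 1/2 * m.m6 - 1/3 * m.m8) ?_
  refine forall_mem_cons (not_occurs (fun t => t 0 * (t 1 - t 3) * (t 2 - t 4)) fun _ m => by
    linear_combination -1/2 * m.m1 + 1/2 * m.m4 - 1/2 * m.m5 + 1/2 * m.m6 - 1/2 * m.m8) ?_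
  refine forall_mem_cons (not_occurs (fun t => t 2 * (t 0 - t 4) * (t 1 - t 3)) fun _ m => by
    linear_combination -1/2 * m.m1 + 1/2 * m.m4 - 1/2 * m.m5 + 1/2 * m.m6 - 1/2 * m.m8) ?_
  refine forall_mem_cons (not_occurs (fun t => t 0 * t 3 * (t 1 - t 2)) fun _ m => by
    linear_combination m.m1 - 1/2 * m.m2 + 1/2 * m.m3 - 1/2 * m.m4) ?_
  refine forall_mem_cons (not_occurs (fun t => t 0 * (t 1 - t 3) * (t 2 - t 3)) fun _ m => by
    linear_combination -1/2 * m.m3 - 1/2 * m.m5 + 1/2 * m.m6 - 1/2 * m.m8 + 1/2 * m.m9) ?_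
  refine forall_mem_cons (not_occurs (fun t => t 3 * (t 0 - t 2) * (t 1 - t 2)) fun _ m => by
    linear_combination 1/2 * m.m2 - 1/2 * m.m3 + 1/2 * m.m6 - 1/2 * m.m8 + 1/2 * m.m9) ?_
  refine forall_mem_cons (not_occurs (fun t => t 0 * (t 0 - t 1) * (t 1 - t 3)) fun _ m => by
    linear_combination 1/2 * m.m1 - 1/2 * m.m2 + 1/2 * m.m3 - 1/2 * m.m6 - 1/2 * m.m9) ?_
  refine forall_mem_cons (not_occurs (fun t => t 2 * t 2 * (t 0 - t 1)) fun _ m => by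
    linear_combination -1/4 * m.m0 + 1/2 * m.m3 + 1/4 * m.m4 - 1/2 * m.m5 + 1/4 * m.m7 - 1/4 *
      m.m9) ?_
  refine forall_mem_cons (not_occurs (fun t => t 2 * t 2 * (t 0 - t 3)) fun _ m => by
    linear_combination -1/2 * m.m4 + 1/2 * m.m5 - m.m6 + 1/2 * m.m8) ?_
  refine forall_mem_cons (not_occurs (fun t => t 0 * t 1 * t 4 * (t 0 - t 1)) fun t m => by
    linear_combination -1/2 * t 1 * m.m7 + 1/2 * t 0 * m.m9) ?_
  exact fun _ h => absurd h List.not_mem_nil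

/-! ### Correctness of the codes -/

/-- The first entries and the second entries of the pairs in `l` have the same equalities. -/
def SamePattern {α β : Type} (l : List (α × β)) : Prop :=
  ∀ p ∈ l, ∀ q ∈ l, (p.1 = q.1 ↔ p.2 = q.2)

theorem SamePattern.of_subset {α β : Type} {l l' : List (α × β)} (h : SamePattern l)
    (hl : l' ⊆ l) : SamePattern l' := fun p hp q hq => h p (hl hp) q (hl hq)

theorem SamePattern.sq {α : Type} {l : List (α × ℝ)} (h : SamePattern l) (h0 : ∀ p ∈ l, 0 ≤ p.2) :
    SamePattern (l.map fun p => (p.1, p.2 ^ 2)) := by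
  intro p hp q hq
  obtain ⟨p', hp', rfl⟩ := List.mem_map.1 hp
  obtain ⟨q', hq', rfl⟩ := List.mem_map.1 hq
  exact (h p' hp' q' hq').trans (pow_left_inj₀ (h0 p' hp') (h0 q' hq') two_ne_zero).symm

theorem firstIndex_cons (x y : ℕ) (l : List ℕ) :
    firstIndex x (y :: l) = if x = y then 0 else firstIndex x l + 1 := by
  show decide! (Nat.beq x y) 0 (firstIndex x l + 1) = _
  cases h : Nat.beq x y
  · rw [if_neg (Nat.ne_of_beq_eq_false h)]
  · rw [if_pos (Nat.eq_of_beq_eq_true h)]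

theorem firstIndex_le (x : ℕ) (l : List ℕ) : firstIndex x l ≤ l.length := by
  induction l with
  | nil => exact le_rfl
  | cons y l ih => rw [firstIndex_cons]; split_ifs <;> simp [ih]

/-- The first index locates one entry equal to the new element, and `hl` transfers its equalities to
the rest of the list. An index equal to the length says that the element is new on both sides. -/
theorem SamePattern.eq_iff_of_firstIndex_eq {l : List (ℕ × ℕ)} (hl : SamePattern l) {x y : ℕ}
    (h : firstIndex x (l.map Prod.fst) = firstIndex y (l.map Prod.snd)) :
    ∀ q ∈ l, (x = q.1 ↔ y = q.2) := by
  induction l with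
  | nil => simp
  | cons p l ih =>
    simp only [List.map_cons, firstIndex_cons] at h
    by_cases hx : x = p.1
    · by_cases hy : y = p.2
      · intro q hq
        rw [hx, hy]
        exact hl p List.mem_cons_self q hq
      · simp [hx, hy] at h
    · by_cases hy : y = p.2
      · simp [hx, hy] at h
      · intro q hq
        rcases List.mem_cons.1 hq with rfl | hq
        · simp [hx, hy]
        · exact ih (hl.of_subset (List.subset_cons_self _ _)) (by simpa [hx, hy] using h) q hq

theorem SamePattern.concat {l : List (ℕ × ℕ)} (hl : SamePattern l) {x y : ℕ}
    (h : firstIndex x (l.map Prod.fst) = firstIndex y (l.map Prod.snd)) :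
    SamePattern (l ++ [(x, y)]) := by
  have H := hl.eq_iff_of_firstIndex_eq h
  intro p hp q hq
  rcases List.mem_append.1 hp with hp | hp <;> rcases List.mem_append.1 hq with hq | hq
  · exact hl p hp q hq
  · rw [List.mem_singleton.1 hq]
    simpa [eq_comm] using H p hp
  · rw [List.mem_singleton.1 hp]
    exact H q hq
  · simp [List.mem_singleton.1 hp, List.mem_singleton.1 hq]

/-- The code is a number in mixed radix: by `firstIndex_le` its lower digits are less than 2, 3, 4
and 5, so equal codes have equal digits. Each digit tells which earlier edge has the same colour, if
any; `SamePattern.concat` then adds the edges one at a time. -/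
theorem samePattern_of_edgeCode_eq {a b c d e f a' b' c' d' e' f' : ℕ}
    (h : edgeCode a b c d e f = edgeCode a' b' c' d' e' f') :
    SamePattern [(a, a'), (b, b'), (c, c'), (d, d'), (e, e'), (f, f')] := by
  have h1 := firstIndex_le b [a]
  have h2 := firstIndex_le c [a, b]
  have h3 := firstIndex_le d [a, b, c]
  have h4 := firstIndex_le e [a, b, c, d]
  have h1' := firstIndex_le b' [a']
  have h2' := firstIndex_le c' [a', b']
  have h3' := firstIndex_le d' [a', b', c']
  have h4' := firstIndex_le e' [a', b', c', d']
  simp only [List.length_cons, List.length_nil] at h1 h2 h3 h4 h1' h2' h3' h4'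
  simp only [edgeCode, Nat.add_eq, Nat.mul_eq] at h
  have s0 : SamePattern [(a, a')] := by simp [SamePattern]
  have s1 := s0.concat (x := b) (y := b') (show firstIndex b [a] = firstIndex b' [a'] by omega)
  have s2 := s1.concat (x := c) (y := c')
    (show firstIndex c [a, b] = firstIndex c' [a', b'] by omega)
  have s3 := s2.concat (x := d) (y := d')
    (show firstIndex d [a, b, c] = firstIndex d' [a', b', c'] by omega)
  have s4 := s3.concat (x := e) (y := e')
    (show firstIndex e [a, b, c, d] = firstIndex e' [a', b', c', d'] by omega)
  exact s4.concat (x := f) (y := f')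
    (show firstIndex f [a, b, c, d, e] = firstIndex f' [a', b', c', d', e'] by omega)

theorem samePattern_of_columnCode_eq {a b c d e f w x y z a' b' c' d' e' f' w' x' y' z' : ℕ}
    (hl : SamePattern [(a, a'), (b, b'), (c, c'), (d, d'), (e, e'), (f, f')])
    (h : columnCode a b c d e f w x y z = columnCode a' b' c' d' e' f' w' x' y' z') :
    SamePattern [(a, a'), (b, b'), (c, c'), (d, d'), (e, e'), (f, f'), (w, w'), (x, x'), (y, y'),
      (z, z')] := by
  have h1 := firstIndex_le w [a, b, c, d, e, f]
  have h2 := firstIndex_le x [a, b, c, d, e, f, w]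
  have h3 := firstIndex_le y [a, b, c, d, e, f, w, x]
  have h1' := firstIndex_le w' [a', b', c', d', e', f']
  have h2' := firstIndex_le x' [a', b', c', d', e', f', w']
  have h3' := firstIndex_le y' [a', b', c', d', e', f', w', x']
  simp only [List.length_cons, List.length_nil] at h1 h2 h3 h1' h2' h3'
  simp only [columnCode, Nat.add_eq, Nat.mul_eq] at h
  have s1 := hl.concat (x := w) (y := w')
    (show firstIndex w [a, b, c, d, e, f] = firstIndex w' [a', b', c', d', e', f'] by omega)
  have s2 := s1.concat (x := x) (y := x')
    (show firstIndex x [a, b, c, d, e, f, w] = firstIndex x' [a', b', c', d', e', f', w'] by omega)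
  have s3 := s2.concat (x := y) (y := y')
    (show firstIndex y [a, b, c, d, e, f, w, x] = firstIndex y' [a', b', c', d', e', f', w', x'] by
      omega)
  exact s3.concat (x := z) (y := z')
    (show firstIndex z [a, b, c, d, e, f, w, x, y] =
      firstIndex z' [a', b', c', d', e', f', w', x', y'] by omega)

theorem force_eq {α : Type} (n : ℕ) (f : ℕ → α) : force n f = f n := by cases n <;> rfl

theorem hasBit_iff (m i : ℕ) : hasBit m i = true ↔ m.testBit i = true := by
  rw [Nat.testBit_eq_decide_div_mod_eq, hasBit]
  show Nat.beq (Nat.land (m >>> i) 1) 1 = true ↔ _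
  rw [Nat.beq_eq]
  show (m >>> i) &&& 1 = 1 ↔ _
  rw [Nat.and_one_is_mod, Nat.shiftRight_eq_div_pow]
  simp

theorem hasBit_pow {i j : ℕ} (h : hasBit (Nat.pow 2 i) j = true) : i = j := by
  rw [hasBit_iff] at h
  simpa using (Nat.testBit_two_pow (n := i) (m := j)).symm.trans h

theorem exists_of_hasBit_unionBits {α : Type} {f : α → ℕ} {l : List α} {i : ℕ}
    (h : hasBit (unionBits f l) i = true) : ∃ x ∈ l, hasBit (f x) i = true := by
  induction l with
  | nil => simp [hasBit_iff, unionBits] at h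
  | cons x l ih =>
    rw [hasBit_iff] at h
    change (f x ||| unionBits f l).testBit i = true at h
    rw [Nat.testBit_or, Bool.or_eq_true] at h
    rcases h with h | h
    · exact ⟨x, List.mem_cons_self, (hasBit_iff _ _).2 h⟩
    · obtain ⟨y, hy, h⟩ := ih ((hasBit_iff _ _).2 h)
      exact ⟨y, List.mem_cons_of_mem _ hy, h⟩

theorem eq_true_of_hasBit_decide {b : Bool} {m i : ℕ} (h : hasBit (decide! b m 0) i = true) :
    b = true ∧ hasBit m i = true := by
  cases b
  · simp [hasBit_iff] at h
  · exact ⟨rfl, h⟩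

/-- The shuffles are words in the three adjacent transpositions, which are undone one by one.
Soundness does not require that every permutation is among them. -/
theorem Pattern.of_mem_shuffles {F : Pattern → Prop} (h12 : ∀ P : Pattern, F P.swap12 → F P)
    (h23 : ∀ P : Pattern, F P.swap23 → F P) (h34 : ∀ P : Pattern, F P.swap34 → F P)
    {P Q : Pattern} (hQ : Q ∈ P.shuffles) (h : F Q) : F P := by
  obtain ⟨R, hR, hQ⟩ := List.mem_flatMap.1 hQ
  obtain ⟨S, hS, hR⟩ := List.mem_flatMap.1 hR
  simp only [List.mem_cons, List.not_mem_nil, or_false] at hQ hR hS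
  have h1 : F R := by
    rcases hQ with rfl | rfl | rfl | rfl
    exacts [h, h12 _ h, h12 _ (h23 _ h), h12 _ (h23 _ (h34 _ h))]
  have h2 : F S := by
    rcases hR with rfl | rfl | rfl
    exacts [h1, h23 _ h1, h23 _ (h34 _ h1)]
  rcases hS with rfl | rfl
  exacts [h2, h34 _ h2]

/-- Exchanging two of the five points realizes the pattern with the two vertices exchanged; only the
edge between them has to be reversed. -/
theorem Pattern.Occurs.of_swap01 {P : Pattern} : P.swap01.Occurs → P.Occurs := by
  cases P
  rintro ⟨t, ht, hp, p, q, r, s, u, h1, h2, h3, h4, h5, h6, h7, h8, h9, h10⟩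
  exact ⟨t, ht, hp, q, p, r, s, u, dist_comm p q ▸ h1, h5, h6, h7, h2, h3, h4, h8, h9, h10⟩

theorem Pattern.Occurs.of_swap12 {P : Pattern} : P.swap12.Occurs → P.Occurs := by
  cases P
  rintro ⟨t, ht, hp, p, q, r, s, u, h1, h2, h3, h4, h5, h6, h7, h8, h9, h10⟩
  exact ⟨t, ht, hp, p, r, q, s, u, h2, h1, h3, h4, dist_comm q r ▸ h5, h8, h9, h6, h7, h10⟩

theorem Pattern.Occurs.of_swap23 {P : Pattern} : P.swap23.Occurs → P.Occurs := by
  cases P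
  rintro ⟨t, ht, hp, p, q, r, s, u, h1, h2, h3, h4, h5, h6, h7, h8, h9, h10⟩
  exact ⟨t, ht, hp, p, q, s, r, u, h1, h3, h2, h4, h6, h5, h7, dist_comm r s ▸ h8, h10, h9⟩

theorem Pattern.Occurs.of_swap34 {P : Pattern} : P.swap34.Occurs → P.Occurs := by
  cases P
  rintro ⟨t, ht, hp, p, q, r, s, u, h1, h2, h3, h4, h5, h6, h7, h8, h9, h10⟩
  exact ⟨t, ht, hp, p, q, r, u, s, h1, h2, h4, h3, h5, h7, h6, h9, h8, dist_comm s u ▸ h10⟩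

theorem Pattern.Occurs.of_mem_pivots {P Q : Pattern} (hQ : Q ∈ P.pivots) (h : Q.Occurs) :
    P.Occurs := by
  simp only [Pattern.pivots, List.mem_cons, List.not_mem_nil, or_false] at hQ
  rcases hQ with rfl | rfl | rfl | rfl | rfl
  · exact h
  · exact h.of_swap01
  · exact h.of_swap01.of_swap12
  · exact h.of_swap01.of_swap12.of_swap23
  · exact h.of_swap01.of_swap12.of_swap23.of_swap34

/-- A set bit comes from a permuted bad pattern, and nonoccurrence is invariant under the
permutation. The four-vertex invariants in `badColumns` are a filter that saves computation, so both
tests on them are dropped here; the codes alone carry the conclusion. -/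
theorem exists_not_occurs_of_badFive {a b c d e f w x y z : ℕ}
    (h : badFive a b c d e f w x y z = true) :
    ∃ P : Pattern, ¬ P.Occurs ∧ P.code = edgeCode a b c d e f ∧
      P.column = columnCode a b c d e f w x y z := by
  rw [badFive, force_eq, badColumns, force_eq] at h
  obtain ⟨P, hP, h⟩ := exists_of_hasBit_unionBits h
  obtain ⟨Q, hQ, h⟩ := exists_of_hasBit_unionBits (eq_true_of_hasBit_decide h).2
  obtain ⟨R, hR, h⟩ := exists_of_hasBit_unionBits (eq_true_of_hasBit_decide h).2
  obtain ⟨h1, h2⟩ := eq_true_of_hasBit_decide h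
  refine ⟨R, fun hR' => not_occurs_of_mem_badPatterns P hP (.of_mem_pivots hQ ?_),
    Nat.eq_of_beq_eq_true h1, hasBit_pow h2⟩
  exact Pattern.of_mem_shuffles (fun _ => .of_swap12) (fun _ => .of_swap23) (fun _ => .of_swap34)
    hR hR'

/-- `Pattern.Occurs` asks for values of all colours. The finitely many values prescribed by `l` are
completed by values above all of them. -/
theorem SamePattern.exists_injective {l : List (ℕ × ℝ)} (hl : SamePattern l)
    (h0 : ∀ p ∈ l, 0 < p.2) :
    ∃ t : ℕ → ℝ, Function.Injective t ∧ (∀ n, 0 < t n) ∧ ∀ p ∈ l, t p.1 = p.2 := by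
  classical
  obtain ⟨S, hS⟩ : ∃ S : ℝ, ∀ p ∈ l, p.2 < S := by
    obtain ⟨S, hS⟩ := (l.map Prod.snd).toFinset.finite_toSet.bddAbove
    exact ⟨S + 1, fun p hp => (hS (by simpa using ⟨p.1, hp⟩)).trans_lt (lt_add_one S)⟩
  have hex : ∀ n : ℕ, ∃ x : ℝ, 0 < x ∧ ((∃ p ∈ l, p.1 = n ∧ p.2 = x) ∨
      ((∀ p ∈ l, p.1 ≠ n) ∧ x = max S 1 + n)) := by
    intro n
    by_cases h : ∃ p ∈ l, p.1 = n
    · obtain ⟨p, hp, h⟩ := h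
      exact ⟨p.2, h0 p hp, .inl ⟨p, hp, h, rfl⟩⟩
    · push Not at h
      -- The summand `n` keeps the unused colours apart, `S` keeps them above the used values, and
      -- the maximum with `1` makes them positive.
      exact ⟨max S 1 + n, by positivity, .inr ⟨h, rfl⟩⟩
  choose t ht0 ht using hex
  refine ⟨t, fun m n hmn => ?_, ht0, fun p hp => ?_⟩
  · rcases ht m with ⟨p, hp, h1, h2⟩ | ⟨h1, h2⟩ <;> rcases ht n with ⟨q, hq, h3, h4⟩ | ⟨h3, h4⟩
    · rw [← h1, ← h3]
      exact (hl p hp q hq).2 (by rw [h2, h4, hmn])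
    · have := hS p hp
      have := le_max_left S 1
      have : (0 : ℝ) ≤ n := n.cast_nonneg
      linarith
    · have := hS q hq
      have := le_max_left S 1
      have : (0 : ℝ) ≤ m := m.cast_nonneg
      linarith
    · rw [h2, h4] at hmn
      exact_mod_cast add_left_cancel hmn
  · rcases ht p.1 with ⟨q, hq, h1, h2⟩ | ⟨h1, h2⟩
    · rw [← h2]
      exact (hl q hq p hp).1 h1
    · exact absurd rfl (h1 p hp)

theorem SamePattern.trans {β : Type} {u v : List ℕ} {w : List β} (h : SamePattern (u.zip v))
    (h' : SamePattern (v.zip w)) (huv : u.length = v.length) (hvw : v.length = w.length) :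
    SamePattern (u.zip w) := by
  intro p hp q hq
  obtain ⟨i, hi, rfl⟩ := List.getElem_of_mem hp
  obtain ⟨j, hj, rfl⟩ := List.getElem_of_mem hq
  simp only [List.length_zip] at hi hj
  have hi1 : i < (u.zip v).length := by simp only [List.length_zip]; omega
  have hj1 : j < (u.zip v).length := by simp only [List.length_zip]; omega
  have hi2 : i < (v.zip w).length := by simp only [List.length_zip]; omega
  have hj2 : j < (v.zip w).length := by simp only [List.length_zip]; omega
  have h1 := h _ (List.getElem_mem hi1) _ (List.getElem_mem hj1)
  have h2 := h' _ (List.getElem_mem hi2) _ (List.getElem_mem hj2)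
  simp only [List.getElem_zip] at h1 h2 ⊢
  exact h1.trans h2

/-- Equal codes match the colours of the points with those of a pattern that does not occur, so the
squared distances of the points would realize that pattern. Distinctness of the points makes the
values positive. -/
theorem not_badFive {a b c d e f w x y z : ℕ} {o p q r s : E 2}
    (hl : SamePattern [(a, dist p q), (b, dist p r), (c, dist p s), (d, dist q r), (e, dist q s),
      (f, dist r s), (w, dist o p), (x, dist o q), (y, dist o r), (z, dist o s)])
    (hd : [o, p, q, r, s].Nodup) : badFive a b c d e f w x y z ≠ true := by
  intro h
  obtain ⟨⟨w', x', y', z', a', b', c', d', e', f'⟩, hP, h1, h2⟩ := exists_not_occurs_of_badFive h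
  have h3 := samePattern_of_columnCode_eq (samePattern_of_edgeCode_eq h1) h2
  have hsq : SamePattern [(a, dist p q ^ 2), (b, dist p r ^ 2), (c, dist p s ^ 2),
      (d, dist q r ^ 2), (e, dist q s ^ 2), (f, dist r s ^ 2), (w, dist o p ^ 2), (x, dist o q ^ 2),
      (y, dist o r ^ 2), (z, dist o s ^ 2)] := hl.sq (by simp)
  have h4 := SamePattern.trans (u := [a', b', c', d', e', f', w', x', y', z'])
    (v := [a, b, c, d, e, f, w, x, y, z]) (w := [dist p q ^ 2, dist p r ^ 2, dist p s ^ 2,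
      dist q r ^ 2, dist q s ^ 2, dist r s ^ 2, dist o p ^ 2, dist o q ^ 2, dist o r ^ 2,
      dist o s ^ 2]) h3 hsq rfl rfl
  simp only [List.nodup_cons, List.mem_cons, List.not_mem_nil, or_false, not_or, List.nodup_nil,
    and_true, not_false_eq_true] at hd
  obtain ⟨t, ht, hp, h⟩ := h4.exists_injective (by simp [hd])
  simp only [List.zip_cons_cons, List.zip_nil_right, List.forall_mem_cons] at h
  refine hP ⟨t, ht, hp, o, p, q, r, s, ?_⟩
  tauto

/-! ### Correctness of the tests -/

/-- The set `X` contains four points with the pattern given by the edges of `P` among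
`1, 2, 3, 4`. -/
def Pattern.FoundIn (P : Pattern) (X : Set (E 2)) : Prop :=
  ∃ p ∈ X, ∃ q ∈ X, ∃ r ∈ X, ∃ s ∈ X, [p, q, r, s].Nodup ∧
    SamePattern [(P.e12, dist p q), (P.e13, dist p r), (P.e14, dist p s), (P.e23, dist q r),
      (P.e24, dist q s), (P.e34, dist r s)]

theorem Pattern.FoundIn.of_swap12 {X : Set (E 2)} {P : Pattern} :
    P.swap12.FoundIn X → P.FoundIn X := by
  cases P
  rintro ⟨p, hp, q, hq, r, hr, s, hs, hd, h⟩
  refine ⟨q, hq, p, hp, r, hr, s, hs, ?_, h.of_subset ?_⟩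
  · simp only [List.nodup_cons, List.mem_cons, List.not_mem_nil, or_false, not_or] at hd ⊢
    tauto
  · simp [Pattern.swap12, dist_comm]

theorem Pattern.FoundIn.of_swap23 {X : Set (E 2)} {P : Pattern} :
    P.swap23.FoundIn X → P.FoundIn X := by
  cases P
  rintro ⟨p, hp, q, hq, r, hr, s, hs, hd, h⟩
  refine ⟨p, hp, r, hr, q, hq, s, hs, ?_, h.of_subset ?_⟩
  · simp only [List.nodup_cons, List.mem_cons, List.not_mem_nil, or_false, not_or] at hd ⊢
    tauto
  · simp [Pattern.swap23, dist_comm]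

theorem Pattern.FoundIn.of_swap34 {X : Set (E 2)} {P : Pattern} :
    P.swap34.FoundIn X → P.FoundIn X := by
  cases P
  rintro ⟨p, hp, q, hq, r, hr, s, hs, hd, h⟩
  refine ⟨p, hp, q, hq, s, hs, r, hr, ?_, h.of_subset ?_⟩
  · simp only [List.nodup_cons, List.mem_cons, List.not_mem_nil, or_false, not_or] at hd ⊢
    tauto
  · simp [Pattern.swap34, dist_comm]

/-- No four points of `X` have a pattern with an edge code in `forb`. -/
def Avoids (forb : ℕ) (X : Set (E 2)) : Prop :=
  ∀ a b c d e f, ∀ p ∈ X, ∀ q ∈ X, ∀ r ∈ X, ∀ s ∈ X, [p, q, r, s].Nodup →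
    SamePattern [(a, dist p q), (b, dist p r), (c, dist p s), (d, dist q r), (e, dist q s),
      (f, dist r s)] → hasBit forb (edgeCode a b c d e f) ≠ true

/-- An edge code in the set is that of a permuted pattern of `l`. Four points with this code realize
the permuted pattern, and undoing the permutation realizes the pattern itself. -/
theorem avoids_codeSet {l : List Pattern} {X : Set (E 2)} (h : ∀ P ∈ l, ¬ P.FoundIn X) :
    Avoids (codeSet l) X := by
  intro a b c d e f p hp q hq r hr s hs hd hl hbit
  obtain ⟨P, hP, hbit⟩ := exists_of_hasBit_unionBits hbit
  obtain ⟨Q, hQ, hbit⟩ := exists_of_hasBit_unionBits hbit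
  have hcode := hasBit_pow hbit
  refine h P hP (Pattern.of_mem_shuffles (F := (Pattern.FoundIn · X)) (fun _ => .of_swap12)
    (fun _ => .of_swap23) (fun _ => .of_swap34) hQ ⟨p, hp, q, hq, r, hr, s, hs, hd, ?_⟩)
  cases Q with
  | mk _ _ _ _ a' b' c' d' e' f' =>
    exact SamePattern.trans (u := [a', b', c', d', e', f']) (v := [a, b, c, d, e, f])
      (w := [dist p q, dist p r, dist p s, dist q r, dist q s, dist r s])
      (samePattern_of_edgeCode_eq hcode) hl rfl rfl

/-- The colours in `row` stand for the distances from `p` to the points `ps`, where `D` is the list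
of the pairs of a colour and the distance it stands for. -/
def IsRow (D : List (ℕ × ℝ)) (p : E 2) (row : List ℕ) (ps : List (E 2)) : Prop :=
  List.Forall₂ (fun c q => (c, dist p q) ∈ D) row ps

theorem IsRow.mono {D D' : List (ℕ × ℝ)} (hD : D ⊆ D') {p : E 2} {row : List ℕ} {ps : List (E 2)}
    (h : IsRow D p row ps) : IsRow D' p row ps := h.imp fun _ _ hc => hD hc

/-- The rows of colours describe the distances from each of the points to the later points. -/
inductive AreRows (D : List (ℕ × ℝ)) : List (List ℕ) → List (E 2) → Prop
  | nil : AreRows D [] []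
  | cons {p : E 2} {row : List ℕ} {ps : List (E 2)} {rows : List (List ℕ)} :
    IsRow D p row ps → AreRows D rows ps → AreRows D (row :: rows) (p :: ps)

theorem AreRows.mono {D D' : List (ℕ × ℝ)} (hD : D ⊆ D') {rows : List (List ℕ)} {ps : List (E 2)}
    (h : AreRows D rows ps) : AreRows D' rows ps := by
  induction h with
  | nil => exact .nil
  | cons h _ ih => exact .cons (h.mono hD) ih

theorem or_of_decide {b c : Bool} (h : decide! b true c = true) : b = true ∨ c = true := by
  cases b
  · exact .inr h
  · exact .inl rfl

/-- The three nested tests run over the older points in addition to the new point `z` and the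
current point `i`. For actual distinct points all the colours lie in one dictionary, so none of the
tests can succeed. -/
theorem not_badWithThree {D : List (ℕ × ℝ)} (hD : SamePattern D) {zi zd zb id ib db : ℕ}
    {z i d b : E 2} (hzi : (zi, dist z i) ∈ D) (hzd : (zd, dist z d) ∈ D)
    (hzb : (zb, dist z b) ∈ D) (hid : (id, dist i d) ∈ D) (hib : (ib, dist i b) ∈ D)
    (hdb : (db, dist d b) ∈ D) {ps : List (E 2)} {rowz rowi rowd rowb : List ℕ}
    (hz : IsRow D z rowz ps) (hi : IsRow D i rowi ps) (hd : IsRow D d rowd ps)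
    (hb : IsRow D b rowb ps) (hnodup : (z :: i :: d :: b :: ps).Nodup) :
    badWithThree zi zd zb id ib db rowb rowz rowi rowd ≠ true := by
  unfold IsRow at hb
  induction hb generalizing rowz rowi rowd with
  | nil => exact Bool.false_ne_true
  | @cons ba a rowb ps hba _ ih =>
    obtain ⟨za, rowz, hza, hz', rfl⟩ := List.forall₂_cons_right_iff.1 hz
    obtain ⟨ia, rowi, hia, hi', rfl⟩ := List.forall₂_cons_right_iff.1 hi
    obtain ⟨da, rowd, hda, hd', rfl⟩ := List.forall₂_cons_right_iff.1 hd
    intro h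
    rcases or_of_decide h with h | h
    · refine not_badFive (o := z) (p := i) (q := d) (r := b) (s := a) (hD.of_subset ?_)
        (hnodup.sublist (by simp)) h
      simp [*]
    · exact ih hz' hi' hd' (hnodup.sublist (by simp)) h

theorem not_badWithTwo {D : List (ℕ × ℝ)} (hD : SamePattern D) {X : Set (E 2)} {forb : ℕ}
    (hX : Avoids forb X) {zi zd id : ℕ}
    {z i d : E 2} (hzi : (zi, dist z i) ∈ D) (hzd : (zd, dist z d) ∈ D) (hid : (id, dist i d) ∈ D)
    {ps : List (E 2)} {rows : List (List ℕ)} {rowz rowi rowd : List ℕ}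
    (hz : IsRow D z rowz ps) (hi : IsRow D i rowi ps) (hd : IsRow D d rowd ps)
    (hrows : AreRows D rows ps) (hnodup : (z :: i :: d :: ps).Nodup)
    (hsub : ∀ p ∈ z :: i :: d :: ps, p ∈ X) :
    badWithTwo forb zi zd id rows rowz rowi rowd ≠ true := by
  induction hrows generalizing rowz rowi rowd with
  | nil => exact Bool.false_ne_true
  | @cons b rowb ps rows hb hrows ih =>
    obtain ⟨zb, rowz, hzb, hz', rfl⟩ := List.forall₂_cons_right_iff.1 hz
    obtain ⟨ib, rowi, hib, hi', rfl⟩ := List.forall₂_cons_right_iff.1 hi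
    obtain ⟨db, rowd, hdb, hd', rfl⟩ := List.forall₂_cons_right_iff.1 hd
    intro h
    rcases or_of_decide h with h | h
    · refine hX _ _ _ _ _ _ z (hsub _ (by simp)) i (hsub _ (by simp)) d (hsub _ (by simp)) b
        (hsub _ (by simp)) (hnodup.sublist (by simp)) (hD.of_subset ?_) h
      simp [*]
    · rcases or_of_decide h with h | h
      · exact not_badWithThree hD hzi hzd hzb hid hib hdb hz' hi' hd' hb hnodup h
      · exact ih hz' hi' hd' (hnodup.sublist (by simp))
          (fun p hp => hsub p (by simp only [List.mem_cons] at hp ⊢; tauto)) h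

theorem not_badWithOne {D : List (ℕ × ℝ)} (hD : SamePattern D) {X : Set (E 2)} {forb : ℕ}
    (hX : Avoids forb X) {zi : ℕ} {z i : E 2} (hzi : (zi, dist z i) ∈ D)
    {ps : List (E 2)} {rows : List (List ℕ)} {rowz rowi : List ℕ}
    (hz : IsRow D z rowz ps) (hi : IsRow D i rowi ps)
    (hrows : AreRows D rows ps) (hnodup : (z :: i :: ps).Nodup)
    (hsub : ∀ p ∈ z :: i :: ps, p ∈ X) :
    badWithOne forb zi rows rowz rowi ≠ true := by
  induction hrows generalizing rowz rowi with
  | nil => exact Bool.false_ne_true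
  | @cons d rowd ps rows hd hrows ih =>
    obtain ⟨zd, rowz, hzd, hz', rfl⟩ := List.forall₂_cons_right_iff.1 hz
    obtain ⟨id, rowi, hid, hi', rfl⟩ := List.forall₂_cons_right_iff.1 hi
    intro h
    rcases or_of_decide h with h | h
    · exact not_badWithTwo hD hX hzi hzd hid hz' hi' hd hrows hnodup hsub h
    · exact ih hz' hi' (hnodup.sublist (by simp))
        (fun p hp => hsub p (by simp only [List.mem_cons] at hp ⊢; tauto)) h

/-! ### Correctness of the search -/

theorem length_le_three_of_nodup {X : Set (E 2)} (hX : IsLocallyDistanceSet 3 X) {p : E 2}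
    (hp : p ∈ X) {xs : List ℝ} (hxs : xs.Nodup) (h : ∀ x ∈ xs, x ∈ distancesFrom X p) :
    xs.length ≤ 3 := by
  classical
  have h1 : ((xs.toFinset : Set ℝ)).encard ≤ 3 :=
    (Set.encard_le_encard fun x hx => h x (by simpa using hx)).trans (hX p hp)
  rw [Set.encard_coe_eq_coe_finsetCard, List.toFinset_card_of_nodup hxs] at h1
  exact_mod_cast h1

/-- The colours in `pal` stand for different distances from `p` to other points of `X`. -/
def IsPalette (X : Set (E 2)) (D : List (ℕ × ℝ)) (pal : List ℕ) (p : E 2) : Prop :=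
  ∃ xs : List ℝ, xs.Nodup ∧ (∀ x ∈ xs, x ∈ distancesFrom X p) ∧
    List.Forall₂ (fun c x => (c, x) ∈ D) pal xs

theorem IsPalette.mono {X : Set (E 2)} {D D' : List (ℕ × ℝ)} (hD : D ⊆ D') {pal : List ℕ} {p : E 2}
    (h : IsPalette X D pal p) : IsPalette X D' pal p := by
  obtain ⟨xs, h1, h2, h3⟩ := h
  exact ⟨xs, h1, h2, h3.imp fun _ _ hc => hD hc⟩

theorem isMem_iff {x : ℕ} {l : List ℕ} : isMem x l = true ↔ x ∈ l := by
  induction l with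
  | nil => simp [isMem]
  | cons y l ih =>
    change decide! (Nat.beq x y) true (isMem x l) = true ↔ _
    cases h : Nat.beq x y
    · simpa [Nat.ne_of_beq_eq_false h] using ih
    · simp [Nat.eq_of_beq_eq_true h]

theorem len_eq {α : Type} (l : List α) : len l = l.length := by
  induction l with
  | nil => rfl
  | cons x l ih => exact congrArg Nat.succ ih

theorem exists_of_allList {α : Type} {f : α → Bool} {l : List α} (h : allList f l = true) :
    ∀ x ∈ l, f x = true := by
  induction l with
  | nil => simp
  | cons x l ih =>
    change decide! (f x) (allList f l) false = true at h
    cases hx : f x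
    · simp [hx] at h
    · rw [hx] at h
      exact List.forall_mem_cons.2 ⟨hx, ih h⟩

/-- A new colour stands for a new distance, since equal distances have equal colours in `D`. -/
theorem IsPalette.cons {X : Set (E 2)} {D : List (ℕ × ℝ)} (hD : SamePattern D) {pal : List ℕ}
    {p : E 2} (hpal : IsPalette X D pal p) {k : ℕ} {x : ℝ} (hk : (k, x) ∈ D)
    (hx : x ∈ distancesFrom X p) (hmem : k ∉ pal) : IsPalette X D (k :: pal) p := by
  obtain ⟨xs, h1, h2, h3⟩ := hpal
  have hx' : x ∉ xs := fun hxs => by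
    obtain ⟨j, hj, rfl⟩ := List.getElem_of_mem hxs
    have hj' : j < pal.length := h3.length_eq ▸ hj
    have h4 : (pal[j], xs[j]) ∈ D := (List.forall₂_iff_get.1 h3).2 j hj' hj
    have : k = pal[j] := (hD _ hk _ h4).2 rfl
    exact hmem (this ▸ List.getElem_mem hj')
  exact ⟨x :: xs, List.nodup_cons.2 ⟨hx', h1⟩, List.forall_mem_cons.2 ⟨hx, h2⟩, .cons hk h3⟩

theorem IsPalette.length_le_three {X : Set (E 2)} (hX : IsLocallyDistanceSet 3 X)
    {D : List (ℕ × ℝ)} {pal : List ℕ} {p : E 2} (hp : p ∈ X) (hpal : IsPalette X D pal p) :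
    pal.length ≤ 3 := by
  obtain ⟨xs, h1, h2, h3⟩ := hpal
  exact h3.length_eq ▸ length_le_three_of_nodup hX hp h1 h2

/-- For a colour that is really seen at `p`, the branch that `addColour` closes would give four
distances from `p`. So the continuation must have been called. -/
theorem IsPalette.exists_of_addColour {X : Set (E 2)} (hX : IsLocallyDistanceSet 3 X)
    {D : List (ℕ × ℝ)} (hD : SamePattern D) {pal : List ℕ} {p : E 2} (hp : p ∈ X)
    (hpal : IsPalette X D pal p) {k : ℕ} {x : ℝ} (hk : (k, x) ∈ D) (hx : x ∈ distancesFrom X p)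
    {f : List ℕ → Bool} (h : addColour pal k f = true) :
    ∃ pal', IsPalette X D pal' p ∧ f pal' = true := by
  unfold addColour at h
  cases hmem : isMem k pal
  · have hnew := hpal.cons hD hk hx fun h => by simp [isMem_iff.2 h] at hmem
    have hble : Nat.ble 3 (len pal) = false := by
      have := hnew.length_le_three hX hp
      rw [Bool.eq_false_iff, Ne, Nat.ble_eq, len_eq]
      exact Nat.not_le.2 this
    rw [hmem, hble] at h
    exact ⟨_, hnew, h⟩
  · rw [hmem] at h
    exact ⟨pal, hpal, h⟩

/-- A palette of three colours is complete. This is why `extend` tries only the colours of a full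
palette. -/
theorem IsPalette.exists_mem {X : Set (E 2)} (hX : IsLocallyDistanceSet 3 X)
    {D : List (ℕ × ℝ)} {pal : List ℕ} {p : E 2} (hp : p ∈ X)
    (hpal : IsPalette X D pal p) (hlen : 3 ≤ len pal) {x : ℝ} (hx : x ∈ distancesFrom X p) :
    ∃ k ∈ pal, (k, x) ∈ D := by
  obtain ⟨xs, h1, h2, h3⟩ := hpal
  by_cases hxs : x ∈ xs
  · obtain ⟨j, hj, rfl⟩ := List.getElem_of_mem hxs
    have hj' : j < pal.length := h3.length_eq ▸ hj
    exact ⟨pal[j], List.getElem_mem hj', (List.forall₂_iff_get.1 h3).2 j hj' hj⟩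
  · have := length_le_three_of_nodup hX hp (List.nodup_cons.2 ⟨hxs, h1⟩)
      (List.forall_mem_cons.2 ⟨hx, h2⟩)
    rw [List.length_cons, ← h3.length_eq, ← len_eq] at this
    omega

/-! ### Dictionaries of colours and keys of points. -/

/-- The number that encodes a list of labels of distances. -/
noncomputable def distKey (cls : ℝ → ℕ) (z : E 2) (ps : List (E 2)) : ℕ :=
  ps.foldr (fun q r => cls (dist z q) + 8 * r) 0

/-- The list `D` is a dictionary of colours and distances, the colours in `fresh` are available, and
`cls` assigns to a distance its colour if that is less than `6`, and `6` otherwise. -/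
structure IsDictionary (cls : ℝ → ℕ) (D : List (ℕ × ℝ)) (fresh : List ℕ) : Prop where
  samePattern : SamePattern D
  cls_eq : ∀ p ∈ D, cls p.2 = if 6 ≤ p.1 then 6 else p.1
  cls_eq_six : ∀ x, (∀ p ∈ D, p.2 ≠ x) → cls x = 6
  nodup : fresh.Nodup
  six_le : ∀ k ∈ fresh, 6 ≤ k
  new : ∀ k ∈ fresh, ∀ p ∈ D, p.1 ≠ k

theorem IsDictionary.cons {cls : ℝ → ℕ} {D : List (ℕ × ℝ)} {k : ℕ} {fresh : List ℕ}
    (h : IsDictionary cls D (k :: fresh)) {x : ℝ} (hx : ∀ p ∈ D, p.2 ≠ x) :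
    IsDictionary cls ((k, x) :: D) fresh where
  samePattern := by
    have hk := h.new k List.mem_cons_self
    intro p hp q hq
    rcases List.mem_cons.1 hp with rfl | hp <;> rcases List.mem_cons.1 hq with rfl | hq
    · simp
    · simp [(hk q hq).symm, (hx q hq).symm]
    · simp [hk p hp, hx p hp]
    · exact h.samePattern p hp q hq
  cls_eq := List.forall_mem_cons.2
    ⟨by rw [if_pos (h.six_le k List.mem_cons_self)]; exact h.cls_eq_six x hx, h.cls_eq⟩
  cls_eq_six y hy := h.cls_eq_six y fun p hp => hy p (List.mem_cons_of_mem _ hp)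
  nodup := (List.nodup_cons.1 h.nodup).2
  six_le j hj := h.six_le j (List.mem_cons_of_mem _ hj)
  new j hj := List.forall_mem_cons.2
    ⟨fun hkj : k = j => (List.nodup_cons.1 h.nodup).1 (hkj ▸ hj),
      h.new j (List.mem_cons_of_mem _ hj)⟩

/-- To sort the points before the search, their keys must not depend on its course. Colours from `6`
on are handed out as the search meets new distances, so they are identified; the smaller colours
belong to the initial points and are fixed by `cls`. -/
theorem key_eq {cls : ℝ → ℕ} {D : List (ℕ × ℝ)} {fresh : List ℕ} (h : IsDictionary cls D fresh)
    {z : E 2} {col : List ℕ} {ps : List (E 2)} (hcol : IsRow D z col ps) :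
    key col = distKey cls z ps := by
  unfold IsRow at hcol
  induction hcol with
  | nil => rfl
  | @cons c q col ps hc _ ih =>
    change decide! (Nat.ble 6 c) 6 c + 8 * key col = cls (dist z q) + 8 * distKey cls z ps
    rw [ih, h.cls_eq _ hc]
    cases hb : Nat.ble 6 c
    · rw [if_neg fun h6 => by simp [Nat.ble_eq_true_of_le h6] at hb]
    · rw [if_pos (Nat.le_of_ble_eq_true hb)]

theorem lastEntries_eq_drop (n : ℕ) (l : List ℕ) : lastEntries n l = l.drop (l.length - n) := by
  induction l with
  | nil => exact List.drop_nil.symm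
  | cons x l ih =>
    change decide! (Nat.ble n (len l)) (lastEntries n l) (x :: l) = _
    rw [len_eq]
    cases hb : Nat.ble n l.length
    · have : ¬ n ≤ l.length := fun h => by simp [Nat.ble_eq_true_of_le h] at hb
      rw [List.length_cons, show l.length + 1 - n = 0 by omega, List.drop_zero]
    · have := Nat.le_of_ble_eq_true hb
      rw [List.length_cons, show l.length + 1 - n = l.length - n + 1 by omega, List.drop_succ_cons]
      exact ih

theorem IsRow.lastEntries {D : List (ℕ × ℝ)} {z : E 2} {col : List ℕ} {ps root : List (E 2)}
    (h : IsRow D z col ps) (hroot : root <:+ ps) :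
    IsRow D z (lastEntries root.length col) root := by
  obtain ⟨pre, rfl⟩ := hroot
  rw [lastEntries_eq_drop, h.length_eq, List.length_append, Nat.add_sub_cancel]
  have := List.forall₂_drop pre.length h
  rwa [List.drop_left] at this

/-- The lists in `pals` are palettes of the points in `ps`. -/
def ArePalettes (X : Set (E 2)) (D : List (ℕ × ℝ)) (pals : List (List ℕ))
    (ps : List (E 2)) : Prop :=
  List.Forall₂ (IsPalette X D) pals ps

theorem ArePalettes.mono {X : Set (E 2)} {D D' : List (ℕ × ℝ)} (hD : D ⊆ D') {pals : List (List ℕ)}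
    {ps : List (E 2)} (h : ArePalettes X D pals ps) : ArePalettes X D' pals ps :=
  h.imp fun _ _ hp => hp.mono hD

theorem eq_true_of_decide {b c : Bool} (h : decide! b c false = true) : b = true ∧ c = true := by
  cases b
  · exact absurd h Bool.false_ne_true
  · exact ⟨rfl, h⟩

/-- The value `true` means that all branches are closed or accepted. The proof follows the branch
given by the actual distances from `z`, beginning with the oldest point as `extend` does: the
induction hypothesis is applied with the continuation that treats the head point `i`. No test closes
this branch, so its continuation returns `true`. -/
theorem exists_of_extend {X : Set (E 2)} (hX : IsLocallyDistanceSet 3 X) {forb : ℕ}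
    (hforb : Avoids forb X) {cls : ℝ → ℕ} {prev : ℕ} {z : E 2} {root : List (E 2)}
    (hz : z ∈ X) (hprev : prev ≤ distKey cls z root) {D : List (ℕ × ℝ)}
    {rows pals : List (List ℕ)} {ps : List (E 2)} (hrows : AreRows D rows ps)
    {fresh : List ℕ} (hD : IsDictionary cls D fresh) (hpals : ArePalettes X D pals ps)
    (hnodup : (z :: ps).Nodup) (hsub : ∀ p ∈ ps, p ∈ X)
    (hroot : ∀ l, l <:+ ps → l.length = root.length → l = root)
    {cont : List ℕ → List ℕ → List (List ℕ) → List ℕ → List ℕ → Bool}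
    (h : extend forb root.length prev rows pals (D.map Prod.fst) fresh cont = true) :
    ∃ D' col zpal pals' fresh', D ⊆ D' ∧ IsDictionary cls D' fresh' ∧ IsRow D' z col ps ∧
      IsPalette X D' zpal z ∧ ArePalettes X D' pals' ps ∧
      cont col zpal pals' (D'.map Prod.fst) fresh' = true := by
  induction hrows generalizing pals fresh cont with
  | nil =>
    exact ⟨D, [], [], [], fresh, List.Subset.refl _, hD, .nil, ⟨[], List.nodup_nil, by simp, .nil⟩,
      .nil, h⟩
  | @cons i row ps rows hrow hrows ih =>
    obtain ⟨pal, pals, hpal, hpals', rfl⟩ := List.forall₂_cons_right_iff.1 hpals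
    have hnodup' : (z :: ps).Nodup := hnodup.sublist (by simp)
    have hsuff : ps <:+ i :: ps := List.suffix_cons i ps
    obtain ⟨D₁, col, zpal, pals₁, fresh₁, hDD, hD₁, hcol, hzpal, hpals₁, h⟩ :=
      ih hD hpals' hnodup' (fun p hp => hsub p (List.mem_cons_of_mem _ hp))
        (fun l hl => hroot l (hl.trans hsuff)) h
    have hi : i ∈ X := hsub i List.mem_cons_self
    have hzi : z ≠ i := by
      rintro rfl
      exact (List.nodup_cons.1 hnodup).1 List.mem_cons_self
    have hr : dist z i ∈ distancesFrom X i := ⟨z, hz, hzi.symm, dist_comm _ _⟩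
    have hr' : dist z i ∈ distancesFrom X z := ⟨i, hi, hzi, rfl⟩
    have hpal₁ := hpal.mono hDD
    -- The order test concerns the moment when the column covers exactly the root. The key of the
    -- column is then that of `z`, which is at least `prev`, so the test does not close the branch.
    replace h : decide! (allList (fun k => addColour pal k fun pal => addColour zpal k fun zpal =>
                  decide! (badWithOne forb k rows col row) true
                    (cont (k :: col) zpal (pal :: pals₁) (D₁.map Prod.fst) fresh₁))
                (decide! (Nat.ble 3 (len pal)) pal (D₁.map Prod.fst)))
              (decide! (Nat.ble 3 (len pal)) true
                (cases! fresh₁ false fun k fresh _ =>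
                  addColour pal k fun pal => addColour zpal k fun zpal =>
                    decide! (badWithOne forb k rows col row) true
                      (cont (k :: col) zpal (pal :: pals₁) (k :: D₁.map Prod.fst) fresh)))
              false = true := by
      have hguard :
          decide! (Nat.beq (len row) root.length) (Nat.ble prev (key col)) true = true := by
        cases hb : Nat.beq (len row) root.length
        · rfl
        · have hlen := Nat.eq_of_beq_eq_true hb
          rw [len_eq, hrow.length_eq] at hlen
          rw [key_eq hD₁ hcol, hroot ps hsuff hlen]
          exact Nat.ble_eq_true_of_le hprev
      change decide! (decide! (Nat.beq (len row) root.length) (Nat.ble prev (key col)) true) _ true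
        = true at h
      rwa [hguard] at h
    obtain ⟨h1, h2⟩ := eq_true_of_decide h
    -- The common end of the three cases: the colour of `dist z i` is known, new, or taken from a
    -- full palette.
    have finish : ∀ (k : ℕ) (D₂ : List (ℕ × ℝ)) (fresh₂ : List ℕ), (k, dist z i) ∈ D₂ → D₁ ⊆ D₂ →
        IsDictionary cls D₂ fresh₂ → (addColour pal k fun pal => addColour zpal k fun zpal =>
          decide! (badWithOne forb k rows col row) true
            (cont (k :: col) zpal (pal :: pals₁) (D₂.map Prod.fst) fresh₂)) = true →
        ∃ D' col zpal pals' fresh', D ⊆ D' ∧ IsDictionary cls D' fresh' ∧ IsRow D' z col (i :: ps) ∧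
          IsPalette X D' zpal z ∧ ArePalettes X D' pals' (i :: ps) ∧
          cont col zpal pals' (D'.map Prod.fst) fresh' = true := by
      intro k D₂ fresh₂ hk hDD₂ hD₂ h
      obtain ⟨pal', hpal', h⟩ :=
        (hpal₁.mono hDD₂).exists_of_addColour hX hD₂.samePattern hi hk hr h
      obtain ⟨zpal', hzpal', h⟩ :=
        (hzpal.mono hDD₂).exists_of_addColour hX hD₂.samePattern hz hk hr' h
      have hDD' := List.Subset.trans hDD hDD₂
      refine ⟨D₂, k :: col, zpal', pal' :: pals₁, fresh₂, hDD', hD₂, .cons hk (hcol.mono hDD₂),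
        hzpal', .cons hpal' (hpals₁.mono hDD₂), (or_of_decide h).resolve_left ?_⟩
      exact not_badWithOne hD₂.samePattern hforb hk (hcol.mono hDD₂) (hrow.mono hDD')
        (hrows.mono hDD') hnodup (List.forall_mem_cons.2 ⟨hz, hsub⟩)
    cases hb : Nat.ble 3 (len pal)
    · rw [hb] at h1 h2
      by_cases hmem : ∃ p ∈ D₁, p.2 = dist z i
      · obtain ⟨⟨k, x⟩, hp, rfl⟩ := hmem
        exact finish k D₁ fresh₁ hp (List.Subset.refl _) hD₁
          (exists_of_allList h1 k (List.mem_map_of_mem hp))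
      · push Not at hmem
        -- Without a fresh colour the search answers `false`, so no bound on the number of colours
        -- has to be proved.
        cases fresh₁ with
        | nil => exact absurd h2 Bool.false_ne_true
        | cons k fresh₂ =>
          exact finish k ((k, dist z i) :: D₁) fresh₂ List.mem_cons_self (List.subset_cons_self _ _)
            (hD₁.cons hmem) h2
    · rw [hb] at h1
      obtain ⟨k, hk, hkD⟩ := hpal₁.exists_mem hX hi (Nat.le_of_ble_eq_true hb) hr
      exact finish k D₁ fresh₁ hkD (List.Subset.refl _) hD₁ (exists_of_allList h1 k hk)

/-- Iteration of `exists_of_extend`. The points `zs` are added in the order of increasing keys, so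
the key of the point just added is a valid lower bound for the next one. -/
theorem exists_of_search {X : Set (E 2)} (hX : IsLocallyDistanceSet 3 X) {forb : ℕ}
    (hforb : Avoids forb X) {cls : ℝ → ℕ} {root : List (E 2)}
    {final : List (List ℕ) → Bool} {prev : ℕ} {zs : List (E 2)}
    (hzs : zs.Pairwise fun y z => distKey cls y root ≤ distKey cls z root)
    (hprev : ∀ z ∈ zs, prev ≤ distKey cls z root)
    {D : List (ℕ × ℝ)} {rows pals : List (List ℕ)} {ps : List (E 2)} (hrows : AreRows D rows ps)
    {fresh : List ℕ} (hD : IsDictionary cls D fresh) (hpals : ArePalettes X D pals ps)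
    (hnodup : (zs ++ ps).Nodup) (hsub : ∀ p ∈ zs ++ ps, p ∈ X) (hroot : root <:+ ps)
    (h : search forb root.length final zs.length prev rows pals (D.map Prod.fst) fresh = true) :
    ∃ D' rows', SamePattern D' ∧ AreRows D' rows' (zs.reverse ++ ps) ∧ final rows' = true := by
  induction zs generalizing prev D rows pals ps fresh with
  | nil => exact ⟨D, rows, hD.samePattern, hrows, h⟩
  | cons z zs ih =>
    obtain ⟨hz1, hz2⟩ := List.pairwise_cons.1 hzs
    have hnodup' : (z :: ps).Nodup := hnodup.sublist (by simp)
    obtain ⟨D', col, zpal, pals', fresh', hDD, hD', hcol, hzpal, hpals', h⟩ :=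
      exists_of_extend hX hforb (hsub z (by simp)) (hprev z List.mem_cons_self) hrows hD hpals
        hnodup' (fun p hp => hsub p (by simp [hp]))
        (fun l hl hlen => (List.suffix_of_suffix_length_le hl hroot hlen.le).eq_of_length hlen) h
    have hkey : key (lastEntries root.length col) = distKey cls z root :=
      key_eq hD' (hcol.lastEntries hroot)
    rw [hkey] at h
    have := ih hz2 hz1 (.cons hcol (hrows.mono hDD)) hD' (.cons hzpal hpals')
      (hnodup.perm List.perm_middle.symm) (fun p hp => hsub p (List.perm_middle.mem_iff.1 hp))
      (hroot.trans (List.suffix_cons z ps)) h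
    simpa using this

/-! ### The results of the search -/

/-- A final test that is constantly `false` makes `true` mean that every branch is closed before all
the points are added. -/
theorem searchFrom_square_five : searchFrom 0 (fun _ => false) 5 square = true := by
  decide +kernel

theorem searchFrom_square_four :
    searchFrom 0 (fun rows => decide (rows = squareRows)) 4 square = true := by
  decide +kernel

theorem searchFrom_trapezoid : searchFrom (codeSet [square])
    (fun rows => decide (rows = trapezoidRows)) 4 trapezoid = true := by
  decide +kernel

theorem searchFromAll_take : searchFromAll (fourPatterns.take 6) [trapezoid, square] = true := by
  decide +kernel

theorem searchFromAll_drop : searchFromAll (fourPatterns.drop 6)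
    (fourPatterns.take 6 ++ [trapezoid, square]) = true := by
  decide +kernel

theorem searchFromPoint_eq_true :
    searchFromPoint (codeSet (square :: trapezoid :: fourPatterns)) 4 = true := by
  decide +kernel

/-! ### The patterns of locally three-distance sets -/

/-- The colours of the edges among `1, 2, 3, 4` are less than `6`. -/
def Pattern.IsSmall (P : Pattern) : Prop :=
  P.e12 < 6 ∧ P.e13 < 6 ∧ P.e14 < 6 ∧ P.e23 < 6 ∧ P.e24 < 6 ∧ P.e34 < 6

instance : DecidablePred Pattern.IsSmall := fun P => by unfold Pattern.IsSmall; infer_instance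

theorem mem_distancesFrom {X : Set (E 2)} {p q : E 2} (hq : q ∈ X) (hpq : p ≠ q) :
    dist p q ∈ distancesFrom X p := ⟨q, hq, hpq, rfl⟩

theorem insertColour_eq (k : ℕ) (l : List ℕ) :
    insertColour k l = if k ∈ l then l else k :: l := by
  change decide! (isMem k l) l (k :: l) = _
  cases h : isMem k l
  · rw [if_neg fun hk => by simp [isMem_iff.2 hk] at h]
  · rw [if_pos (isMem_iff.1 h)]

theorem IsPalette.insert {X : Set (E 2)} {D : List (ℕ × ℝ)} (hD : SamePattern D) {pal : List ℕ}
    {p : E 2} (hpal : IsPalette X D pal p) {k : ℕ} {x : ℝ} (hk : (k, x) ∈ D)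
    (hx : x ∈ distancesFrom X p) : IsPalette X D (insertColour k pal) p := by
  rw [insertColour_eq]
  split_ifs with h
  · exact hpal
  · exact hpal.cons hD hk hx h

theorem isPalette_singleton {X : Set (E 2)} {D : List (ℕ × ℝ)} {p : E 2} {k : ℕ} {x : ℝ}
    (hk : (k, x) ∈ D) (hx : x ∈ distancesFrom X p) : IsPalette X D [k] p :=
  ⟨[x], by simp, by simpa using hx, .cons hk .nil⟩

/-- An insertion of a colour comes from an insertion into a dictionary. -/
theorem exists_insert {L D : List (ℕ × ℝ)} (hL : SamePattern L) (hD : D ⊆ L) {k : ℕ} {x : ℝ}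
    (hk : (k, x) ∈ L) :
    ∃ D', D'.map Prod.fst = insertColour k (D.map Prod.fst) ∧ D ⊆ D' ∧ D' ⊆ L ∧ (k, x) ∈ D' := by
  rw [insertColour_eq]
  split_ifs with h
  · obtain ⟨⟨j, y⟩, hj, rfl⟩ := List.mem_map.1 h
    have : y = x := (hL _ (hD hj) _ hk).1 rfl
    exact ⟨D, rfl, List.Subset.refl _, hD, this ▸ hj⟩
  · exact ⟨(k, x) :: D, rfl, List.subset_cons_self _ _, List.cons_subset.2 ⟨hk, hD⟩,
      List.mem_cons_self⟩

/-- The labels are read off from `D`. As its colours are below `6`, the label `6` is free for all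
the other distances, and the fresh colours are new. -/
theorem exists_isDictionary {D : List (ℕ × ℝ)} (hD : SamePattern D) (hsmall : ∀ p ∈ D, p.1 < 6) :
    ∃ cls, IsDictionary cls D freshColours := by
  have hex : ∀ x : ℝ, ∃ n, (∃ p ∈ D, p.2 = x ∧ p.1 = n) ∨ ((∀ p ∈ D, p.2 ≠ x) ∧ n = 6) := by
    intro x
    by_cases h : ∃ p ∈ D, p.2 = x
    · obtain ⟨p, hp, h⟩ := h
      exact ⟨p.1, .inl ⟨p, hp, h, rfl⟩⟩
    · push Not at h
      exact ⟨6, .inr ⟨h, rfl⟩⟩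
  choose cls hcls using hex
  have hfresh : ∀ k ∈ freshColours, 6 ≤ k := by decide
  refine ⟨cls, hD, fun p hp => ?_, fun x hx => ?_, by decide, hfresh, fun k hk p hp => ?_⟩
  · rw [if_neg (Nat.not_le.2 (hsmall p hp))]
    rcases hcls p.2 with ⟨q, hq, h1, h2⟩ | ⟨h, -⟩
    · rw [← h2]
      exact (hD q hq p hp).2 h1
    · exact absurd rfl (h p hp)
  · rcases hcls x with ⟨q, hq, h1, -⟩ | ⟨-, h⟩
    · exact absurd h1 (hx q hq)
    · exact h
  · exact ((hsmall p hp).trans_le (hfresh k hk)).ne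

/-- A set with enough points contains a list of further points, ordered by a key. -/
theorem exists_sorted_list {X : Set (E 2)} {ps : List (E 2)} (hps : ps.Nodup) (f : E 2 → ℕ) {n : ℕ}
    (hX : ((n + ps.length : ℕ) : ℕ∞) ≤ X.encard) :
    ∃ zs : List (E 2), zs.length = n ∧ zs.Pairwise (fun y z => f y ≤ f z) ∧ (zs ++ ps).Nodup ∧
      ∀ z ∈ zs, z ∈ X := by
  classical
  have h1 : (n : ℕ∞) ≤ (X \ (ps.toFinset : Set (E 2))).encard := by
    have h2 := X.encard_le_encard_sdiff_add_encard (ps.toFinset : Set (E 2))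
    rw [Set.encard_coe_eq_coe_finsetCard, List.toFinset_card_of_nodup hps] at h2
    have h3 := hX.trans h2
    rw [Nat.cast_add] at h3
    exact (ENat.add_le_add_iff_right (ENat.natCast_ne_top _)).1 h3
  obtain ⟨T, hT, hTn⟩ := Set.exists_subset_encard_eq h1
  have hfin : T.Finite := Set.finite_of_encard_eq_coe hTn
  refine ⟨hfin.toFinset.toList.insertionSort (fun y z => f y ≤ f z), ?_, ?_, ?_, fun z hz => ?_⟩
  · rw [List.length_insertionSort, Finset.length_toList]
    rw [hfin.encard_eq_coe_toFinset_card] at hTn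
    exact_mod_cast hTn
  · have : Std.Total (fun y z : E 2 => f y ≤ f z) := ⟨fun y z => le_total (f y) (f z)⟩
    have : IsTrans (E 2) (fun y z => f y ≤ f z) := ⟨fun x y z => le_trans⟩
    exact List.pairwise_insertionSort _ _
  · refine List.Nodup.append ?_ hps fun z hz hz' => ?_
    · exact (List.perm_insertionSort _ _).nodup_iff.2 (Finset.nodup_toList _)
    · rw [List.mem_insertionSort, Finset.mem_toList, hfin.mem_toFinset] at hz
      exact (hT hz).2 (by simpa using hz')
  · rw [List.mem_insertionSort, Finset.mem_toList, hfin.mem_toFinset] at hz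
    exact (hT hz).1

/-- Four points with the pattern `P` form the root, and `n` further points of `X`, sorted by their
keys, are added. Only a lower bound on the cardinality is needed, so `X` may be infinite. -/
theorem exists_of_searchFrom {X : Set (E 2)} (hX : IsLocallyDistanceSet 3 X) {forb : ℕ}
    (hforb : Avoids forb X) {P : Pattern} (hP : P.IsSmall) (hPX : P.FoundIn X)
    {final : List (List ℕ) → Bool} {n : ℕ} (hn : ((n + 4 : ℕ) : ℕ∞) ≤ X.encard)
    (h : searchFrom forb final n P = true) :
    ∃ D rows ps, SamePattern D ∧ AreRows D rows ps ∧ ps.Nodup ∧ (∀ p ∈ ps, p ∈ X) ∧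
      ps.length = n + 4 ∧ final rows = true := by
  obtain ⟨p, hp, q, hq, r, hr, s, hs, hd, hL⟩ := hPX
  cases P with
  | mk _ _ _ _ a b c d e f =>
    dsimp only at hL
    have hsmall : ∀ x ∈ [(a, dist p q), (b, dist p r), (c, dist p s), (d, dist q r), (e, dist q s),
      (f, dist r s)], x.1 < 6 := by simpa [Pattern.IsSmall] using hP
    set L := [(a, dist p q), (b, dist p r), (c, dist p s), (d, dist q r), (e, dist q s),
      (f, dist r s)] with hLdef
    -- The dictionary is built by the same insertions as the list of known colours in `searchFrom`,
    -- since its first components have to be exactly that list.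
    have h6 : [(f, dist r s)] ⊆ L := by simp [hLdef]
    obtain ⟨D5, e5, s5, l5, m5⟩ := exists_insert hL h6 (k := e) (x := dist q s) (by simp [hLdef])
    obtain ⟨D4, e4, s4, l4, m4⟩ := exists_insert hL l5 (k := d) (x := dist q r) (by simp [hLdef])
    obtain ⟨D3, e3, s3, l3, m3⟩ := exists_insert hL l4 (k := c) (x := dist p s) (by simp [hLdef])
    obtain ⟨D2, e2, s2, l2, m2⟩ := exists_insert hL l3 (k := b) (x := dist p r) (by simp [hLdef])
    obtain ⟨D, e1, s1, l1, ma⟩ := exists_insert hL l2 (k := a) (x := dist p q) (by simp [hLdef])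
    have mb := s1 m2
    have mc := s1 (s2 m3)
    have md := s1 (s2 (s3 m4))
    have me := s1 (s2 (s3 (s4 m5)))
    have mf := s1 (s2 (s3 (s4 (s5 (List.mem_singleton_self _)))))
    have hD := hL.of_subset l1
    obtain ⟨cls, hdict⟩ := exists_isDictionary hD fun x hx => hsmall x (l1 hx)
    obtain ⟨zs, rfl, hsort, hnodup, hzX⟩ := exists_sorted_list hd
      (fun z => distKey cls z [p, q, r, s]) (n := n) hn
    have hd' := hd
    simp only [List.nodup_cons, List.mem_cons, List.not_mem_nil, or_false, not_or, List.nodup_nil,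
      and_true, not_false_eq_true] at hd'
    obtain ⟨⟨hpq, hpr, hps⟩, ⟨hqr, hqs⟩, hrs⟩ := hd'
    have hpals : ArePalettes X D [insertColour a (insertColour b [c]),
        insertColour a (insertColour d [e]), insertColour b (insertColour d [f]),
        insertColour c (insertColour e [f])] [p, q, r, s] := by
      refine .cons ?_ (.cons ?_ (.cons ?_ (.cons ?_ .nil)))
      · exact ((isPalette_singleton mc (mem_distancesFrom hs hps)).insert hD mb
          (mem_distancesFrom hr hpr)).insert hD ma (mem_distancesFrom hq hpq)
      · exact ((isPalette_singleton me (mem_distancesFrom hs hqs)).insert hD md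
          (mem_distancesFrom hr hqr)).insert hD (dist_comm p q ▸ ma)
          (mem_distancesFrom hp (Ne.symm hpq))
      · exact ((isPalette_singleton mf (mem_distancesFrom hs hrs)).insert hD (dist_comm q r ▸ md)
          (mem_distancesFrom hq (Ne.symm hqr))).insert hD (dist_comm p r ▸ mb)
          (mem_distancesFrom hp (Ne.symm hpr))
      · exact ((isPalette_singleton (dist_comm r s ▸ mf) (mem_distancesFrom hr
          (Ne.symm hrs))).insert hD (dist_comm q s ▸ me) (mem_distancesFrom hq
          (Ne.symm hqs))).insert hD
          (dist_comm p s ▸ mc) (mem_distancesFrom hp (Ne.symm hps))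
    have hrows : AreRows D [[a, b, c], [d, e], [f], []] [p, q, r, s] :=
      .cons (.cons ma (.cons mb (.cons mc .nil))) (.cons (.cons md (.cons me .nil))
        (.cons (.cons mf .nil) (.cons .nil .nil)))
    have hsub : ∀ x ∈ zs ++ [p, q, r, s], x ∈ X := by
      intro x hx
      rcases List.mem_append.1 hx with hx | hx
      · exact hzX x hx
      · simp only [List.mem_cons, List.not_mem_nil, or_false] at hx
        rcases hx with rfl | rfl | rfl | rfl <;> assumption
    have hknown : D.map Prod.fst = insertColour a (insertColour b (insertColour c (insertColour d
        (insertColour e [f])))) := by rw [e1, e2, e3, e4, e5]; rfl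
    obtain ⟨D', rows, h1, h2, h3⟩ := exists_of_search hX hforb (root := [p, q, r, s])
      (final := final) (prev := 0) hsort (fun _ _ => Nat.zero_le _) hrows hdict hpals hnodup hsub
      (List.suffix_refl _)
      (by rw [hknown]; exact h)
    refine ⟨D', rows, zs.reverse ++ [p, q, r, s], h1, h2, ?_, fun x hx => hsub x ?_, by simp, h3⟩
    · exact ((List.reverse_perm zs).append_right _).nodup_iff.2 hnodup
    · simpa using hx

/-- If all 24 patterns are avoided they may be forbidden in the search from a single point, and then
no branch reaches five points. -/
theorem exists_foundIn {X : Set (E 2)} (hX : IsLocallyDistanceSet 3 X) (h5 : 5 ≤ X.encard) :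
    ∃ P ∈ square :: trapezoid :: fourPatterns, P.FoundIn X := by
  by_contra! hno
  obtain ⟨p, hp⟩ : X.Nonempty := by
    rw [← Set.encard_pos]
    exact lt_of_lt_of_le (by norm_num) h5
  obtain ⟨zs, hlen, -, hnodup, hzX⟩ := exists_sorted_list (List.nodup_singleton p) (fun _ => 0)
    (n := 4) h5
  -- A single point has no edges, hence no colours below `6`. All keys agree and the order of the
  -- further points is immaterial.
  have hdict : IsDictionary (fun _ => 6) [] freshColours :=
    ⟨by simp [SamePattern], by simp, by simp, by decide, by decide, by simp⟩
  obtain ⟨-, -, -, -, h⟩ := exists_of_search hX (avoids_codeSet hno) (root := [p])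
    (cls := fun _ => 6) (final := fun _ => false) (prev := 0) (zs := zs)
    (List.pairwise_of_forall fun _ _ => le_rfl)
    (fun _ _ => Nat.zero_le _) (rows := [[]]) (pals := [[]]) (ps := [p]) (.cons .nil .nil)
    hdict (.cons ⟨[], by simp, by simp, .nil⟩ .nil) hnodup
    (fun x hx => by
      rcases List.mem_append.1 hx with hx | hx
      · exact hzX x hx
      · rwa [List.mem_singleton.1 hx])
    (List.suffix_refl _) (by rw [hlen]; exact searchFromPoint_eq_true)
  exact Bool.false_ne_true h

/-- Each excluded pattern becomes forbidden in the searches from the later ones; the order of the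
list matters for this reason. -/
theorem not_foundIn_of_searchFromAll {X : Set (E 2)} (hX : IsLocallyDistanceSet 3 X)
    (h8 : 8 ≤ X.encard) {l earlier : List Pattern} (hl : ∀ P ∈ l, P.IsSmall)
    (hearlier : ∀ P ∈ earlier, ¬ P.FoundIn X) (h : searchFromAll l earlier = true) :
    ∀ P ∈ l, ¬ P.FoundIn X := by
  induction l generalizing earlier with
  | nil => simp
  | cons P l ih =>
    obtain ⟨h1, h2⟩ := eq_true_of_decide h
    rw [force_eq] at h1
    have hP : ¬ P.FoundIn X := fun hP => by
      obtain ⟨-, -, -, -, -, -, -, -, h3⟩ := exists_of_searchFrom hX (avoids_codeSet hearlier)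
        (hl P List.mem_cons_self) hP (n := 4) h8 h1
      exact Bool.false_ne_true h3
    exact List.forall_mem_cons.2 ⟨hP, ih (fun Q hQ => hl Q (List.mem_cons_of_mem _ hQ))
      (List.forall_mem_cons.2 ⟨hP, hearlier⟩) h2⟩

/-! ### Eliminating the trapezoid and finding a square. -/

theorem SamePattern.exists_val {D : List (ℕ × ℝ)} (hD : SamePattern D) :
    ∃ v : ℕ → ℝ, ∀ c x, (c, x) ∈ D → v c = x := by
  have hex : ∀ c : ℕ, ∃ x : ℝ, ∀ y, (c, y) ∈ D → x = y := by
    intro c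
    by_cases h : ∃ x, (c, x) ∈ D
    · obtain ⟨x, hx⟩ := h
      exact ⟨x, fun y hy => (hD _ hx _ hy).1 rfl⟩
    · push Not at h
      exact ⟨0, fun y hy => absurd hy (h y)⟩
  choose v hv using hex
  exact ⟨v, hv⟩

/-- The pattern that extends the one of a trapezoid does not occur in the plane. -/
theorem not_areRows_trapezoidRows {D : List (ℕ × ℝ)} (hD : SamePattern D) {ps : List (E 2)}
    (hps : ps.Nodup) : ¬ AreRows D trapezoidRows ps := by
  intro h
  obtain ⟨v, hv⟩ := hD.exists_val
  unfold trapezoidRows at h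
  rcases h with _ | @⟨p₀, _, _, _, h₀, h⟩
  rcases h with _ | @⟨p₁, _, _, _, h₁, h⟩
  rcases h with _ | @⟨p₂, _, _, _, h₂, h⟩
  rcases h with _ | @⟨p₃, _, _, _, h₃, h⟩
  rcases h with _ | @⟨p₄, _, _, _, h₄, h⟩
  rcases h with _ | @⟨p₅, _, _, _, h₅, h⟩
  rcases h with _ | @⟨p₆, _, _, _, h₆, h⟩
  rcases h with _ | @⟨p₇, _, _, _, h₇, h⟩
  cases h
  simp only [IsRow, List.forall₂_cons, List.Forall₂.nil, and_true] at h₀ h₁ h₂ h₃ h₄ h₅ h₆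
  obtain ⟨d01, d02, d03, d04, d05, d06, d07⟩ := h₀
  obtain ⟨d12, d13, d14, d15, d16, d17⟩ := h₁
  obtain ⟨d23, d24, d25, d26, d27⟩ := h₂
  obtain ⟨d34, d35, d36, d37⟩ := h₃
  obtain ⟨d45, d46, d47⟩ := h₄
  obtain ⟨d56, d57⟩ := h₅
  let t : ℕ → ℝ := fun c => v c ^ 2
  have hsq : ∀ {c x}, (c, x) ∈ D → t c = x ^ 2 := fun {c x} hc => by rw [← hv c x hc]
  have hpos : ∀ {c x}, (c, x) ∈ D → 0 < x → t c ≠ 0 := fun {c x} hc hx => by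
    rw [hsq hc]; positivity
  simp only [List.nodup_cons, List.mem_cons, not_or] at hps
  have t6 := hpos d01 (dist_pos.2 hps.1.1)
  have t7 := hpos d03 (dist_pos.2 hps.1.2.2.1)
  have t1 := hpos d05 (dist_pos.2 hps.1.2.2.2.2.1)
  have m := gramRelations (hsq d01) (hsq d02) (hsq d05) (hsq d06) (hsq d12) (hsq d15) (hsq d16)
    (hsq d25) (hsq d26) (hsq d56)
  have m' := gramRelations (hsq d01) (hsq d03) (hsq d05) (hsq d06) (hsq d13) (hsq d15) (hsq d16)
    (hsq d35) (hsq d36) (hsq d56)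
  -- Two five-point subsets give `t 0 - t 1 = t 7` and `t 0 - t 1 = -t 6`. Together they contradict
  -- the positivity of squared distances.
  have e : t 1 * t 7 * (t 0 - t 1 - t 7) = 0 := by linear_combination 1 / 2 * m.m2 - 1 / 2 * m.m3
  have e' : t 1 * t 1 * (t 0 - t 1 + t 6) = 0 := by linear_combination 1 / 6 * m'.m7 + 1 / 3 * m'.m8
  have e1 := (mul_eq_zero.1 e).resolve_left (mul_ne_zero t1 t7)
  have e2 := (mul_eq_zero.1 e').resolve_left (mul_ne_zero t1 t1)
  have h6 : 0 ≤ t 6 := sq_nonneg _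
  have h7 : 0 ≤ t 7 := sq_nonneg _
  exact t6 (by linarith)

theorem not_foundIn_trapezoid {X : Set (E 2)} (hX : IsLocallyDistanceSet 3 X) (h8 : 8 ≤ X.encard)
    (hsquare : ¬ square.FoundIn X) : ¬ trapezoid.FoundIn X := by
  intro h
  obtain ⟨D, rows, ps, hD, hrows, hps, -, -, h⟩ := exists_of_searchFrom hX
    (avoids_codeSet (l := [square]) (by simpa using hsquare)) (by decide) h (n := 4) h8
    searchFrom_trapezoid
  rw [of_decide_eq_true h] at hrows
  exact not_areRows_trapezoidRows hD hps hrows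

/-- Without a square the trapezoid is impossible, and then so are the other 22 patterns in turn; but
one of the 24 must be present. -/
theorem foundIn_square {X : Set (E 2)} (hX : IsLocallyDistanceSet 3 X) (h8 : 8 ≤ X.encard) :
    square.FoundIn X := by
  by_contra hsquare
  have htrapezoid := not_foundIn_trapezoid hX h8 hsquare
  have hbase : ∀ P ∈ [trapezoid, square], ¬ P.FoundIn X := by simp [hsquare, htrapezoid]
  have htake := not_foundIn_of_searchFromAll hX h8 (by decide) hbase searchFromAll_take
  have hdrop := not_foundIn_of_searchFromAll hX h8 (by decide)
    (List.forall_mem_append.2 ⟨htake, hbase⟩) searchFromAll_drop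
  obtain ⟨P, hP, hPX⟩ := exists_foundIn hX ((by norm_num : (5 : ℕ∞) ≤ 8).trans h8)
  rcases List.mem_cons.1 hP with rfl | hP
  · exact hsquare hPX
  rcases List.mem_cons.1 hP with rfl | hP
  · exact htrapezoid hPX
  rw [← List.take_append_drop 6 fourPatterns] at hP
  exact List.forall_mem_append.2 ⟨htake, hdrop⟩ P hP hPX

/-- More than eight points would contain a square and five further points, which the search excludes
without forbidding any four-point pattern. -/
theorem encard_le_eight {X : Set (E 2)} (hX : IsLocallyDistanceSet 3 X) : X.encard ≤ 8 := by
  by_contra! h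
  have h9 : 9 ≤ X.encard := by
    have := Order.add_one_le_of_lt h
    norm_num at this
    exact this
  obtain ⟨-, -, -, -, -, -, -, -, h⟩ := exists_of_searchFrom hX
    (forb := 0) (by intro; simp [hasBit]) (by decide) (foundIn_square hX h.le) (n := 5) h9
    searchFrom_square_five
  exact Bool.false_ne_true h

theorem exists_areRows_squareRows {X : Set (E 2)} (hX : IsLocallyDistanceSet 3 X)
    (h8 : 8 ≤ X.encard) : ∃ D ps, SamePattern D ∧ AreRows D squareRows ps ∧ ps.Nodup ∧
      (∀ p ∈ ps, p ∈ X) ∧ ps.length = 8 := by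
  obtain ⟨D, rows, ps, hD, hrows, hps, hsub, hlen, h⟩ := exists_of_searchFrom hX
    (forb := 0) (by intro; simp [hasBit]) (by decide) (foundIn_square hX h8) (n := 4) h8
    searchFrom_square_four
  rw [of_decide_eq_true h] at hrows
  exact ⟨D, ps, hD, hrows, hps, hsub, hlen⟩

/-! ### Squares and similarities -/

/-- A rhombus with equal diagonals is a square. -/
theorem square_of_dist_eq {a b c d : E 2} {s : ℝ} (hab : dist a b = s) (hac : dist a c = s)
    (hbd : dist b d = s) (hcd : dist c d = s) (had : dist a d = dist b c) (hbc : b ≠ c) :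
    d - a = (b - a) + (c - a) ∧ inner ℝ (b - a) (c - a) = 0 := by
  have h1 : dist a b ^ 2 = s ^ 2 := by rw [hab]
  have h2 : dist a c ^ 2 = s ^ 2 := by rw [hac]
  have h3 : dist b d ^ 2 = s ^ 2 := by rw [hbd]
  have h4 : dist c d ^ 2 = s ^ 2 := by rw [hcd]
  have h5 : dist a d ^ 2 = dist b c ^ 2 := by rw [had]
  have h6 : dist b c ^ 2 ≠ 0 := pow_ne_zero 2 (dist_pos.2 hbc).ne'
  rw [dist_sq_eq] at h1 h2 h3 h4 h5 h6
  rw [dist_sq_eq] at h5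
  -- The diagonals are perpendicular by `hp` and equally long by `h5`, so by Lagrange's identity the
  -- square of their determinant is the fourth power of `dist b c`.
  have hdet : (d 0 - a 0) * (b 1 - c 1) - (d 1 - a 1) * (b 0 - c 0) ≠ 0 := by
    intro h
    have : ((b 0 - c 0) ^ 2 + (b 1 - c 1) ^ 2) * ((b 0 - c 0) ^ 2 + (b 1 - c 1) ^ 2) = 0 := by
      have hp : (d 0 - a 0) * (b 0 - c 0) + (d 1 - a 1) * (b 1 - c 1) = 0 := by
        linear_combination (h1 - h2 - h3 + h4) / 2
      linear_combination
        ((d 0 - a 0) * (b 1 - c 1) - (d 1 - a 1) * (b 0 - c 0)) * h +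
        ((d 0 - a 0) * (b 0 - c 0) + (d 1 - a 1) * (b 1 - c 1)) * hp -
        ((b 0 - c 0) ^ 2 + (b 1 - c 1) ^ 2) * h5
    exact h6 (mul_self_eq_zero.1 this)
  -- The defect `d - b - c + a` is perpendicular to both diagonals, which are independent, so it
  -- vanishes.
  have hed : (d 0 - b 0 - c 0 + a 0) * (d 0 - a 0) + (d 1 - b 1 - c 1 + a 1) * (d 1 - a 1) = 0 := by
    linear_combination (h3 + h4 - h1 - h2) / 2
  have heg : (d 0 - b 0 - c 0 + a 0) * (b 0 - c 0) + (d 1 - b 1 - c 1 + a 1) * (b 1 - c 1) = 0 := by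
    linear_combination (h2 - h1 - h3 + h4) / 2
  have e0 : d 0 - b 0 - c 0 + a 0 = 0 := by
    refine (mul_eq_zero.1 ?_).resolve_right hdet
    linear_combination (b 1 - c 1) * hed - (d 1 - a 1) * heg
  have e1 : d 1 - b 1 - c 1 + a 1 = 0 := by
    refine (mul_eq_zero.1 ?_).resolve_right hdet
    linear_combination (d 0 - a 0) * heg - (b 0 - c 0) * hed
  constructor
  · ext i
    fin_cases i
    · simp only [PiLp.sub_apply, PiLp.add_apply, Fin.zero_eta]; linarith
    · simp only [PiLp.sub_apply, PiLp.add_apply, Fin.mk_one]; linarith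
  · simp only [PiLp.inner_apply, Fin.sum_univ_two, PiLp.sub_apply, RCLike.inner_apply, conj_trivial]
    have e0' : d 0 = b 0 + c 0 - a 0 := by linarith
    have e1' : d 1 = b 1 + c 1 - a 1 := by linarith
    rw [e0', e1'] at h5
    linear_combination h5 / 4

/-- There is a similarity that maps a given square to the standard one. -/
theorem exists_dilationEquiv {a b c d : E 2} {s : ℝ} (hab : dist a b = s) (hac : dist a c = s)
    (hbd : dist b d = s) (hcd : dist c d = s) (had : dist a d = dist b c) (hbc : b ≠ c) :
    ∃ f : E 2 ≃ᵈ E 2, f a = !₂[-1, -1] ∧ f b = !₂[1, -1] ∧ f c = !₂[-1, 1] ∧ f d = !₂[1, 1] ∧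
      ∀ x y, dist (f x) (f y) = 2 / s * dist x y := by
  obtain ⟨hd, hinner⟩ := square_of_dist_eq hab hac hbd hcd had hbc
  have hs : 0 < s := by
    refine lt_of_le_of_ne (hab ▸ dist_nonneg) fun h => hbc ?_
    rw [← h, dist_eq_zero] at hab hac
    rw [← hab, ← hac]
  have hb : ‖b - a‖ = s := by rw [← dist_eq_norm, dist_comm, hab]
  have hc : ‖c - a‖ = s := by rw [← dist_eq_norm, dist_comm, hac]
  have hortho : Orthonormal ℝ ![s⁻¹ • (b - a), s⁻¹ • (c - a)] := by
    rw [orthonormal_vecCons_iff]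
    refine ⟨?_, ?_, ?_⟩
    · rw [norm_smul, hb, norm_inv, Real.norm_of_nonneg hs.le, inv_mul_cancel₀ hs.ne']
    · intro i
      fin_cases i
      simp [inner_smul_left, inner_smul_right, hinner]
    · rw [orthonormal_vecCons_iff]
      refine ⟨?_, fun i => i.elim0, ?_⟩
      · rw [norm_smul, hc, norm_inv, Real.norm_of_nonneg hs.le, inv_mul_cancel₀ hs.ne']
      · exact ⟨fun i => i.elim0, fun i => i.elim0⟩
  -- The two normalized sides already have the right number of elements, so the basis consists of
  -- them.
  obtain ⟨e, he⟩ := Orthonormal.exists_orthonormalBasis_extension_of_card_eq (s := Set.univ)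
    (ι := Fin 2) (𝕜 := ℝ) (E := E 2) (by simp) (v := ![s⁻¹ • (b - a), s⁻¹ • (c - a)])
    (hortho.comp _ Subtype.val_injective)
  have he0 : s • e 0 = b - a := by rw [he 0 trivial]; simp [smul_smul, hs.ne']
  have he1 : s • e 1 = c - a := by rw [he 1 trivial]; simp [smul_smul, hs.ne']
  have hk : s / 2 ≠ 0 := by positivity
  -- The centre of the square. The similarity moves it to the origin, scales by `2 / s` and takes
  -- coordinates in `e`.
  set m : E 2 := a + (s / 2) • (e 0 + e 1) with hm
  have key : ∀ x y : ℝ, ∀ p : E 2, p = m + (s / 2) • (x • e 0 + y • e 1) →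
      e.repr ((s / 2)⁻¹ • (p - m)) = !₂[x, y] := by
    rintro x y p rfl
    rw [add_sub_cancel_left, smul_smul, inv_mul_cancel₀ hk, one_smul, map_add, map_smul, map_smul,
      e.repr_self, e.repr_self]
    ext i
    fin_cases i <;> simp
  refine ⟨(DilationEquiv.smulTorsor m hk).symm.trans e.repr.toIsometryEquiv.toDilationEquiv,
    key (-1) (-1) a ?_, key 1 (-1) b ?_, key (-1) 1 c ?_, key 1 1 d ?_, fun x y => ?_⟩
  · rw [hm]; module
  · rw [hm, ← sub_add_cancel b a, ← he0]; module
  · rw [hm, ← sub_add_cancel c a, ← he1]; module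
  · rw [hm, ← sub_add_cancel d a, hd, ← he0, ← he1]; module
  · change dist (e.repr ((s / 2)⁻¹ • (x - m))) (e.repr ((s / 2)⁻¹ • (y - m))) = _
    rw [LinearIsometryEquiv.dist_map, dist_smul₀, dist_sub_right, norm_inv,
      Real.norm_of_nonneg (by positivity), inv_div]

theorem eq_of_two_coords {p : E 2} {x y : ℝ} (h0 : p 0 = x) (h1 : p 1 = y) : p = !₂[x, y] := by
  ext i
  fin_cases i <;> simp [h0, h1]

theorem one_lt_sqrt_three : 1 < √3 := by rw [Real.lt_sqrt] <;> norm_num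

/-- The coordinates of the apex of an equilateral triangle, up to a reflection. -/
theorem apex_coords {x y : ℝ} (h1 : (x + 1) ^ 2 + (y - 1) ^ 2 = 4)
    (h2 : (x - 1) ^ 2 + (y - 1) ^ 2 = 4) (h3 : 4 < (x + 1) ^ 2 + (y + 1) ^ 2) :
    x = 0 ∧ y = 1 + √3 := by
  have hx : x = 0 := by linarith
  subst hx
  refine ⟨rfl, ?_⟩
  -- Subtracting `h1` from `h3` leaves `0 < 4 * y`. This discards the inward apex `1 - √3`.
  have hy : 0 < y := by nlinarith
  have h4 : (y - 1 - √3) * (y - 1 + √3) = 0 := by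
    have := Real.sq_sqrt (show (0 : ℝ) ≤ 3 by norm_num)
    linear_combination h1 - this
  rcases mul_eq_zero.1 h4 with h | h
  · linarith
  · linarith [one_lt_sqrt_three]

/-- The vertices of a square together with the apexes of the equilateral triangles erected outwards
on its sides form a set similar to `squareWithTriangles`. -/
theorem similarSets_of_dist {a b c d p q r u : E 2} {s : ℝ} (hab : dist a b = s)
    (hac : dist a c = s) (hbd : dist b d = s) (hcd : dist c d = s) (had : dist a d = dist b c)
    (hbc : b ≠ c) (hpa : dist p a = s) (hpb : dist p b = s) (hpc : s < dist p c)
    (hqa : dist q a = s) (hqc : dist q c = s) (hqb : s < dist q b) (hrb : dist r b = s)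
    (hrd : dist r d = s) (hra : s < dist r a) (huc : dist u c = s) (hud : dist u d = s)
    (hua : s < dist u a) :
    SimilarSets {d, c, a, b, r, u, q, p} squareWithTriangles := by
  obtain ⟨f, fa, fb, fc, fd, hf⟩ := exists_dilationEquiv hab hac hbd hcd had hbc
  have hs : 0 < s := by
    refine lt_of_le_of_ne (hab ▸ dist_nonneg) fun h => hbc ?_
    rw [← h, dist_eq_zero] at hab hac
    rw [← hab, ← hac]
  have heq : ∀ {x y}, dist x y = s → dist (f x) (f y) ^ 2 = 4 := fun {x y} h => by
    rw [hf, h, div_mul_cancel₀ _ hs.ne']; norm_num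
  have hlt : ∀ {x y}, s < dist x y → 4 < dist (f x) (f y) ^ 2 := fun {x y} h => by
    have : 2 < 2 / s * dist x y := by rw [div_mul_eq_mul_div, lt_div_iff₀ hs]; linarith
    rw [hf]
    nlinarith
  replace hpa := heq hpa
  replace hpb := heq hpb
  replace hpc := hlt hpc
  replace hqa := heq hqa
  replace hqc := heq hqc
  replace hqb := hlt hqb
  replace hrb := heq hrb
  replace hrd := heq hrd
  replace hra := hlt hra
  replace huc := heq huc
  replace hud := heq hud
  replace hua := hlt hua
  simp only [fa, fb, fc, fd, dist_sq_eq, Matrix.cons_val_zero, Matrix.cons_val_one]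
    at hpa hpb hpc hqa hqc hqb hrb hrd hra huc hud hua
  have fp : f p = !₂[0, -(1 + √3)] := by
    obtain ⟨h0, h1⟩ := apex_coords (x := f p 0) (y := -f p 1) (by linarith) (by linarith)
      (by linarith)
    exact eq_of_two_coords h0 (by linarith)
  have fq : f q = !₂[-(1 + √3), 0] := by
    obtain ⟨h0, h1⟩ := apex_coords (x := f q 1) (y := -f q 0) (by linarith) (by linarith)
      (by linarith)
    exact eq_of_two_coords (by linarith) h0
  have fr : f r = !₂[1 + √3, 0] := by
    obtain ⟨h0, h1⟩ := apex_coords (x := f r 1) (y := f r 0) (by linarith) (by linarith)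
      (by linarith)
    exact eq_of_two_coords h1 h0
  have fu : f u = !₂[0, 1 + √3] := by
    obtain ⟨h0, h1⟩ := apex_coords (x := f u 0) (y := f u 1) (by linarith) (by linarith)
      (by linarith)
    exact eq_of_two_coords h0 h1
  refine ⟨f, ?_⟩
  simp only [Set.image_insert_eq, Set.image_singleton, fa, fb, fc, fd, fp, fq, fr, fu,
    squareWithTriangles]

/-- The points `p₀, …, p₃` form a square of side colour `6` and `p₄, …, p₇` one of side colour `0`.
Each point of one square has distance `v 0` to two neighbouring vertices of the other and distance
`v 6` to the remaining two. -/
theorem similarSets_of_areRows {D : List (ℕ × ℝ)} (hD : SamePattern D) {ps : List (E 2)}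
    (hps : ps.Nodup) (h : AreRows D squareRows ps) :
    SimilarSets {p | p ∈ ps} squareWithTriangles := by
  obtain ⟨v, hv⟩ := hD.exists_val
  unfold squareRows at h
  rcases h with _ | @⟨p₀, _, _, _, h₀, h⟩
  rcases h with _ | @⟨p₁, _, _, _, h₁, h⟩
  rcases h with _ | @⟨p₂, _, _, _, h₂, h⟩
  rcases h with _ | @⟨p₃, _, _, _, h₃, h⟩
  rcases h with _ | @⟨p₄, _, _, _, h₄, h⟩
  rcases h with _ | @⟨p₅, _, _, _, h₅, h⟩
  rcases h with _ | @⟨p₆, _, _, _, h₆, h⟩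
  rcases h with _ | @⟨p₇, _, _, _, h₇, h⟩
  cases h
  simp only [IsRow, List.forall₂_cons, List.Forall₂.nil, and_true] at h₀ h₁ h₂ h₃ h₄ h₅ h₆
  obtain ⟨d01, d02, d03, d04, d05, d06, d07⟩ := h₀
  obtain ⟨d12, d13, d14, d15, d16, d17⟩ := h₁
  obtain ⟨d23, d24, d25, d26, d27⟩ := h₂
  obtain ⟨d34, d35, d36, d37⟩ := h₃
  obtain ⟨d45, d46, d47⟩ := h₄
  obtain ⟨d56, d57⟩ := h₅
  have hne : v 0 ≠ v 6 := fun h => by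
    have := (hD _ d01 _ d04).2 (by rw [← hv _ _ d01, ← hv _ _ d04, h])
    exact absurd this (by norm_num)
  have hv' : ∀ {c : ℕ} {x y : E 2}, (c, dist x y) ∈ D → dist y x = v c := fun {c x y} hc => by
    rw [hv _ _ hc, dist_comm]
  simp only [List.nodup_cons, List.mem_cons, not_or] at hps
  -- The two squares play symmetric roles under an exchange of the colours `0` and `6`. The shorter
  -- side belongs to the inner square, and the strict inequality puts the triangles outside.
  rcases lt_or_gt_of_ne hne with hlt | hlt
  · have := similarSets_of_dist (a := p₄) (b := p₅) (c := p₆) (d := p₇) (p := p₀) (q := p₁)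
      (r := p₂) (u := p₃) (s := v 0) (hv _ _ d45).symm (hv _ _ d46).symm (hv _ _ d57).symm
      (hv _ _ h₆).symm
      ((hv _ _ d47).symm.trans (hv _ _ d56)) hps.2.2.2.2.2.1.1 (hv _ _ d04).symm (hv _ _ d05).symm
      (hlt.trans_eq (hv _ _ d06)) (hv _ _ d14).symm (hv _ _ d16).symm (hlt.trans_eq (hv _ _ d15))
      (hv _ _ d25).symm (hv _ _ d27).symm (hlt.trans_eq (hv _ _ d24)) (hv _ _ d36).symm
      (hv _ _ d37).symm (hlt.trans_eq (hv _ _ d34))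
    convert this using 1
    ext x
    simp only [List.mem_cons, List.not_mem_nil, or_false, Set.mem_ofPred_eq, Set.mem_insert_iff,
      Set.mem_singleton_iff]
    exact Iff.of_eq (by ac_rfl)
  · have := similarSets_of_dist (a := p₀) (b := p₁) (c := p₂) (d := p₃) (p := p₇) (q := p₆)
      (r := p₅) (u := p₄) (s := v 6) (hv _ _ d01).symm (hv _ _ d02).symm (hv _ _ d13).symm
      (hv _ _ d23).symm
      ((hv _ _ d03).symm.trans (hv _ _ d12)) hps.2.1.1 (hv' d07) (hv' d17)
      (hlt.trans_eq (hv' d27).symm) (hv' d06) (hv' d26) (hlt.trans_eq (hv' d16).symm)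
      (hv' d15) (hv' d35) (hlt.trans_eq (hv' d05).symm) (hv' d24) (hv' d34)
      (hlt.trans_eq (hv' d04).symm)
    convert this using 1
    ext x
    simp only [List.mem_cons, List.not_mem_nil, or_false, Set.mem_ofPred_eq, Set.mem_insert_iff,
      Set.mem_singleton_iff]
    exact Iff.of_eq (by ac_rfl)

/-! ### The eight-point set -/

theorem encard_squareWithTriangles : squareWithTriangles.encard = 8 := by
  have h := one_lt_sqrt_three
  have hne : ∀ {x y z w : ℝ}, (x ≠ z ∨ y ≠ w) → (!₂[x, y] : E 2) ≠ !₂[z, w] := by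
    intro x y z w hor heq
    have h0 := congrArg (fun p : E 2 => p 0) heq
    have h1 := congrArg (fun p : E 2 => p 1) heq
    simp only [Matrix.cons_val_zero, Matrix.cons_val_one] at h0 h1
    tauto
  have hnodup : [(!₂[1, 1] : E 2), !₂[-1, 1], !₂[-1, -1], !₂[1, -1], !₂[1 + √3, 0], !₂[0, 1 + √3],
      !₂[-(1 + √3), 0], !₂[0, -(1 + √3)]].Nodup := by
    simp only [List.nodup_cons, List.mem_cons, List.not_mem_nil, or_false, not_or, List.nodup_nil,
      and_true, not_false_eq_true]
    refine ⟨⟨?_, ?_, ?_, ?_, ?_, ?_, ?_⟩, ⟨?_, ?_, ?_, ?_, ?_, ?_⟩, ⟨?_, ?_, ?_, ?_, ?_⟩,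
      ⟨?_, ?_, ?_, ?_⟩, ⟨?_, ?_, ?_⟩, ⟨?_, ?_⟩, ?_⟩ <;> apply hne <;>
    first
    | (left; intro h'; linarith)
    | (right; intro h'; linarith)
  classical
  have : squareWithTriangles = ((List.toFinset [(!₂[1, 1] : E 2), !₂[-1, 1], !₂[-1, -1], !₂[1, -1],
      !₂[1 + √3, 0], !₂[0, 1 + √3], !₂[-(1 + √3), 0], !₂[0, -(1 + √3)]] : Finset (E 2)) :
      Set (E 2)) := by
    ext x; simp [squareWithTriangles]
  rw [this, Set.encard_coe_eq_coe_finsetCard, List.toFinset_card_of_nodup hnodup]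
  rfl

theorem isLocallyDistanceSet_squareWithTriangles :
    IsLocallyDistanceSet 3 squareWithTriangles := by
  have h3 : √3 ^ 2 = 3 := Real.sq_sqrt (by norm_num)
  have hsub : ∀ x ∈ squareWithTriangles, ∃ t : ℝ, ∀ y ∈ squareWithTriangles, x ≠ y →
      dist x y ^ 2 = 4 ∨ dist x y ^ 2 = 8 + 4 * √3 ∨ dist x y ^ 2 = t := by
    have key : ∀ x ∈ squareWithTriangles, ∃ t : ℝ, ∀ y ∈ squareWithTriangles,
        dist x y ^ 2 = 0 ∨ dist x y ^ 2 = 4 ∨ dist x y ^ 2 = 8 + 4 * √3 ∨ dist x y ^ 2 = t := by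
      simp only [squareWithTriangles, Set.forall_mem_insert, Set.mem_singleton_iff, forall_eq,
        dist_sq_eq, Matrix.cons_val_zero, Matrix.cons_val_one]
      -- Every point has the squared distances `4` and `8 + 4 * √3`. The third one is that of the
      -- opposite point: `8` for a vertex of the square and `(2 * (1 + √3)) ^ 2` for an apex.
      refine ⟨⟨8, ?_⟩, ⟨8, ?_⟩, ⟨8, ?_⟩, ⟨8, ?_⟩, ⟨16 + 8 * √3, ?_⟩, ⟨16 + 8 * √3, ?_⟩,
        ⟨16 + 8 * √3, ?_⟩, ⟨16 + 8 * √3, ?_⟩⟩ <;>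
      refine ⟨?_, ?_, ?_, ?_, ?_, ?_, ?_, ?_⟩ <;>
      first
      | (left; linear_combination (0 : ℝ) * h3)
      | (right; left; linear_combination (0 : ℝ) * h3)
      | (right; left; linear_combination h3)
      | (right; right; left; linear_combination h3)
      | (right; right; left; linear_combination 2 * h3)
      | (right; right; right; linear_combination (0 : ℝ) * h3)
      | (right; right; right; linear_combination 4 * h3)
    intro x hx
    obtain ⟨t, ht⟩ := key x hx
    exact ⟨t, fun y hy hxy => (ht y hy).resolve_left (pow_ne_zero 2 (dist_pos.2 hxy).ne')⟩
  intro x hx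
  obtain ⟨t, ht⟩ := hsub x hx
  have hle : distancesFrom squareWithTriangles x ⊆ {√4, √(8 + 4 * √3), √t} := by
    rintro _ ⟨y, hy, hxy, rfl⟩
    simp only [Set.mem_insert_iff, Set.mem_singleton_iff]
    rw [← Real.sqrt_sq (dist_nonneg (x := x) (y := y))]
    rcases ht y hy hxy with h | h | h <;> simp [h]
  refine (Set.encard_le_encard hle).trans ?_
  refine (Set.encard_insert_le _ _).trans ?_
  refine (add_le_add_left (Set.encard_insert_le _ _) 1).trans ?_
  rw [Set.encard_singleton]
  norm_num

theorem eq_setOf_mem {X : Set (E 2)} (h8 : X.encard = 8) {ps : List (E 2)} (hps : ps.Nodup)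
    (hsub : ∀ p ∈ ps, p ∈ X) (hlen : ps.length = 8) : X = {p | p ∈ ps} := by
  classical
  have hfin : X.Finite := Set.finite_of_encard_eq_coe (k := 8) h8
  have h : {p | p ∈ ps} = (ps.toFinset : Set (E 2)) := by ext; simp
  have hsub' : {p | p ∈ ps} ⊆ X := fun p hp => hsub p hp
  refine (hfin.eq_of_subset_of_encard_le' hsub' ?_).symm
  rw [h8, h, Set.encard_coe_eq_coe_finsetCard, List.toFinset_card_of_nodup hps, hlen]
  rfl

end ThreeDistance

/-! ### The main theorem. -/

open ThreeDistance

theorem mainTheorem11 :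
    (∀ X : Set (E 2), X.encard = 8 → IsLocallyDistanceSet 3 X →
      SimilarSets X squareWithTriangles) ∧
    IsGreatest (locallyDistanceSetCards 2 3) 8 := by
  refine ⟨fun X h8 hX => ?_, ⟨squareWithTriangles, isLocallyDistanceSet_squareWithTriangles,
    encard_squareWithTriangles⟩, ?_⟩
  · obtain ⟨D, ps, hD, hrows, hps, hsub, hlen⟩ := exists_areRows_squareRows hX h8.ge
    rw [eq_setOf_mem h8 hps hsub hlen]
    exact similarSets_of_areRows hD hps hrows
  · rintro n ⟨X, hX, rfl⟩
    exact encard_le_eight hX
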